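/- **Setting.** Let $v_1,v_2,\dots>0$, let $a,b:[0,\infty)\to\mathbb R$ be smooth nondecreasing functions with $a(0)=b(0)=0$, and let $y_1>y_2>\cdots$ be integers. PushASEP is the continuous-time Markov dynamics of particles on $\mathbb Z$ with positions $x_1(t)>x_2(t)>\cdots$ and $x_n(0)=y_n$, in which particle $n$ jumps one step to the right at rate $\dot a(t)v_n$, provided the target site is empty, and jumps one step to the left at rate $\dot b(t)/v_n$, pushing one step to the left all the particles of the contiguous block directly to its left. For every $N$ the evolution of $(x_1,\dots,x_N)$ is not influenced by the other particles: it is the Markov process on decreasing $N$-tuples whose transition probabilities solve the corresponding Kolmogorov forward (master) equation; this determines the law of all finite-dimensional distributions. Write $(n,t)\prec(n',t')$ if $n\le n'$, $t\ge t'$ and $(n,t)\ne(n',t')$. Let $\Gamma_0$ be a positively oriented circle centred at $0$ that encloses no pole $1/v_j$ (of the finitely many rates involved), and put, for $n,l\ge1$, $t\ge 0$, $x\in\mathbb Z$, $$\Psi^{n,t}_{n-l}(x)=\frac1{2\pi i}\oint_{\Gamma_0}dz\,z^{x-y_l-1}e^{a(t)/z+b(t)z}\,\frac{(1-v_1z)\cdots(1-v_nz)}{(1-v_1z)\cdots(1-v_lz)},$$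 $$\phi^{((n_1,t_1),(n_2,t_2))}(x,y)=\mathbf 1_{[(n_1,t_1)\prec(n_2,t_2)]}\,\frac1{2\pi i}\oint_{\Gamma_0}\frac{dz}{z^{y-x+1}}\,\frac{e^{(a(t_1)-a(t_2))/z}\,e^{(b(t_1)-b(t_2))z}}{(1-v_{n_1+1}z)\cdots(1-v_{n_2}z)}.$$ Let $u_1<\dots<u_\nu$ be the different values among $v_1,\dots,v_n$, with multiplicities $\alpha_1,\dots,\alpha_\nu$, and let $V_n=\mathrm{span}\{x\mapsto x^l u_k^x:\ 1\le k\le\nu,\ 0\le l\le\alpha_k-1\}$, a space of functions on $\mathbb Z$. **Proposition 3.1.** (1) For all $n\ge1$ and $t\ge0$ there is exactly one family $\{\Phi^{n,t}_{n-k}\}_{k=1}^n$ of functions on $\mathbb Z$ such that $$\sum_{x\in\mathbb Z}\Psi^{n,t}_{n-l}(x)\,\Phi^{n,t}_{n-k}(x)=\delta_{k,l}\quad(1\le k,l\le n)$$ (with absolutely convergent sums) and $\mathrm{span}\{\Phi^{n,t}_{n-k}:1\le k\le n\}=V_n$. (2) Let $(n_1,t_1)\prec(n_2,t_2)\prec\dots\prec(n_m,t_m)$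 with $n_k\ge1$, $t_k\ge0$, and let $s_1,\dots,s_m\in\mathbb R$. Put $\tilde\chi_s((n_k,t_k))(x)=\mathbf 1(x<s_k)$ and $$K((n,t),x;(n',t'),x')=-\phi^{((n,t),(n',t'))}(x,x')+\sum_{k=1}^{n'}\Psi^{n,t}_{n-k}(x)\,\Phi^{n',t'}_{n'-k}(x').$$ Then $$\mathbb P\Big(\bigcap_{k=1}^m\{x_{n_k}(t_k)\ge s_k\}\Big)=\det\big(\mathbf 1-\tilde\chi_sK\tilde\chi_s\big)_{\ell^2(\{(n_1,t_1),\dots,(n_m,t_m)\}\times\mathbb Z)},$$ where, for a kernel $A$ on a discrete set $X$, the Fredholm determinant $\det(\mathbf 1-A)$ is the Fredholm series $\sum_{r\ge0}\frac{(-1)^r}{r!}\sum_{p_1,\dots,p_r\in X}\det[A(p_i,p_j)]_{i,j=1}^r$; for $A=\tilde\chi_sK\tilde\chi_s$ this series converges absolutely, as a series over all $r$ and all $(p_1,\dots,p_r)$. -/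

import Mathlib

namespace PushASEP

/-! Particles are labelled `1, 2, 3, …` from right to left. A configuration of the first `N`
particles is a map `η : Fin N → ℤ`, where `η k` is the position of the particle with label `k + 1`;
only strictly decreasing `η` represent genuine configurations. -/

/-- Particle `k` jumps one site to the right. -/
def jumpRight {N : ℕ} (η : Fin N → ℤ) (k : Fin N) : Fin N → ℤ :=
  Function.update η k (η k + 1)

/-- Particle `k` jumps one site to the left, pushing by one site every particle of the block of
contiguous particles that starts at `k` and extends to its left. -/
def pushLeft {N : ℕ} (η : Fin N → ℤ) (k : Fin N) : Fin N → ℤ :=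
  fun j => if k ≤ j ∧ η j = η k - (((j : ℕ) : ℤ) - ((k : ℕ) : ℤ)) then η j - 1 else η j

/-- The generator at time `t` of the `N`-particle PushASEP. The particle with label `n` jumps to the
right at rate `a'(t) v n`, provided the target site is empty, and to the left (pushing) at rate
`b'(t) / v n`. The derivatives are one-sided at time `0`. -/
noncomputable def generator (v : ℕ → ℝ) (a b : ℝ → ℝ) {N : ℕ} (t : ℝ)
    (f : (Fin N → ℤ) → ℝ) (η : Fin N → ℤ) : ℝ :=
  ∑ k : Fin N,
    ((if ∀ j, η j ≠ η k + 1 then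
        derivWithin a (Set.Ici 0) t * v (k + 1) * (f (jumpRight η k) - f η)
      else 0)
      + derivWithin b (Set.Ici 0) t / v (k + 1) * (f (pushLeft η k) - f η))

/-- `p s t η ζ` is the probability that the `N`-particle PushASEP is in state `ζ` at time `t` if it
is in state `η` at time `s ≤ t`: for each initial configuration, a probability distribution that
evolves by the master equation (Kolmogorov forward equation) of the model. In `forward` only
finitely many terms of the sum over `ξ` are nonzero: `generator … (𝟙_ζ) ξ` is the `(ξ, ζ)` entry of
the matrix of jump rates. -/
structure IsTransitionFunction (v : ℕ → ℝ) (a b : ℝ → ℝ) {N : ℕ}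
    (p : ℝ → ℝ → (Fin N → ℤ) → (Fin N → ℤ) → ℝ) : Prop where
  nonneg : ∀ s t η ζ, 0 ≤ s → s ≤ t → StrictAnti η → 0 ≤ p s t η ζ
  hasSum_one : ∀ s t η, 0 ≤ s → s ≤ t → StrictAnti η → HasSum (fun ζ => p s t η ζ) 1
  initial : ∀ s η ζ, 0 ≤ s → StrictAnti η → p s s η ζ = if ζ = η then 1 else 0
  forward : ∀ s t η ζ, 0 ≤ s → s ≤ t → StrictAnti η →
    HasDerivWithinAt (fun u => p s u η ζ)
      (∑' ξ : Fin N → ℤ, p s t η ξ * generator v a b t (fun ω => if ω = ζ then 1 else 0) ξ)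
      (Set.Ici s) t

/-- `x n t` (`n ≥ 1`, `t ≥ 0`) are the positions of the particles of a PushASEP with particles
`1, 2, …` started from `y 1 > y 2 > …`: for every `N`, the first `N` particles (which are not
influenced by the others) form a Markov process started from `(y 1, …, y N)` with the transition
function of the `N`-particle PushASEP. -/
structure IsPushASEP {Ω : Type*} [MeasurableSpace Ω] (μ : MeasureTheory.Measure Ω)
    (v : ℕ → ℝ) (a b : ℝ → ℝ) (y : ℕ → ℤ) (x : ℕ → ℝ → Ω → ℤ) : Prop where
  measurable : ∀ n t, 1 ≤ n → 0 ≤ t → Measurable (x n t)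
  law : ∀ N : ℕ, ∃ p : ℝ → ℝ → (Fin N → ℤ) → (Fin N → ℤ) → ℝ,
    IsTransitionFunction v a b p ∧
    ∀ (r : ℕ) (τ : Fin (r + 1) → ℝ) (ζ : Fin (r + 1) → Fin N → ℤ),
      Monotone τ → τ 0 = 0 → (∀ k : Fin N, ζ 0 k = y (k + 1)) →
      μ.real {ω | ∀ (i : Fin (r + 1)) (k : Fin N), x (k + 1) (τ i) ω = ζ i k} =
        ∏ i : Fin r, p (τ i.castSucc) (τ i.succ) (ζ i.castSucc) (ζ i.succ)

/-- `(n₁, t₁) ≺ (n₂, t₂)`. -/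
def Prec (n₁ : ℕ) (t₁ : ℝ) (n₂ : ℕ) (t₂ : ℝ) : Prop :=
  n₁ ≤ n₂ ∧ t₂ ≤ t₁ ∧ (n₁, t₁) ≠ (n₂, t₂)

/-- The circle of radius `ρ` around `0` is a loop `Γ₀` for the rates `v 1, …, v n`: it encloses the
point `0` but none of the points `1 / v j`, `1 ≤ j ≤ n`. -/
def IsSmallRadius (v : ℕ → ℝ) (n : ℕ) (ρ : ℝ) : Prop :=
  0 < ρ ∧ ∀ j, 1 ≤ j → j ≤ n → ρ < 1 / v j

/-- `Psi v a b y ρ n t l x` is `Ψ^{n,t}_{n-l}(x)`, for `l ≥ 1`, with `Γ₀` the circle of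
radius `ρ`. -/
noncomputable def Psi (v : ℕ → ℝ) (a b : ℝ → ℝ) (y : ℕ → ℤ) (ρ : ℝ)
    (n : ℕ) (t : ℝ) (l : ℕ) (x : ℤ) : ℂ :=
  (2 * Real.pi * Complex.I)⁻¹ *
    ∮ z in C(0, ρ), z ^ (x - y l - 1) * Complex.exp (a t / z + b t * z) *
      ((∏ j ∈ Finset.Icc 1 n, (1 - v j * z)) / ∏ j ∈ Finset.Icc 1 l, (1 - v j * z))

open Classical in
/-- `phi v a b ρ n₁ t₁ n₂ t₂ x y` is `φ^{((n₁,t₁),(n₂,t₂))}(x, y)`, with `Γ₀` the circle of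
radius `ρ`. -/
noncomputable def phi (v : ℕ → ℝ) (a b : ℝ → ℝ) (ρ : ℝ)
    (n₁ : ℕ) (t₁ : ℝ) (n₂ : ℕ) (t₂ : ℝ) (x y : ℤ) : ℂ :=
  if Prec n₁ t₁ n₂ t₂ then
    (2 * Real.pi * Complex.I)⁻¹ *
      ∮ z in C(0, ρ), 1 / z ^ (y - x + 1) *
        (Complex.exp ((a t₁ - a t₂) / z) * Complex.exp ((b t₁ - b t₂) * z) /
          ∏ j ∈ Finset.Ioc n₁ n₂, (1 - v j * z))
  else 0

/-- The space `V_n`, spanned by the functions `x ↦ x ^ l * u ^ x` on `ℤ`, where `u` is one of the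
values `v 1, …, v n` and `0 ≤ l ≤ α - 1` with `α` the multiplicity of `u` among them. -/
noncomputable def V (v : ℕ → ℝ) (n : ℕ) : Submodule ℂ (ℤ → ℂ) :=
  Submodule.span ℂ {f | ∃ j l : ℕ, 1 ≤ j ∧ j ≤ n ∧
    l < ((Finset.Icc 1 n).filter (fun i => v i = v j)).card ∧
    f = fun x : ℤ => (x : ℂ) ^ l * (v j : ℂ) ^ x}

/-- The requirements on the functions `Φ^{n,t}_{n-k}`, `1 ≤ k ≤ n`: biorthogonality to the
`Ψ^{n,t}_{n-l}`, and spanning `V_n`. Here `Φ i` is `Φ^{n,t}_{n-k}` with `k = i + 1`. -/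
structure IsDual (v : ℕ → ℝ) (a b : ℝ → ℝ) (y : ℕ → ℤ) (ρ : ℝ) (n : ℕ) (t : ℝ)
    (Φ : Fin n → ℤ → ℂ) : Prop where
  orthogonal : ∀ k l : Fin n,
    HasSum (fun x : ℤ => Psi v a b y ρ n t (l + 1) x * Φ k x) (if k = l then 1 else 0)
  span_eq : Submodule.span ℂ (Set.range Φ) = V v n

/-- The kernel `K((n₁,t₁),x₁; (n₂,t₂),x₂)`, where `Φ n t i` is `Φ^{n,t}_{n-(i+1)}`. -/
noncomputable def kernel (v : ℕ → ℝ) (a b : ℝ → ℝ) (y : ℕ → ℤ) (ρ : ℝ)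
    (Φ : (n : ℕ) → ℝ → Fin n → ℤ → ℂ)
    (n₁ : ℕ) (t₁ : ℝ) (x₁ : ℤ) (n₂ : ℕ) (t₂ : ℝ) (x₂ : ℤ) : ℂ :=
  -phi v a b ρ n₁ t₁ n₂ t₂ x₁ x₂ +
    ∑ k : Fin n₂, Psi v a b y ρ n₁ t₁ (k + 1) x₁ * Φ n₂ t₂ k x₂

/-- The Fredholm determinant `det(1 - A)` on `ℓ²(X)`, `X` discrete, exists and equals `d`: the
Fredholm series `∑ r, (-1)^r / r! ∑_{p₁,…,p_r ∈ X} det [A(p_i, p_j)]` converges absolutely, as a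
series over all `r` and all `(p₁,…,p_r)`, and its sum is `d`. -/
def HasFredholmDet {X : Type*} (A : X → X → ℂ) (d : ℂ) : Prop :=
  HasSum (fun q : Σ r : ℕ, (Fin r → X) =>
    (-1 : ℂ) ^ q.1 / (q.1.factorial : ℂ) *
      Matrix.det (Matrix.of fun i j : Fin q.1 => A (q.2 i) (q.2 j))) d

/-- The multiplication operator `χ̃_s`: `χ̃_s(k)(x) = 𝟙(x < s k)`. -/
noncomputable def chi {m : ℕ} (s : Fin m → ℝ) (p : Fin m × ℤ) : ℂ :=
  if (p.2 : ℝ) < s p.1 then 1 else 0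

end PushASEP

/-! Both sides of the identity equal one N × N determinant, N being the largest particle label on
the path.

Algebra. Functions on ℤ are treated as Laurent coefficient sequences: multiplication by z becomes
the shift T, products become convolutions, and `V v n` is the kernel of ∏ (1 - v_j T) (`mem_V_iff`).
Pairing Ψ^{n,t}_{n-l} with f ∈ V_n is then evaluation at y_l of ∏_{l<j≤n} (1 - v_j T) applied to the
convolution of f with the coefficients of e^{a/z+bz} (`hasSum_Psi_mul`). In a suitable basis of V_n
the pairing matrix is triangular with nonzero diagonal, which gives existence and uniqueness of the
dual functions.

Determinant. The function φ uses the expansion on a small circle. Replacing it by the expansion of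
the same function on a large circle changes it by an element of V_n, and this change is exactly
absorbed by the Ψ's in the sum (`Chain.kernel_eq`). The regularised kernel is strictly triangular in
the time index plus a term of rank N, its two-time parts form a semigroup, and geometric weights
make it square summable. Hence its Fredholm determinant reduces to an N × N determinant
(`hasFredholmDet_of_finite_rank`, `Chain.matrix_eq`), built from the last dual functions, corrected
by the contributions of the other times and cut to x ≥ s.

Probability. A product of powers and exponentials times a determinant (`backFun`) solves the
backward equation of independent walks. A linear relation between neighbouring columns produces both
the exclusion of right jumps and the pushing of left jumps (`backFun_relation`,
`BoundaryRelation.jumpGen_eq`), so its expectation propagates along PushASEP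
(`IsTransitionFunction.tsum_backFun`, via Dynkin's formula). At its final time the determinant
vanishes if particle n is to the left of s; otherwise it collapses to the function of the
chronologically next observation (`backFun_terminal`), because the corrected dual functions satisfy
the matching recursion (`Chain.DD_step`). Iterating with the Markov property expresses the
probability as the function of the earliest observation at time 0 and configuration y, which is the
same N × N determinant (`Chain.levelFun_init`). -/

namespace PushASEP
open Filter Topology

/-! ### Laurent expansions on circles and their coefficient sequences -/

/-- Absolute summability of `∑ c k * z ^ k` on the circle of radius `r`. -/
def Wt (r : ℝ) (c : ℤ → ℂ) : Prop := Summable fun k : ℤ => ‖c k‖ * r ^ k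

/-- Convolution of two-sided sequences. -/
noncomputable def conv (c d : ℤ → ℂ) (n : ℤ) : ℂ := ∑' k, c k * d (n - k)

/-- `g` has the absolutely convergent Laurent expansion `∑ c k * z ^ k` on the circle `|z| = r`. -/
structure HasLaurent (r : ℝ) (g : ℂ → ℂ) (c : ℤ → ℂ) : Prop where
  summable : Wt r c
  hasSum : ∀ z : ℂ, ‖z‖ = r → HasSum (fun k => c k * z ^ k) (g z)

lemma circleIntegral_zpow {r : ℝ} (hr : 0 < r) (n : ℤ) :
    (∮ z in C(0, r), z ^ n) = if n = -1 then 2 * Real.pi * Complex.I else 0 := by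
  split_ifs with h
  · subst h
    simpa using circleIntegral.integral_sub_center_inv 0 hr.ne'
  · simpa using circleIntegral.integral_sub_zpow_of_ne h 0 0 r

/-- Termwise integration leaves only the power z⁻¹. This turns the contour integrals defining Ψ and
φ into coefficients, and makes the expansion on a given circle unique, so that identities between
sequences can be checked on functions. -/
lemma HasLaurent.coeff {r : ℝ} {g : ℂ → ℂ} {c : ℤ → ℂ} (hr : 0 < r) (h : HasLaurent r g c)
    (k : ℤ) : (2 * Real.pi * Complex.I)⁻¹ * ∮ z in C(0, r), z ^ (-k - 1) * g z = c k := by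
  have h1 : HasSum (fun j : ℤ => ∮ z in C(0, r), z ^ (-k - 1) * (c j * z ^ j))
      (∮ z in C(0, r), z ^ (-k - 1) * g z) := by
    unfold circleIntegral
    apply intervalIntegral.hasSum_integral_of_dominated_convergence
      (bound := fun j _ => r * (r ^ (-k - 1) * (‖c j‖ * r ^ j)))
    · intro j
      refine Continuous.aestronglyMeasurable ?_
      have hc : Continuous (circleMap 0 r) := continuous_circleMap 0 r
      have hne : ∀ θ, circleMap 0 r θ ≠ 0 := fun θ => circleMap_ne_center hr.ne'
      simp only [deriv_circleMap, smul_eq_mul]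
      have : ∀ n : ℤ, Continuous fun θ => (circleMap 0 r θ) ^ n := fun n =>
        hc.zpow₀ n (fun θ => Or.inl (hne θ))
      have h1 := this (-k-1)
      have h2 := this j
      fun_prop
    · intro j
      refine Eventually.of_forall fun θ _ => ?_
      simp [abs_of_pos hr]
    · refine Eventually.of_forall fun θ _ => ?_
      exact (h.summable.mul_left _).mul_left _
    · simp
    · refine Eventually.of_forall fun θ _ => ?_
      have := h.hasSum (circleMap 0 r θ) (by simp [abs_of_pos hr])
      exact (this.mul_left _).const_smul _
  have h2 : (fun j : ℤ => ∮ z in C(0, r), z ^ (-k - 1) * (c j * z ^ j)) =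
      fun j => if j = k then c k * (2 * Real.pi * Complex.I) else 0 := by
    funext j
    have : (∮ z in C(0, r), z ^ (-k - 1) * (c j * z ^ j)) =
        ∮ z in C(0, r), c j * z ^ (j - k - 1) := by
      apply circleIntegral.integral_congr hr.le
      intro z hz
      have hz0 : z ≠ 0 := by
        rintro rfl
        simp at hz
        exact hr.ne hz
      simp only
      rw [show j - k - 1 = (-k - 1) + j by ring, zpow_add₀ hz0]
      ring
    rw [this, circleIntegral.integral_const_mul, circleIntegral_zpow hr]
    by_cases hjk : j = k
    · subst hjk; simp
    · rw [if_neg hjk, if_neg (by omega), mul_zero]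
  rw [h2] at h1
  have h3 := h1.unique (hasSum_ite_eq k (c k * (2 * Real.pi * Complex.I)))
  rw [h3]
  have : (2 * Real.pi * Complex.I : ℂ) ≠ 0 := by simp [Real.pi_ne_zero]
  field_simp

lemma HasLaurent.unique {r : ℝ} {g : ℂ → ℂ} {c d : ℤ → ℂ} (hr : 0 < r) (h : HasLaurent r g c)
    (h' : HasLaurent r g d) : c = d := by
  funext k
  rw [← h.coeff hr, h'.coeff hr]

lemma HasLaurent.congr {r : ℝ} {g g' : ℂ → ℂ} {c : ℤ → ℂ} (h : HasLaurent r g c)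
    (hg : ∀ z, ‖z‖ = r → g z = g' z) : HasLaurent r g' c :=
  ⟨h.summable, fun z hz => hg z hz ▸ h.hasSum z hz⟩

lemma Wt.hasLaurent {r : ℝ} {c : ℤ → ℂ} (h : Wt r c) :
    HasLaurent r (fun z => ∑' k, c k * z ^ k) c := by
  refine ⟨h, fun z hz => Summable.hasSum ?_⟩
  refine Summable.of_norm ?_
  simpa [hz] using (show Summable _ from h)

/-- The shear `(n, k) ↦ (k, n - k)`. -/
def shear : ℤ × ℤ ≃ ℤ × ℤ where
  toFun p := (p.2, p.1 - p.2)
  invFun p := (p.1 + p.2, p.1)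
  left_inv p := by simp
  right_inv p := by simp

/-- The shear turns the family into the product of two summable families; this is the Fubini
argument behind all statements on convolutions. -/
lemma Wt.summable_shear {r : ℝ} (hr : 0 < r) {c d : ℤ → ℂ} (hc : Wt r c) (hd : Wt r d) :
    Summable fun p : ℤ × ℤ => ‖c p.2 * d (p.1 - p.2)‖ * r ^ p.1 := by
  have h1 : Summable fun p : ℤ × ℤ => (‖c p.1‖ * r ^ p.1) * (‖d p.2‖ * r ^ p.2) :=
    Summable.mul_of_nonneg hc hd (fun k => by positivity) (fun k => by positivity)
  have h2 := (shear.summable_iff).2 h1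
  refine h2.congr fun p => ?_
  simp only [Function.comp, shear, Equiv.coe_fn_mk, norm_mul]
  have : r ^ p.1 = r ^ p.2 * r ^ (p.1 - p.2) := by
    rw [← zpow_add₀ hr.ne']; congr 1; ring
  rw [this]; ring

lemma Wt.summable_conv {r : ℝ} (hr : 0 < r) {c d : ℤ → ℂ} (hc : Wt r c) (hd : Wt r d) (n : ℤ) :
    Summable fun k => c k * d (n - k) := by
  have h1 := (hc.summable_shear hr hd).prod_factor n
  refine Summable.of_norm ?_
  have h2 := h1.mul_right ((r ^ n)⁻¹)
  refine h2.congr fun k => ?_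
  have : r ^ n ≠ 0 := by positivity
  simp only [mul_assoc, mul_inv_cancel₀ this, mul_one]

lemma Wt.convolve {r : ℝ} (hr : 0 < r) {c d : ℤ → ℂ} (hc : Wt r c) (hd : Wt r d) :
    Wt r (conv c d) := by
  have h1 := hc.summable_shear hr hd
  refine Summable.of_norm_bounded h1.prod (fun n => ?_)
  simp only [norm_mul, norm_norm]
  rw [tsum_mul_right, norm_zpow, Real.norm_of_nonneg hr.le]
  have h2 : Summable fun k => ‖c k * d (n - k)‖ := (hc.summable_conv hr hd n).norm
  have := norm_tsum_le_tsum_norm h2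
  simp only [norm_mul] at this
  gcongr
  exact this

lemma HasLaurent.mul {r : ℝ} (hr : 0 < r) {g g' : ℂ → ℂ} {c d : ℤ → ℂ} (h : HasLaurent r g c)
    (h' : HasLaurent r g' d) : HasLaurent r (fun z => g z * g' z) (conv c d) := by
  refine ⟨h.summable.convolve hr h'.summable, fun z hz => ?_⟩
  have hz0 : z ≠ 0 := by
    rintro rfl; simp at hz; exact hr.ne hz
  have s1 : Summable fun k => ‖c k * z ^ k‖ := by
    simpa [hz] using (show Summable _ from h.summable)
  have s2 : Summable fun k => ‖d k * z ^ k‖ := by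
    simpa [hz] using (show Summable _ from h'.summable)
  have h0 := summable_mul_of_summable_norm s1 s2
  have h1 := (h.hasSum z hz).mul (h'.hasSum z hz) h0
  have h2 := (shear.hasSum_iff).2 h1
  have h3 : HasSum (fun p : ℤ × ℤ => c p.2 * d (p.1 - p.2) * z ^ p.1) (g z * g' z) := by
    rw [show (fun p : ℤ × ℤ => c p.2 * d (p.1 - p.2) * z ^ p.1) =
      (fun p : ℤ × ℤ => (c p.1 * z ^ p.1) * (d p.2 * z ^ p.2)) ∘ shear from ?_]
    · exact h2
    funext p
    have : z ^ p.1 = z ^ p.2 * z ^ (p.1 - p.2) := by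
      rw [← zpow_add₀ hz0]; congr 1; ring
    simp only [Function.comp, shear, Equiv.coe_fn_mk, this]
    ring
  clear h0 h1 h2
  refine h3.prod_fiberwise fun n => ?_
  exact ((h.summable.summable_conv hr h'.summable n).hasSum).mul_right (z ^ n)

lemma HasLaurent.add {r : ℝ} {g g' : ℂ → ℂ} {c d : ℤ → ℂ} (hr : 0 < r) (h : HasLaurent r g c)
    (h' : HasLaurent r g' d) : HasLaurent r (fun z => g z + g' z) (c + d) := by
  refine ⟨?_, fun z hz => ?_⟩
  · refine Summable.of_nonneg_of_le (fun k => by positivity) (fun k => ?_)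
      (h.summable.add h'.summable)
    rw [← add_mul]
    gcongr
    exact norm_add_le _ _
  · simpa [add_mul] using (h.hasSum z hz).add (h'.hasSum z hz)

lemma HasLaurent.smul {r : ℝ} {g : ℂ → ℂ} {c : ℤ → ℂ} (a : ℂ) (h : HasLaurent r g c) :
    HasLaurent r (fun z => a * g z) (a • c) := by
  refine ⟨?_, fun z hz => ?_⟩
  · simpa [Wt, mul_assoc] using h.summable.mul_left ‖a‖
  · simpa [mul_assoc] using (h.hasSum z hz).mul_left a

/-- The shift `f ↦ f (· - 1)` on two-sided sequences. -/
def shift : Module.End ℂ (ℤ → ℂ) where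
  toFun f x := f (x - 1)
  map_add' _ _ := rfl
  map_smul' _ _ := rfl

@[simp] lemma shift_apply (f : ℤ → ℂ) (x : ℤ) : shift f x = f (x - 1) := rfl

/-- Multiplication by z shifts the coefficients; polynomials in the shift therefore act as
multiplication by polynomials in z. -/
lemma HasLaurent.mul_id {r : ℝ} (hr : 0 < r) {g : ℂ → ℂ} {c : ℤ → ℂ} (h : HasLaurent r g c) :
    HasLaurent r (fun z => z * g z) (shift c) := by
  refine ⟨?_, fun z hz => ?_⟩
  · have := ((Equiv.subRight (1 : ℤ)).summable_iff).2 (h.summable.mul_left r)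
    refine this.congr fun k => ?_
    simp only [Function.comp, Equiv.subRight_apply, shift_apply]
    rw [zpow_sub₀ hr.ne']; field_simp
  · have hz0 : z ≠ 0 := by
      rintro rfl; simp at hz; exact hr.ne hz
    have := ((Equiv.subRight (1 : ℤ)).hasSum_iff).2 ((h.hasSum z hz).mul_left z)
    refine this.congr_fun fun k => ?_
    simp only [Function.comp, Equiv.subRight_apply, shift_apply]
    rw [zpow_sub₀ hz0]; field_simp

open Polynomial in
lemma HasLaurent.aeval_mul {r : ℝ} (hr : 0 < r) {g : ℂ → ℂ} {c : ℤ → ℂ} (h : HasLaurent r g c)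
    (p : ℂ[X]) : HasLaurent r (fun z => p.eval z * g z) (aeval shift p c) := by
  induction p using Polynomial.induction_on' with
  | add p q hp hq =>
    simpa [add_mul] using hp.add hr hq
  | monomial n a =>
    rw [← C_mul_X_pow_eq_monomial]
    have : ∀ n, HasLaurent r (fun z => z ^ n * g z) ((shift ^ n) c) := by
      intro n
      induction n with
      | zero => simpa using h
      | succ n ih =>
        have := ih.mul_id hr
        rw [pow_succ']
        refine this.congr fun z _ => ?_
        ring
    simpa [mul_assoc, Algebra.algebraMap_eq_smul_one] using (this n).smul a

lemma hasLaurent_of_nat {r : ℝ} {g : ℂ → ℂ} {a : ℕ → ℂ}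
    (hs : Summable fun n => ‖a n‖ * r ^ n)
    (h : ∀ z : ℂ, ‖z‖ = r → HasSum (fun n => a n * z ^ n) (g z)) :
    HasLaurent r g (fun k => if 0 ≤ k then a k.toNat else 0) := by
  have hinj : Function.Injective (fun n : ℕ => (n : ℤ)) := Nat.cast_injective
  refine ⟨?_, fun z hz => ?_⟩
  · refine (hinj.summable_iff ?_).1 ?_
    · intro k hk
      have : ¬ 0 ≤ k := fun h0 => hk ⟨k.toNat, by simp [h0]⟩
      simp [this]
    · simpa [Function.comp_def] using hs
  · refine (hinj.hasSum_iff ?_).1 ?_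
    · intro k hk
      have : ¬ 0 ≤ k := fun h0 => hk ⟨k.toNat, by simp [h0]⟩
      simp [this]
    · simpa [Function.comp_def] using h z hz

lemma HasLaurent.comp_inv {r : ℝ} {g : ℂ → ℂ} {c : ℤ → ℂ} (h : HasLaurent r⁻¹ g c) :
    HasLaurent r (fun z => g z⁻¹) (fun k => c (-k)) := by
  refine ⟨?_, fun z hz => ?_⟩
  · have := ((Equiv.neg ℤ).summable_iff).2 h.summable
    simpa [Function.comp_def, Wt] using this
  · have := ((Equiv.neg ℤ).hasSum_iff).2 (h.hasSum z⁻¹ (by simp [hz]))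
    simpa [Function.comp_def] using this

lemma exists_hasLaurent_exp_mul (B : ℂ) :
    ∃ c : ℤ → ℂ, ∀ r : ℝ, 0 < r → HasLaurent r (fun z => Complex.exp (B * z)) c := by
  refine ⟨fun k => if 0 ≤ k then B ^ k.toNat / (k.toNat.factorial : ℂ) else 0, fun r hr => ?_⟩
  refine hasLaurent_of_nat (a := fun n => B ^ n / (n.factorial : ℂ)) ?_ fun z _ => ?_
  · refine (Real.summable_pow_div_factorial (‖B‖ * r)).congr fun n => ?_
    simp [mul_pow]; ring
  · have := NormedSpace.expSeries_div_hasSum_exp (B * z)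
    rw [← Complex.exp_eq_exp_ℂ] at this
    simpa [mul_pow, mul_div_right_comm] using this

lemma exists_hasLaurent_exp (A B : ℂ) :
    ∃ c : ℤ → ℂ, ∀ r : ℝ, 0 < r → HasLaurent r (fun z => Complex.exp (A / z + B * z)) c := by
  obtain ⟨c, hc⟩ := exists_hasLaurent_exp_mul A
  obtain ⟨d, hd⟩ := exists_hasLaurent_exp_mul B
  refine ⟨_, fun r hr => ((hc r⁻¹ (by positivity)).comp_inv.mul hr (hd r hr)).congr fun z _ => ?_⟩
  rw [← Complex.exp_add, div_eq_mul_inv]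

lemma hasLaurent_one (r : ℝ) : HasLaurent r (fun _ => 1) (Pi.single 0 1) := by
  refine ⟨?_, fun z _ => ?_⟩
  · refine summable_of_ne_finset_zero (s := {0}) fun k hk => ?_
    have : k ≠ 0 := by simpa using hk
    simp [this]
  · have := hasSum_single (f := fun k : ℤ => (Pi.single 0 1 : ℤ → ℂ) k * z ^ k) 0
      (fun k hk => by simp [hk])
    simpa using this

lemma hasLaurent_geom {v r : ℝ} (hr : 0 < r) (hv : 0 < v) (h : r * v < 1) :
    HasLaurent r (fun z => (1 - v * z)⁻¹) (fun k => if 0 ≤ k then (v : ℂ) ^ k.toNat else 0) := by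
  refine hasLaurent_of_nat (a := fun n => (v : ℂ) ^ n) ?_ fun z hz => ?_
  · refine (summable_geometric_of_lt_one (by positivity) h).congr fun n => ?_
    simp [mul_pow, abs_of_pos hv, mul_comm]
  · have : ‖(v : ℂ) * z‖ < 1 := by simpa [hz, abs_of_pos hv, mul_comm] using h
    simpa [mul_pow] using hasSum_geometric_of_norm_lt_one this

lemma exists_hasLaurent_geom_inner {v : ℝ} (hv : 0 < v) :
    ∃ c : ℤ → ℂ, ∀ r : ℝ, 0 < r → r * v < 1 → HasLaurent r (fun z => (1 - v * z)⁻¹) c :=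
  ⟨_, fun _ hr h => hasLaurent_geom hr hv h⟩

/-- For |vz| > 1 the function equals -(vz)⁻¹ / (1 - (vz)⁻¹), a geometric series in 1/z. -/
lemma exists_hasLaurent_geom_outer {v : ℝ} (hv : 0 < v) :
    ∃ c : ℤ → ℂ, ∀ r : ℝ, 0 < r → 1 < r * v → HasLaurent r (fun z => (1 - v * z)⁻¹) c := by
  refine ⟨_, fun r hr h => HasLaurent.congr (HasLaurent.comp_inv
    (((hasLaurent_geom (v := v⁻¹) (inv_pos.2 hr) (inv_pos.2 hv) ?_).mul_id
      (inv_pos.2 hr)).smul (-(v : ℂ)⁻¹))) fun z hz => ?_⟩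
  · rw [← mul_inv]
    exact inv_lt_one_of_one_lt₀ h
  · have hz0 : z ≠ 0 := by
      rintro rfl; simp at hz; exact hr.ne hz
    have hv0 : (v : ℂ) ≠ 0 := by exact_mod_cast hv.ne'
    have h1 : (v : ℂ) * z ≠ 1 := by
      intro h1
      have := congrArg norm h1
      simp [hz, abs_of_pos hv] at this
      rw [mul_comm] at this
      exact h.ne' this
    have h2 : (1 - (v : ℂ) * z) ≠ 0 := fun h => h1 (by linear_combination -h)
    have h3 : ((v : ℂ) * z - 1) ≠ 0 := fun h => h1 (by linear_combination h)
    push_cast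
    have h4 : (1 - (v : ℂ)⁻¹ * z⁻¹) = ((v : ℂ) * z - 1) / (v * z) := by field_simp
    rw [h4]
    field_simp
    ring

lemma exists_hasLaurent_prod {v : ℕ → ℝ} {P : ℝ → ℕ → Prop} (S : Finset ℕ)
    (h : ∀ j ∈ S, ∃ c : ℤ → ℂ, ∀ r : ℝ, 0 < r → P r j → HasLaurent r (fun z => (1 - v j * z)⁻¹) c) :
    ∃ c : ℤ → ℂ, ∀ r : ℝ, 0 < r → (∀ j ∈ S, P r j) →
      HasLaurent r (fun z => ∏ j ∈ S, (1 - v j * z)⁻¹) c := by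
  classical
  induction S using Finset.induction_on with
  | empty => exact ⟨_, fun r _ _ => by simpa using hasLaurent_one r⟩
  | insert j S hj ih =>
    obtain ⟨c, hc⟩ := ih fun i hi => h i (Finset.mem_insert_of_mem hi)
    obtain ⟨d, hd⟩ := h j (Finset.mem_insert_self _ _)
    refine ⟨_, fun r hr hP => ((hd r hr (hP j (Finset.mem_insert_self _ _))).mul hr
      (hc r hr fun i hi => hP i (Finset.mem_insert_of_mem hi))).congr fun z _ => ?_⟩
    rw [Finset.prod_insert hj]

/-! ### Inner and outer expansions of the symbol, and the difference operators -/

/-- The function whose Laurent coefficients on a small circle give `φ`. -/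
noncomputable def symbol (v : ℕ → ℝ) (A B : ℂ) (S : Finset ℕ) (z : ℂ) : ℂ :=
  Complex.exp (A / z + B * z) * ∏ j ∈ S, (1 - v j * z)⁻¹

/-- The sequence is chosen before the radius: all circles inside the poles share their coefficients.
`exists_outer` does the same for circles outside the poles. -/
lemma exists_inner {v : ℕ → ℝ} {S : Finset ℕ} (hv : ∀ j ∈ S, 0 < v j) (A B : ℂ) :
    ∃ c : ℤ → ℂ, ∀ r : ℝ, 0 < r → (∀ j ∈ S, r * v j < 1) → HasLaurent r (symbol v A B S) c := by
  obtain ⟨c, hc⟩ := exists_hasLaurent_exp A B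
  obtain ⟨d, hd⟩ := exists_hasLaurent_prod (P := fun r j => r * v j < 1) S
    fun j hj => exists_hasLaurent_geom_inner (hv j hj)
  exact ⟨_, fun r hr h => (hc r hr).mul hr (hd r hr h)⟩

lemma exists_outer {v : ℕ → ℝ} {S : Finset ℕ} (hv : ∀ j ∈ S, 0 < v j) (A B : ℂ) :
    ∃ c : ℤ → ℂ, ∀ r : ℝ, 0 < r → (∀ j ∈ S, 1 < r * v j) → HasLaurent r (symbol v A B S) c := by
  obtain ⟨c, hc⟩ := exists_hasLaurent_exp A B
  obtain ⟨d, hd⟩ := exists_hasLaurent_prod (P := fun r j => 1 < r * v j) S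
    fun j hj => exists_hasLaurent_geom_outer (hv j hj)
  exact ⟨_, fun r hr h => (hc r hr).mul hr (hd r hr h)⟩

/-- Coefficients of the expansion of `symbol` on small circles. -/
noncomputable def inner (v : ℕ → ℝ) (A B : ℂ) (S : Finset ℕ) : ℤ → ℂ :=
  open Classical in if h : ∀ j ∈ S, 0 < v j then (exists_inner h A B).choose else 0

/-- Coefficients of the expansion of `symbol` on large circles. -/
noncomputable def outer (v : ℕ → ℝ) (A B : ℂ) (S : Finset ℕ) : ℤ → ℂ :=
  open Classical in if h : ∀ j ∈ S, 0 < v j then (exists_outer h A B).choose else 0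

lemma hasLaurent_inner {v : ℕ → ℝ} {S : Finset ℕ} (hv : ∀ j ∈ S, 0 < v j) (A B : ℂ) {r : ℝ}
    (hr : 0 < r) (h : ∀ j ∈ S, r * v j < 1) : HasLaurent r (symbol v A B S) (inner v A B S) := by
  rw [inner, dif_pos hv]
  exact (exists_inner hv A B).choose_spec r hr h

lemma hasLaurent_outer {v : ℕ → ℝ} {S : Finset ℕ} (hv : ∀ j ∈ S, 0 < v j) (A B : ℂ) {r : ℝ}
    (hr : 0 < r) (h : ∀ j ∈ S, 1 < r * v j) : HasLaurent r (symbol v A B S) (outer v A B S) := by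
  rw [outer, dif_pos hv]
  exact (exists_outer hv A B).choose_spec r hr h

/-- Coefficients of `exp (A / z + B * z)`. -/
noncomputable def expc (A B : ℂ) : ℤ → ℂ := inner 0 A B ∅

lemma hasLaurent_expc (A B : ℂ) {r : ℝ} (hr : 0 < r) :
    HasLaurent r (fun z => Complex.exp (A / z + B * z)) (expc A B) :=
  (hasLaurent_inner (v := 0) (S := ∅) (by simp) A B hr (by simp)).congr fun z _ => by simp [symbol]

open Polynomial in
/-- `∏ (1 - v j X)` over `j ∈ S`. -/
noncomputable def fac (v : ℕ → ℝ) (S : Finset ℕ) : ℂ[X] := ∏ j ∈ S, (1 - C (v j : ℂ) * X)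

lemma eval_fac (v : ℕ → ℝ) (S : Finset ℕ) (z : ℂ) :
    (fac v S).eval z = ∏ j ∈ S, (1 - v j * z) := by
  simp [fac, Polynomial.eval_prod]

/-- The operator `∏ (1 - v j T)` on functions on `ℤ`, with `T` the shift. -/
noncomputable def DD (v : ℕ → ℝ) (S : Finset ℕ) : Module.End ℂ (ℤ → ℂ) :=
  Polynomial.aeval shift (fac v S)

lemma DD_union (v : ℕ → ℝ) {S S' : Finset ℕ} (h : Disjoint S S') :
    DD v (S ∪ S') = DD v S * DD v S' := by
  rw [DD, DD, DD, ← map_mul, fac, fac, fac, Finset.prod_union h]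

@[simp] lemma DD_empty (v : ℕ → ℝ) : DD v ∅ = 1 := by simp [DD, fac]

lemma DD_singleton (v : ℕ → ℝ) (j : ℕ) (f : ℤ → ℂ) (x : ℤ) :
    DD v {j} f x = f x - v j * f (x - 1) := by
  simp [DD, fac, Algebra.algebraMap_eq_smul_one]

lemma HasLaurent.DD {r : ℝ} (hr : 0 < r) {g : ℂ → ℂ} {c : ℤ → ℂ} (h : HasLaurent r g c)
    (v : ℕ → ℝ) (S : Finset ℕ) :
    HasLaurent r (fun z => (∏ j ∈ S, (1 - v j * z)) * g z) (DD v S c) := by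
  have := h.aeval_mul hr (fac v S)
  simp only [eval_fac] at this
  exact this

lemma HasLaurent.coeff_unique {r : ℝ} {g : ℂ → ℂ} {c d : ℤ → ℂ} (hr : 0 < r)
    (h : HasLaurent r g c) {g' : ℂ → ℂ} (h' : HasLaurent r g' d)
    (hg : ∀ z, ‖z‖ = r → g z = g' z) : c = d :=
  (h.congr hg).unique hr h'

lemma one_sub_ne_zero {v r : ℝ} (hv : 0 < v) (h : r * v ≠ 1) {z : ℂ} (hz : ‖z‖ = r) :
    (1 - (v : ℂ) * z) ≠ 0 := by
  intro h1
  have h2 : (v : ℂ) * z = 1 := by linear_combination -h1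
  have := congrArg norm h2
  simp [hz, abs_of_pos hv] at this
  exact h (by rw [mul_comm]; exact this)

lemma prod_mul_prod_inv {v : ℕ → ℝ} {S : Finset ℕ} {r : ℝ} (hv : ∀ j ∈ S, 0 < v j)
    (h : ∀ j ∈ S, r * v j ≠ 1) {z : ℂ} (hz : ‖z‖ = r) :
    (∏ j ∈ S, (1 - (v j : ℂ) * z)) * ∏ j ∈ S, (1 - (v j : ℂ) * z)⁻¹ = 1 := by
  rw [← Finset.prod_mul_distrib]
  exact Finset.prod_eq_one fun j hj => mul_inv_cancel₀ (one_sub_ne_zero (hv j hj) (h j hj) hz)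

/-- Multiplication by ∏ (1 - v_j z) removes the poles. As the same holds for `DD_outer`, the
difference of the two expansions is annihilated by the operator; this is what later places it in
`V`. -/
lemma DD_inner {v : ℕ → ℝ} {S : Finset ℕ} (hv : ∀ j ∈ S, 0 < v j) (A B : ℂ) {r : ℝ}
    (hr : 0 < r) (h : ∀ j ∈ S, r * v j < 1) : DD v S (inner v A B S) = expc A B := by
  refine ((hasLaurent_inner hv A B hr h).DD hr v S).coeff_unique hr (hasLaurent_expc A B hr)
    fun z hz => ?_
  rw [symbol, mul_left_comm, prod_mul_prod_inv hv (fun j hj => (h j hj).ne) hz, mul_one]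

lemma DD_outer {v : ℕ → ℝ} {S : Finset ℕ} (hv : ∀ j ∈ S, 0 < v j) (A B : ℂ) {r : ℝ}
    (hr : 0 < r) (h : ∀ j ∈ S, 1 < r * v j) : DD v S (outer v A B S) = expc A B := by
  refine ((hasLaurent_outer hv A B hr h).DD hr v S).coeff_unique hr (hasLaurent_expc A B hr)
    fun z hz => ?_
  rw [symbol, mul_left_comm, prod_mul_prod_inv hv (fun j hj => (h j hj).ne') hz, mul_one]

lemma symbol_mul (v : ℕ → ℝ) (A B A' B' : ℂ) {S S' : Finset ℕ} (h : Disjoint S S') (z : ℂ) :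
    symbol v A B S z * symbol v A' B' S' z = symbol v (A + A') (B + B') (S ∪ S') z := by
  simp only [symbol]
  rw [Finset.prod_union h, show (A + A') / z + (B + B') * z = (A / z + B * z) + (A' / z + B' * z)
    by ring, Complex.exp_add (A / z + B * z)]
  ring

/-! Convolution -/

lemma conv_comm (c d : ℤ → ℂ) : conv c d = conv d c := by
  funext n
  rw [conv, ← (Equiv.subLeft n).tsum_eq, conv]
  refine tsum_congr fun k => ?_
  simp [mul_comm]

lemma Wt.conv_assoc {r : ℝ} (hr : 0 < r) {c d e : ℤ → ℂ} (hc : Wt r c) (hd : Wt r d)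
    (he : Wt r e) : conv (conv c d) e = conv c (conv d e) :=
  ((hc.hasLaurent.mul hr hd.hasLaurent).mul hr he.hasLaurent).coeff_unique hr
    (hc.hasLaurent.mul hr (hd.hasLaurent.mul hr he.hasLaurent)) fun z _ => by ring

lemma Wt.add {r : ℝ} (hr : 0 < r) {c d : ℤ → ℂ} (hc : Wt r c) (hd : Wt r d) : Wt r (c + d) :=
  (hc.hasLaurent.add hr hd.hasLaurent).summable

lemma Wt.smul {r : ℝ} {c : ℤ → ℂ} (a : ℂ) (hc : Wt r c) : Wt r (a • c) :=
  (hc.hasLaurent.smul a).summable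

lemma wt_zero (r : ℝ) : Wt r 0 := by simp [Wt, summable_zero]

lemma Wt.DD {r : ℝ} (hr : 0 < r) {c : ℤ → ℂ} (hc : Wt r c) (v : ℕ → ℝ) (S : Finset ℕ) :
    Wt r (DD v S c) := (hc.hasLaurent.DD hr v S).summable

lemma conv_add_left {c d e : ℤ → ℂ} (hc : ∀ n, Summable fun k => c k * e (n - k))
    (hd : ∀ n, Summable fun k => d k * e (n - k)) : conv (c + d) e = conv c e + conv d e := by
  funext n
  simp only [conv, Pi.add_apply, add_mul]
  exact (hc n).tsum_add (hd n)

lemma conv_smul_left (a : ℂ) (c e : ℤ → ℂ) : conv (a • c) e = a • conv c e := by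
  funext n
  simp only [conv, Pi.smul_apply, smul_eq_mul, mul_assoc]
  exact tsum_mul_left

/-! ### Sequences split between a large and a small circle -/

/-- Sums of a sequence summable on the circle of radius `R` and one summable on the circle of
radius `r`. -/
def Split (R r : ℝ) (f : ℤ → ℂ) : Prop := ∃ f₁ f₂, Wt R f₁ ∧ Wt r f₂ ∧ f = f₁ + f₂

section
variable {R r : ℝ} {f g c d : ℤ → ℂ}

lemma Split.add (hR : 0 < R) (hr : 0 < r) (hf : Split R r f) (hg : Split R r g) :
    Split R r (f + g) := by
  obtain ⟨f₁, f₂, h₁, h₂, rfl⟩ := hf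
  obtain ⟨g₁, g₂, h₃, h₄, rfl⟩ := hg
  exact ⟨_, _, h₁.add hR h₃, h₂.add hr h₄, by abel⟩

lemma Split.smul (a : ℂ) (hf : Split R r f) : Split R r (a • f) := by
  obtain ⟨f₁, f₂, h₁, h₂, rfl⟩ := hf
  exact ⟨_, _, h₁.smul a, h₂.smul a, by simp⟩

lemma split_zero : Split R r 0 := ⟨0, 0, wt_zero R, wt_zero r, by simp⟩

lemma Wt.split_left (h : Wt R f) : Split R r f := ⟨f, 0, h, wt_zero r, by simp⟩

/-- A function such as u^x is summable on no circle, but its two halves are summable on different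
circles. This suffices for convolution with a sequence summable on both, such as the coefficients of
e^{A/z+Bz}. -/
lemma Split.summable (hR : 0 < R) (hr : 0 < r) (hf : Split R r f) (hcR : Wt R c) (hcr : Wt r c)
    (n : ℤ) : Summable fun k => f k * c (n - k) := by
  obtain ⟨f₁, f₂, h₁, h₂, rfl⟩ := hf
  simpa [add_mul] using (h₁.summable_conv hR hcR n).add (h₂.summable_conv hr hcr n)

lemma Split.conv_add (hR : 0 < R) (hr : 0 < r) (hf : Split R r f) (hg : Split R r g)
    (hcR : Wt R c) (hcr : Wt r c) : conv (f + g) c = conv f c + conv g c :=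
  conv_add_left (hf.summable hR hr hcR hcr) (hg.summable hR hr hcR hcr)

lemma Wt.conv_add (hR : 0 < R) (hf : Wt R f) (hg : Wt R g) (hc : Wt R c) :
    conv (f + g) c = conv f c + conv g c :=
  conv_add_left (hf.summable_conv hR hc) (hg.summable_conv hR hc)

lemma Wt.conv_add_mixed (hR : 0 < R) (hr : 0 < r) (hf : Wt R f) (hg : Wt r g)
    (hcR : Wt R c) (hcr : Wt r c) : conv (f + g) c = conv f c + conv g c :=
  conv_add_left (hf.summable_conv hR hcR) (hg.summable_conv hr hcr)

lemma Split.conv_assoc (hR : 0 < R) (hr : 0 < r) (hf : Split R r f) (hcR : Wt R c) (hcr : Wt r c)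
    (hdR : Wt R d) (hdr : Wt r d) : conv (conv f c) d = conv f (conv c d) := by
  obtain ⟨f₁, f₂, h₁, h₂, rfl⟩ := hf
  rw [h₁.conv_add_mixed hR hr h₂ hcR hcr, (h₁.convolve hR hcR).conv_add_mixed hR hr
    (h₂.convolve hr hcr) hdR hdr, h₁.conv_add_mixed hR hr h₂ (hcR.convolve hR hdR)
    (hcr.convolve hr hdr), h₁.conv_assoc hR hcR hdR, h₂.conv_assoc hr hcr hdr]

lemma Wt.DD_conv (hr : 0 < r) (hf : Wt r f) (hc : Wt r c) (v : ℕ → ℝ) (S : Finset ℕ) :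
    PushASEP.DD v S (conv f c) = conv (PushASEP.DD v S f) c :=
  ((hf.hasLaurent.mul hr hc.hasLaurent).DD hr v S).coeff_unique hr
    ((hf.hasLaurent.DD hr v S).mul hr hc.hasLaurent) fun z _ => by ring

lemma Wt.conv_DD (hr : 0 < r) (hf : Wt r f) (hc : Wt r c) (v : ℕ → ℝ) (S : Finset ℕ) :
    conv f (PushASEP.DD v S c) = PushASEP.DD v S (conv f c) := by
  rw [conv_comm, ← hc.DD_conv hr hf, conv_comm]

lemma Split.DD_conv (hR : 0 < R) (hr : 0 < r) (hf : Split R r f) (hcR : Wt R c) (hcr : Wt r c)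
    (v : ℕ → ℝ) (S : Finset ℕ) : DD v S (conv f c) = conv (DD v S f) c := by
  obtain ⟨f₁, f₂, h₁, h₂, rfl⟩ := hf
  rw [h₁.conv_add_mixed hR hr h₂ hcR hcr, map_add, map_add, h₁.DD_conv hR hcR, h₂.DD_conv hr hcr,
    (h₁.DD hR v S).conv_add_mixed hR hr (h₂.DD hr v S) hcR hcr]

lemma Split.conv_DD (hR : 0 < R) (hr : 0 < r) (hf : Split R r f) (hcR : Wt R c) (hcr : Wt r c)
    (v : ℕ → ℝ) (S : Finset ℕ) : conv f (DD v S c) = DD v S (conv f c) := by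
  obtain ⟨f₁, f₂, h₁, h₂, rfl⟩ := hf
  rw [h₁.conv_add_mixed hR hr h₂ hcR hcr, map_add, ← h₁.conv_DD hR hcR, ← h₂.conv_DD hr hcr,
    h₁.conv_add_mixed hR hr h₂ (hcR.DD hR v S) (hcr.DD hr v S)]

end

/-! The space `V` -/

open Polynomial

lemma coeff_X_sub_C_pow' (n k : ℕ) :
    (((X : ℂ[X]) - C 1) ^ n).coeff k = (-1) ^ (n - k) * (n.choose k : ℂ) := by
  rw [sub_eq_add_neg, ← C_neg, coeff_X_add_C_pow]

/-- The function `x ↦ p(x) u ^ x`. -/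
noncomputable def quasiPoly (p : ℂ[X]) (u : ℝ) : ℤ → ℂ := fun x => p.eval (x : ℂ) * (u : ℂ) ^ x

/-- The number of `i ∈ {1, …, n}` with `v i = u`. -/
noncomputable def mult (v : ℕ → ℝ) (n : ℕ) (u : ℝ) : ℕ :=
  ((Finset.Icc 1 n).filter (fun i => v i = u)).card

lemma quasiPoly_mem_V {v : ℕ → ℝ} {n : ℕ} {u : ℝ} {p : ℂ[X]} (hp : p.degree < mult v n u) :
    quasiPoly p u ∈ V v n := by
  by_cases h0 : p = 0
  · subst h0
    convert (V v n).zero_mem using 1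
    funext x; simp [quasiPoly]
  have hd : p.natDegree < mult v n u := (natDegree_lt_iff_degree_lt h0).2 hp
  have hpos : 0 < mult v n u := by omega
  obtain ⟨j, hj⟩ := Finset.card_pos.1 hpos
  simp only [Finset.mem_filter, Finset.mem_Icc] at hj
  have : quasiPoly p u = ∑ i ∈ Finset.range (mult v n u),
      p.coeff i • fun x : ℤ => (x : ℂ) ^ i * (v j : ℂ) ^ x := by
    funext x
    simp only [quasiPoly, eval_eq_sum_range' hd, Finset.sum_apply, Pi.smul_apply, smul_eq_mul,
      Finset.sum_mul, mul_assoc, hj.2]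
  rw [this]
  refine Submodule.sum_mem _ fun i hi => Submodule.smul_mem _ _ (Submodule.subset_span ?_)
  refine ⟨j, i, hj.1.1, hj.1.2, ?_, rfl⟩
  rw [hj.2]
  exact Finset.mem_range.1 hi

lemma V_induction {v : ℕ → ℝ} {n : ℕ} (W : Submodule ℂ (ℤ → ℂ))
    (h : ∀ j l, 1 ≤ j → j ≤ n → l < mult v n (v j) → quasiPoly (X ^ l) (v j) ∈ W) :
    V v n ≤ W := by
  refine Submodule.span_le.2 ?_
  rintro f ⟨j, l, h1, h2, h3, rfl⟩
  have := h j l h1 h2 h3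
  rwa [show quasiPoly (X ^ l) (v j) = fun x : ℤ => (x : ℂ) ^ l * (v j : ℂ) ^ x by
    funext x; simp [quasiPoly]] at this

lemma mult_succ (v : ℕ → ℝ) (n : ℕ) (u : ℝ) :
    mult v (n + 1) u = mult v n u + if v (n + 1) = u then 1 else 0 := by
  have h0 : Finset.Icc 1 (n + 1) = insert (n + 1) (Finset.Icc 1 n) := by ext x; simp; omega
  rw [mult, mult, h0]
  split_ifs with h
  · rw [Finset.filter_insert, if_pos h, Finset.card_insert_of_notMem (by simp)]
  · rw [Finset.filter_insert, if_neg h, add_zero]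

lemma DD_quasiPoly (v : ℕ → ℝ) (m : ℕ) {u : ℝ} (hu : u ≠ 0) (p : ℂ[X]) :
    DD v {m} (quasiPoly p u) =
      quasiPoly (p - C ((v m : ℂ) / u) * p.comp (X - C 1)) u := by
  funext x
  have hu' : (u : ℂ) ≠ 0 := by exact_mod_cast hu
  rw [DD_singleton]
  simp [quasiPoly, zpow_sub₀ hu']
  field_simp

/-- The coefficient of X^l in X^l - c (X-1)^l is 1 - c, so a degree is lost in the resonant case c =
1. -/
lemma degree_diff_lt {c : ℂ} {l d : ℕ} (hl : l < d + if c = 1 then 1 else 0) :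
    ((X : ℂ[X]) ^ l - C c * ((X : ℂ[X]) ^ l).comp (X - C 1)).degree < d := by
  rw [degree_lt_iff_coeff_zero]
  intro k hk
  rw [pow_comp, X_comp, coeff_sub, coeff_C_mul, coeff_X_pow, coeff_X_sub_C_pow']
  split_ifs at hl with hc
  · rcases (show l < k ∨ l = k by omega) with h | rfl
    · rw [if_neg (by omega), Nat.choose_eq_zero_of_lt h]; simp
    · simp [hc]
  · rw [if_neg (by omega), Nat.choose_eq_zero_of_lt (by omega)]; simp

/-- The leading term is removed by induction on the degree. For c ≠ 1 a multiple of X^d does it,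
with leading factor 1 - c. For c = 1 one uses that X^{d+1} - (X-1)^{d+1} has leading term (d+1) X^d;
the extra degree is the extra multiplicity gained in `V` when v_{n+1} equals the base u. -/
lemma exists_diff_eq (c : ℂ) (d : ℕ) (p : ℂ[X]) (hp : p.degree < d) :
    ∃ q : ℂ[X], q.degree < ((d + if c = 1 then 1 else 0 : ℕ) : WithBot ℕ) ∧
      q - C c * q.comp (X - C 1) = p := by
  induction d generalizing p with
  | zero =>
    have : p = 0 := by simpa using hp
    exact ⟨0, by rw [degree_zero]; exact WithBot.bot_lt_coe _, by simp [this]⟩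
  | succ d ih =>
    obtain ⟨q₀, hq₀, hq₁⟩ : ∃ q₀ : ℂ[X], q₀.degree < ((d + 1 + if c = 1 then 1 else 0 : ℕ) :
        WithBot ℕ) ∧ (p - (q₀ - C c * q₀.comp (X - C 1))).degree < d := by
      by_cases hc : c = 1
      · refine ⟨C (p.coeff d / (d + 1)) * X ^ (d + 1), ?_, ?_⟩
        · refine (degree_C_mul_X_pow_le _ _).trans_lt ?_
          simp only [hc, if_true]
          exact_mod_cast Nat.lt_succ_self _
        · rw [degree_lt_iff_coeff_zero]
          intro k hk
          have hpk : d < k → p.coeff k = 0 := fun h =>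
            coeff_eq_zero_of_degree_lt (hp.trans_le (by exact_mod_cast h))
          rw [mul_comp, C_comp, pow_comp, X_comp, coeff_sub, coeff_sub, coeff_C_mul, coeff_C_mul,
            coeff_C_mul, coeff_X_pow, coeff_X_sub_C_pow', hc]
          rcases (show k = d ∨ k = d + 1 ∨ d + 1 < k by omega) with rfl | rfl | h
          · have : (k : ℂ) + 1 ≠ 0 := by exact_mod_cast Nat.succ_ne_zero k
            simp
            field_simp
            ring
          · simp [hpk]
          · rw [if_neg (by omega), Nat.choose_eq_zero_of_lt h, hpk (by omega)]; simp
      · have hc' : 1 - c ≠ 0 := sub_ne_zero.2 (Ne.symm hc)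
        refine ⟨C (p.coeff d / (1 - c)) * X ^ d, ?_, ?_⟩
        · refine (degree_C_mul_X_pow_le _ _).trans_lt ?_
          simp only [hc, if_false]
          exact_mod_cast Nat.lt_succ_self _
        · rw [degree_lt_iff_coeff_zero]
          intro k hk
          have hpk : d < k → p.coeff k = 0 := fun h =>
            coeff_eq_zero_of_degree_lt (hp.trans_le (by exact_mod_cast h))
          rw [mul_comp, C_comp, pow_comp, X_comp, coeff_sub, coeff_sub, coeff_C_mul, coeff_C_mul,
            coeff_C_mul, coeff_X_pow, coeff_X_sub_C_pow']
          rcases (show k = d ∨ d < k by omega) with rfl | h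
          · simp
            field_simp
            ring
          · rw [if_neg (by omega), Nat.choose_eq_zero_of_lt h, hpk (by omega)]; simp
    obtain ⟨q, hq, hq'⟩ := ih _ hq₁
    refine ⟨q₀ + q, (degree_add_le _ _).trans_lt (max_lt hq₀ (hq.trans_le ?_)), ?_⟩
    · exact_mod_cast (by omega)
    · rw [add_comp]
      linear_combination hq'

lemma Icc_succ_eq (n : ℕ) : Finset.Icc 1 (n + 1) = Finset.Icc 1 n ∪ {n + 1} := by
  ext x; simp; omega

lemma eq_of_DD_singleton_eq_zero {v : ℕ → ℝ} {m : ℕ} (hv : v m ≠ 0) {f : ℤ → ℂ}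
    (h : DD v {m} f = 0) : f = f 0 • quasiPoly 1 (v m) := by
  have hv' : (v m : ℂ) ≠ 0 := by exact_mod_cast hv
  have h1 : ∀ x, f x = v m * f (x - 1) := fun x => by
    have := congrFun h x
    rw [DD_singleton] at this
    simpa [sub_eq_zero] using this
  funext x
  simp only [quasiPoly, Pi.smul_apply, eval_one, one_mul, smul_eq_mul]
  induction x using Int.induction_on with
  | zero => simp
  | succ i ih =>
    rw [h1, add_sub_cancel_right, ih, zpow_add_one₀ hv']; ring
  | pred i ih =>
    rw [h1] at ih
    have : (v m : ℂ) * f (-i - 1) = v m * (f 0 * v m ^ (-(i : ℤ) - 1)) := by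
      rw [ih, zpow_sub_one₀ hv']; field_simp
    exact mul_left_cancel₀ hv' this

lemma DD_quasiPoly_one (v : ℕ → ℝ) {m : ℕ} (hv : v m ≠ 0) : DD v {m} (quasiPoly 1 (v m)) = 0 := by
  have hv' : (v m : ℂ) ≠ 0 := by exact_mod_cast hv
  rw [DD_quasiPoly v m hv]
  funext x
  simp [quasiPoly, hv']

section
variable {v : ℕ → ℝ} (hv : ∀ n, 1 ≤ n → 0 < v n)
include hv

lemma div_eq_one_iff' {n j : ℕ} (hj : 1 ≤ j) :
    (v (n + 1) : ℂ) / v j = 1 ↔ v (n + 1) = v j := by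
  have : (v j : ℂ) ≠ 0 := by exact_mod_cast (hv j hj).ne'
  rw [div_eq_one_iff_eq this]
  norm_cast

lemma DD_mem_V {n : ℕ} {f : ℤ → ℂ} (hf : f ∈ V v (n + 1)) : DD v {n + 1} f ∈ V v n := by
  refine V_induction ((V v n).comap (DD v {n + 1})) ?_ hf
  intro j l h1 h2 h3
  rw [Submodule.mem_comap, DD_quasiPoly _ _ (hv j h1).ne']
  refine quasiPoly_mem_V (degree_diff_lt ?_)
  rw [mult_succ] at h3
  simpa only [div_eq_one_iff' hv h1] using h3

lemma exists_DD_eq {n : ℕ} {f : ℤ → ℂ} (hf : f ∈ V v n) :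
    ∃ g ∈ V v (n + 1), DD v {n + 1} g = f := by
  have : V v n ≤ (V v (n + 1)).map (DD v {n + 1}) := by
    refine V_induction _ ?_
    intro j l h1 h2 h3
    obtain ⟨q, hq, hq'⟩ := exists_diff_eq ((v (n + 1) : ℂ) / v j) (mult v n (v j)) (X ^ l)
      ((degree_X_pow_le l).trans_lt (by exact_mod_cast h3))
    refine ⟨quasiPoly q (v j), quasiPoly_mem_V ?_, ?_⟩
    · rw [mult_succ]
      simpa only [div_eq_one_iff' hv h1] using hq
    · rw [DD_quasiPoly _ _ (hv j h1).ne', hq']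
  exact this hf

/-- If (1 - v_{n+1} T) f lies in V_n, then f differs from a preimage taken in V_{n+1} by a multiple
of v_{n+1}^x, which also lies in V_{n+1}. This replaces bookkeeping with multiplicities by the
kernel of one operator. -/
lemma mem_V_iff {n : ℕ} {f : ℤ → ℂ} : f ∈ V v n ↔ DD v (Finset.Icc 1 n) f = 0 := by
  induction n generalizing f with
  | zero =>
    have : V v 0 = ⊥ := by
      rw [eq_bot_iff]
      exact V_induction _ fun j l h1 h2 => by omega
    simp [this]
  | succ n ih =>
    have hd : Disjoint (Finset.Icc 1 n) {n + 1} := by simp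
    rw [Icc_succ_eq, DD_union v hd, Module.End.mul_apply, ← ih]
    refine ⟨DD_mem_V hv, fun h => ?_⟩
    obtain ⟨g, hg, hg'⟩ := exists_DD_eq hv h
    have h1 : DD v {n + 1} (f - g) = 0 := by rw [map_sub, hg', sub_self]
    have h2 := eq_of_DD_singleton_eq_zero (hv (n + 1) (by omega)).ne' h1
    have h3 : quasiPoly 1 (v (n + 1)) ∈ V v (n + 1) := by
      refine quasiPoly_mem_V ?_
      rw [mult_succ, if_pos rfl, degree_one]
      exact_mod_cast Nat.succ_pos _
    have := (V v (n + 1)).add_mem ((V v (n + 1)).smul_mem ((f - g) 0) h3) hg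
    rwa [← h2, sub_add_cancel] at this

end

/-- Up to polynomial factors, (R u)^x decays at -∞ and (r u)^x at +∞: the negative half belongs to
the large circle and the other half to the small one. -/
lemma quasiPoly_split {R r u : ℝ} (hR : 0 < R) (hr : 0 < r) (hu : 0 < u) (h1 : r * u < 1)
    (h2 : 1 < R * u) (l : ℕ) : Split R r (quasiPoly (X ^ l) u) := by
  classical
  refine ⟨fun x => if x < 0 then quasiPoly (X ^ l) u x else 0,
    fun x => if x < 0 then 0 else quasiPoly (X ^ l) u x, ?_, ?_, ?_⟩
  · have hinj : Function.Injective (fun n : ℕ => -(n : ℤ)) := fun a b h => by simpa using h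
    refine (hinj.summable_iff ?_).1 ?_
    · intro k hk
      have : ¬ k < 0 := fun h0 => hk ⟨(-k).toNat, by simp; omega⟩
      simp [this]
    · have := summable_pow_mul_geometric_of_norm_lt_one l (r := (R * u)⁻¹)
        (by rw [norm_inv, Real.norm_of_nonneg (by positivity)]; exact inv_lt_one_of_one_lt₀ h2)
      refine Summable.of_nonneg_of_le (fun n => mul_nonneg (norm_nonneg _) (zpow_nonneg (le_of_lt (by assumption)) _)) (fun n => ?_) this
      simp only [Function.comp]
      split_ifs with h
      · simp [quasiPoly, abs_of_pos hu, mul_pow]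
        apply le_of_eq; ring
      · simp; positivity
  · have hinj : Function.Injective (fun n : ℕ => (n : ℤ)) := Nat.cast_injective
    refine (hinj.summable_iff ?_).1 ?_
    · intro k hk
      have : k < 0 := by
        by_contra h0
        exact hk ⟨k.toNat, by simp; omega⟩
      simp [this]
    · have := summable_pow_mul_geometric_of_norm_lt_one l (r := r * u)
        (by rwa [Real.norm_of_nonneg (by positivity)])
      refine Summable.of_nonneg_of_le (fun n => mul_nonneg (norm_nonneg _) (zpow_nonneg (le_of_lt (by assumption)) _)) (fun n => ?_) this
      simp only [Function.comp, not_lt.2 (Int.natCast_nonneg n), if_false]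
      simp [quasiPoly, abs_of_pos hu, mul_pow]
      apply le_of_eq; ring
  · funext x
    simp only [Pi.add_apply]
    split_ifs <;> simp

lemma split_of_mem_V {v : ℕ → ℝ} {n : ℕ} {R r : ℝ} (hR : 0 < R) (hr : 0 < r)
    (hv : ∀ n, 1 ≤ n → 0 < v n) (h1 : ∀ j, 1 ≤ j → j ≤ n → r * v j < 1)
    (h2 : ∀ j, 1 ≤ j → j ≤ n → 1 < R * v j) {f : ℤ → ℂ} (hf : f ∈ V v n) : Split R r f := by
  let W : Submodule ℂ (ℤ → ℂ) :=
    { carrier := {f | Split R r f}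
      add_mem' := fun h h' => Split.add hR hr h h'
      zero_mem' := split_zero
      smul_mem' := fun a _ h => h.smul a }
  have : V v n ≤ W := V_induction W fun j l hj hj' _ =>
    quasiPoly_split hR hr (hv j hj) (h1 j hj hj') (h2 j hj hj') l
  exact this hf

end PushASEP

/-! ### Triangular bases of V and determinants of pairings -/

namespace PushASEP
open Filter Topology Polynomial

lemma exists_large_radius {v : ℕ → ℝ} (hv : ∀ n, 1 ≤ n → 0 < v n) (n : ℕ) :
    ∃ R : ℝ, 0 < R ∧ ∀ j, 1 ≤ j → j ≤ n → 1 < R * v j := by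
  have hnn : ∀ j ∈ Finset.Icc 1 n, 0 ≤ 2 / v j := fun j hj =>
    (div_pos two_pos (hv j (Finset.mem_Icc.1 hj).1)).le
  refine ⟨1 + ∑ j ∈ Finset.Icc 1 n, 2 / v j, by
    have := Finset.sum_nonneg hnn; linarith, fun j h1 h2 => ?_⟩
  have h3 := Finset.single_le_sum hnn (Finset.mem_Icc.2 ⟨h1, h2⟩)
  have hj := hv j h1
  calc (1 : ℝ) < 2 / v j * v j := by field_simp; norm_num
    _ ≤ _ := by gcongr; linarith

lemma exists_small_radius {v : ℕ → ℝ} (hv : ∀ n, 1 ≤ n → 0 < v n) (n : ℕ) :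
    ∃ r : ℝ, 0 < r ∧ ∀ j, 1 ≤ j → j ≤ n → r * v j < 1 := by
  have hnn : ∀ j ∈ Finset.Icc 1 n, 0 ≤ v j := fun j hj => (hv j (Finset.mem_Icc.1 hj).1).le
  have hpos : 0 < 1 + ∑ j ∈ Finset.Icc 1 n, v j := by
    have := Finset.sum_nonneg hnn
    linarith
  refine ⟨(1 + ∑ j ∈ Finset.Icc 1 n, v j)⁻¹, inv_pos.2 hpos, fun j h1 h2 => ?_⟩
  have := Finset.single_le_sum hnn (Finset.mem_Icc.2 ⟨h1, h2⟩)
  rw [inv_mul_lt_iff₀ hpos]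
  linarith

lemma IsSmallRadius.mul_lt {v : ℕ → ℝ} (hv : ∀ n, 1 ≤ n → 0 < v n) {n : ℕ} {ρ : ℝ}
    (h : IsSmallRadius v n ρ) {j : ℕ} (h1 : 1 ≤ j) (h2 : j ≤ n) : ρ * v j < 1 := by
  have := h.2 j h1 h2
  rwa [lt_div_iff₀ (hv j h1)] at this

lemma wt_expc (A B : ℂ) {r : ℝ} (hr : 0 < r) : Wt r (expc A B) := (hasLaurent_expc A B hr).summable

lemma expc_zero : expc 0 0 = Pi.single 0 1 :=
  (hasLaurent_expc 0 0 one_pos).coeff_unique one_pos (hasLaurent_one 1) fun z _ => by simp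

lemma conv_single (f : ℤ → ℂ) : conv f (Pi.single 0 1) = f := by
  funext n
  rw [conv, tsum_eq_single n]
  · simp
  · intro k hk
    rw [Pi.single_eq_of_ne (by omega), mul_zero]

lemma conv_expc_zero (f : ℤ → ℂ) : conv f (expc 0 0) = f := by rw [expc_zero, conv_single]

lemma conv_expc_expc (A B A' B' : ℂ) : conv (expc A B) (expc A' B') = expc (A + A') (B + B') :=
  ((hasLaurent_expc A B one_pos).mul one_pos (hasLaurent_expc A' B' one_pos)).coeff_unique one_pos
    (hasLaurent_expc _ _ one_pos) fun z _ => by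
      rw [← Complex.exp_add]; congr 1; ring

lemma conv_zero_left (c : ℤ → ℂ) : conv 0 c = 0 := by
  funext n; simp [conv]

/-- Geometric functions are eigenfunctions of convolutions; the eigenvalue is the value of
e^{A/z+Bz} at z = 1/u. -/
lemma conv_quasiPoly_one {u : ℝ} (hu : 0 < u) (A B : ℂ) :
    conv (quasiPoly 1 u) (expc A B) = Complex.exp (A * u + B / u) • quasiPoly 1 u := by
  have hu0 : (u : ℂ) ≠ 0 := by exact_mod_cast hu.ne'
  have h := (hasLaurent_expc A B (inv_pos.2 hu)).hasSum (u : ℂ)⁻¹ (by simp [abs_of_pos hu])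
  funext y
  have h2 := ((Equiv.subLeft y).hasSum_iff).2 (h.mul_left ((u : ℂ) ^ y))
  simp only [Pi.smul_apply, smul_eq_mul, quasiPoly, eval_one, one_mul]
  rw [conv, show Complex.exp (A * u + B / u) * (u : ℂ) ^ y =
    (u : ℂ) ^ y * Complex.exp (A / (u : ℂ)⁻¹ + B * (u : ℂ)⁻¹) by
      rw [mul_comm, div_inv_eq_mul, div_eq_mul_inv B], ← h2.tsum_eq]
  refine tsum_congr fun k => ?_
  simp only [quasiPoly, eval_one, one_mul, Function.comp, Equiv.subLeft_apply]
  rw [inv_zpow', neg_sub, mul_left_comm, ← zpow_add₀ hu0]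
  rw [mul_comm]; congr 2; ring

lemma Ioc_succ_eq {k n : ℕ} (h : k ≤ n) : Finset.Ioc k (n + 1) = Finset.Ioc k n ∪ {n + 1} := by
  ext x; simp; omega

lemma Ioc_eq_union {k l n : ℕ} (h : k ≤ l) (h' : l ≤ n) :
    Finset.Ioc k n = Finset.Ioc k l ∪ Finset.Ioc l n := by
  ext x; simp; omega

lemma DD_Ioc (v : ℕ → ℝ) {k l n : ℕ} (h : k ≤ l) (h' : l ≤ n) (f : ℤ → ℂ) :
    DD v (Finset.Ioc k n) f = DD v (Finset.Ioc k l) (DD v (Finset.Ioc l n) f) := by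
  rw [Ioc_eq_union h h', DD_union v, Module.End.mul_apply]
  rw [Finset.disjoint_left]
  intro x; simp; omega

lemma Ioc_zero_eq (n : ℕ) : Finset.Ioc 0 n = Finset.Icc 1 n := by ext x; simp; omega

section
variable {v : ℕ → ℝ} (hv : ∀ n, 1 ≤ n → 0 < v n)
include hv

lemma mem_V_of_DD_Ioc {k n : ℕ} (h : k ≤ n) {f : ℤ → ℂ} (hf : DD v (Finset.Ioc k n) f = 0) :
    f ∈ V v n := by
  rw [mem_V_iff hv, ← Ioc_zero_eq, DD_Ioc v (Nat.zero_le k) h, hf, map_zero]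

/-- Start from v_k^x at level k and lift through the surjections 1 - v_{m+1} T : V_{m+1} → V_m. In
this basis pairing matrices are triangular, with nowhere vanishing geometric functions on the
diagonal. -/
lemma exists_triangular_basis (n : ℕ) : ∃ e : ℕ → ℤ → ℂ, ∀ k, 1 ≤ k → k ≤ n →
    e k ∈ V v n ∧ DD v (Finset.Ioc k n) (e k) = quasiPoly 1 (v k) := by
  induction n with
  | zero => exact ⟨0, fun k h1 h2 => by omega⟩
  | succ n ih =>
    obtain ⟨e, he⟩ := ih
    have : ∀ k, ∃ g : ℤ → ℂ, 1 ≤ k → k ≤ n + 1 → g ∈ V v (n + 1) ∧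
        DD v (Finset.Ioc k (n + 1)) g = quasiPoly 1 (v k) := by
      intro k
      by_cases hk : 1 ≤ k ∧ k ≤ n
      · obtain ⟨g, hg, hg'⟩ := exists_DD_eq hv (he k hk.1 hk.2).1
        refine ⟨g, fun _ _ => ⟨hg, ?_⟩⟩
        rw [Ioc_succ_eq hk.2, DD_union v (by simp), Module.End.mul_apply, hg',
          (he k hk.1 hk.2).2]
      · refine ⟨quasiPoly 1 (v (n + 1)), fun h1 h2 => ?_⟩
        obtain rfl : k = n + 1 := by omega
        refine ⟨mem_V_of_DD_Ioc hv (Nat.le_succ n) ?_, by simp⟩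
        rw [Nat.Ioc_succ_singleton]
        exact DD_quasiPoly_one v (hv _ h1).ne'
    choose g hg using this
    exact ⟨g, hg⟩

/-- The operator over (k+1, n] maps h into the kernel of 1 - v_{k+1} T, hence to a multiple a of
v_{k+1}^x; then h - a e_{k+1} is killed by the shorter product, and the induction goes on. -/
lemma exists_expansion {n : ℕ} {e : ℕ → ℤ → ℂ}
    (he : ∀ k, 1 ≤ k → k ≤ n → DD v (Finset.Ioc k n) (e k) = quasiPoly 1 (v k)) {k : ℕ}
    (hk : k ≤ n) {h : ℤ → ℂ} (hh : DD v (Finset.Ioc k n) h = 0) :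
    ∃ c : ℕ → ℂ, h = ∑ j ∈ Finset.Ioc k n, c j • e j := by
  induction hk using Nat.decreasingInduction generalizing h with
  | self => exact ⟨0, by simpa using hh⟩
  | of_succ k hk ih =>
    rw [DD_Ioc v (Nat.le_succ k) hk, Nat.Ioc_succ_singleton] at hh
    have h1 := eq_of_DD_singleton_eq_zero (hv (k + 1) (by omega)).ne' hh
    set a := DD v (Finset.Ioc k.succ n) h 0
    obtain ⟨c, hc⟩ := ih (h := h - a • e (k + 1)) (by
      rw [map_sub, map_smul, he (k + 1) (by omega) hk, sub_eq_zero]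
      exact h1)
    refine ⟨Function.update c (k + 1) a, ?_⟩
    rw [Ioc_eq_union (Nat.le_succ k) hk, Nat.Ioc_succ_singleton, Finset.sum_union (by simp),
      Finset.sum_singleton, Function.update_self]
    rw [sub_eq_iff_eq_add] at hc
    rw [hc, add_comm]
    congr 1
    refine Finset.sum_congr rfl fun j hj => ?_
    rw [Function.update_of_ne]
    have := (Finset.mem_Ioc.1 hj).1
    omega

omit hv in
lemma DD_Ioc_triangular {n : ℕ} (hv : ∀ n, 1 ≤ n → 0 < v n) {e : ℤ → ℂ} {k : ℕ} (hk1 : 1 ≤ k) (hk : k ≤ n)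
    (he : DD v (Finset.Ioc k n) e = quasiPoly 1 (v k)) {l : ℕ} (hl : l < k) :
    DD v (Finset.Ioc l n) e = 0 := by
  rw [DD_Ioc v hl.le hk, he, DD_Ioc v (Nat.le_sub_one_of_lt hl) (Nat.sub_le k 1)]
  have : Finset.Ioc (k - 1) k = {k} := by ext x; simp; omega
  rw [this, DD_quasiPoly_one v (hv k hk1).ne', map_zero]

/-- The matrix of pairings is, for functions killed by `DD v (Ioc m n)`, a constant matrix times a
triangular one. -/
lemma exists_det_pairing {ι : Type*} [Fintype ι] [LinearOrder ι] {lab : ι → ℕ}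
    (hmono : StrictMono lab) {m n : ℕ} (hmn : m ≤ n) (hlab : ∀ j, (∃ i, lab i = j) ↔ m < j ∧ j ≤ n)
    {h : ι → ℤ → ℂ} (hh : ∀ k, DD v (Finset.Ioc m n) (h k) = 0) :
    ∃ κ : ℂ, ∀ (A B : ℂ) (η : ι → ℤ),
      Matrix.det (Matrix.of fun k l => DD v (Finset.Ioc (lab l) n) (conv (h k) (expc A B)) (η l)) =
        κ * ∏ l, ((v (lab l) : ℂ) ^ η l * Complex.exp (A * v (lab l) + B / v (lab l))) := by
  classical
  obtain ⟨e, he⟩ := exists_triangular_basis hv n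
  have hc := fun k => exists_expansion hv (fun k h1 h2 => (he k h1 h2).2) hmn (hh k)
  choose c hc using hc
  have hl : ∀ i, m < lab i ∧ lab i ≤ n := fun i => (hlab _).1 ⟨i, rfl⟩
  obtain ⟨R, hR, hR'⟩ := exists_large_radius hv n
  obtain ⟨r, hr, hr'⟩ := exists_small_radius hv n
  have hsp : ∀ {f}, f ∈ V v n → Split R r f := fun hf => split_of_mem_V hR hr hv hr' hR' hf
  have hsum : ∀ k, h k = ∑ i, c k (lab i) • e (lab i) := by
    intro k
    rw [hc k]
    have : Finset.Ioc m n = Finset.univ.image lab := by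
      ext j; simp [hlab]
    rw [this, Finset.sum_image (fun a _ b _ hab => hmono.injective hab)]
  -- The constant is the determinant of the coefficients of `h` in the basis `e`. It depends on
  -- neither `A`, `B` nor `η`, so it can later be found by evaluating at one convenient choice of
  -- them.
  refine ⟨Matrix.det (Matrix.of fun k i => c k (lab i)), fun A B η => ?_⟩
  have hw1 := wt_expc A B hR
  have hw2 := wt_expc A B hr
  have hmat : (Matrix.of fun k l => DD v (Finset.Ioc (lab l) n) (conv (h k) (expc A B)) (η l)) =
      (Matrix.of fun k i => c k (lab i)) * (Matrix.of fun i l =>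
        DD v (Finset.Ioc (lab l) n) (conv (e (lab i)) (expc A B)) (η l)) := by
    ext k l
    rw [Matrix.mul_apply]
    simp only [Matrix.of_apply]
    have h1 : conv (h k) (expc A B) = ∑ i, c k (lab i) • conv (e (lab i)) (expc A B) := by
      rw [hsum k]
      have : ∀ s : Finset ι, Split R r (∑ i ∈ s, c k (lab i) • e (lab i)) ∧
          conv (∑ i ∈ s, c k (lab i) • e (lab i)) (expc A B) =
          ∑ i ∈ s, c k (lab i) • conv (e (lab i)) (expc A B) := by
        intro s
        induction s using Finset.induction_on with
        | empty => exact ⟨by simpa using split_zero, by simp [conv_zero_left]⟩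
        | insert i s hi ih =>
          have hi' := (hsp (he (lab i) (by have := hl i; omega) (hl i).2).1).smul (c k (lab i))
          rw [Finset.sum_insert hi, Finset.sum_insert hi]
          exact ⟨hi'.add hR hr ih.1, by
            rw [hi'.conv_add hR hr ih.1 hw1 hw2, ih.2, conv_smul_left]⟩
      exact (this Finset.univ).2
    rw [h1, map_sum, Finset.sum_apply]
    simp
  rw [hmat, Matrix.det_mul]
  congr 1
  rw [Matrix.det_of_isUpperTriangular]
  · refine Finset.prod_congr rfl fun l _ => ?_
    have h1 := he (lab l) (by have := hl l; omega) (hl l).2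
    rw [Matrix.of_apply, (hsp h1.1).DD_conv hR hr hw1 hw2, h1.2,
      conv_quasiPoly_one (hv _ (by have := hl l; omega))]
    simp [quasiPoly, mul_comm]
  · intro i l hil
    replace hil : l < i := hil
    have h1 := he (lab i) (by have := hl i; omega) (hl i).2
    rw [Matrix.of_apply, (hsp h1.1).DD_conv hR hr hw1 hw2,
      DD_Ioc_triangular hv (by have := hl i; omega) (hl i).2 h1.2 (hmono hil), conv_zero_left]
    rfl

end

end PushASEP

/-! ### Ψ and φ as coefficients; existence and uniqueness of the dual functions -/

namespace PushASEP
open Filter Topology Polynomial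

section
variable {v : ℕ → ℝ} (hv : ∀ n, 1 ≤ n → 0 < v n)
include hv

/-- After cancellation only numerators with l < j ≤ n or denominators with n < j ≤ l remain, and one
of these ranges is empty. So one statement covers the Ψ's of nonnegative and of negative lower index
n - l. -/
lemma Psi_eq {a b : ℝ → ℝ} {y : ℕ → ℤ} {ρ : ℝ} {n l N : ℕ} (hρ : IsSmallRadius v N ρ)
    (hl : l ≤ N) {c : ℤ → ℂ} {t : ℝ}
    (hc : HasLaurent ρ (fun z => (∏ j ∈ Finset.Ioc l n, (1 - (v j : ℂ) * z)) *
      symbol v (a t) (b t) (Finset.Ioc n l) z) c) (x : ℤ) :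
    Psi v a b y ρ n t l x = c (y l - x) := by
  rw [Psi, ← hc.coeff hρ.1]
  congr 1
  refine circleIntegral.integral_congr hρ.1.le fun z hz => ?_
  have hz' : ‖z‖ = ρ := by simpa using hz
  have hne : ∀ S : Finset ℕ, S ⊆ Finset.Icc 1 N → ∏ j ∈ S, (1 - (v j : ℂ) * z) ≠ 0 := fun S hS =>
    Finset.prod_ne_zero_iff.2 fun j hj => by
      have := Finset.mem_Icc.1 (hS hj)
      exact one_sub_ne_zero (hv j this.1) (hρ.mul_lt hv this.1 this.2).ne hz'
  simp only [symbol]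
  rw [show -(y l - x) - 1 = x - y l - 1 by ring, mul_assoc, Finset.prod_inv_distrib]
  congr 1
  rw [mul_left_comm]
  congr 1
  have h1 : ∏ j ∈ Finset.Icc 1 l, (1 - (v j : ℂ) * z) ≠ 0 :=
    hne _ (Finset.Icc_subset_Icc_right hl)
  have h2 : ∏ j ∈ Finset.Ioc n l, (1 - (v j : ℂ) * z) ≠ 0 :=
    hne _ fun j hj => by
      have := Finset.mem_Ioc.1 hj
      exact Finset.mem_Icc.2 ⟨by omega, by omega⟩
  rw [← div_eq_mul_inv, div_eq_div_iff h1 h2, ← Ioc_zero_eq, ← Ioc_zero_eq]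
  have hdis : ∀ p q r : ℕ, Disjoint (Finset.Ioc p q) (Finset.Ioc q r) := fun p q r => by
    rw [Finset.disjoint_left]; intro x; simp; omega
  rcases le_total n l with h | h
  · rw [Finset.Ioc_eq_empty (a := l) (by omega), Finset.prod_empty, one_mul,
      Ioc_eq_union (Nat.zero_le n) h, Finset.prod_union (hdis _ _ _)]
  · rw [Finset.Ioc_eq_empty (a := n) (by omega), Finset.prod_empty, mul_one,
      Ioc_eq_union (Nat.zero_le l) h, Finset.prod_union (hdis _ _ _), mul_comm]

lemma Psi_eq_of_le {a b : ℝ → ℝ} {y : ℕ → ℤ} {ρ : ℝ} {n l : ℕ} (hρ : IsSmallRadius v n ρ)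
    (hl : l ≤ n) (t : ℝ) (x : ℤ) :
    Psi v a b y ρ n t l x = DD v (Finset.Ioc l n) (expc (a t) (b t)) (y l - x) := by
  refine Psi_eq hv hρ hl ?_ x
  refine ((hasLaurent_expc _ _ hρ.1).DD hρ.1 v _).congr fun z _ => ?_
  simp [symbol, Finset.Ioc_eq_empty (a := n) (b := l) (by omega)]

lemma phi_eq {a b : ℝ → ℝ} {ρ : ℝ} {n₁ n₂ : ℕ} (hρ : IsSmallRadius v n₂ ρ) {t₁ t₂ : ℝ}
    (h : Prec n₁ t₁ n₂ t₂) (x y : ℤ) :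
    phi v a b ρ n₁ t₁ n₂ t₂ x y =
      inner v (a t₁ - a t₂) (b t₁ - b t₂) (Finset.Ioc n₁ n₂) (y - x) := by
  rw [phi, if_pos h, ← (hasLaurent_inner (v := v) (S := Finset.Ioc n₁ n₂) (fun j hj => hv j ?_)
    _ _ hρ.1 fun j hj => ?_).coeff hρ.1]
  · congr 1
    refine circleIntegral.integral_congr hρ.1.le fun z hz => ?_
    simp only [symbol]
    rw [Complex.exp_add, Finset.prod_inv_distrib, show -(y - x) - 1 = -(y - x + 1) by ring,
      zpow_neg]
    ring
  · have := Finset.mem_Ioc.1 hj; omega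
  · have := Finset.mem_Ioc.1 hj
    exact hρ.mul_lt hv (by omega) (by omega)

lemma split_of_V {n : ℕ} {ρ : ℝ} (hρ : IsSmallRadius v n ρ) :
    ∃ R : ℝ, 0 < R ∧ ∀ f ∈ V v n, Split R ρ f := by
  obtain ⟨R, hR, hR'⟩ := exists_large_radius hv n
  exact ⟨R, hR, fun f hf => split_of_mem_V hR hρ.1 hv (fun j h1 h2 => hρ.mul_lt hv h1 h2) hR' hf⟩

lemma DD_conv_expc {n : ℕ} {f : ℤ → ℂ} (hf : f ∈ V v n) (A B : ℂ) (S : Finset ℕ) :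
    DD v S (conv f (expc A B)) = conv (DD v S f) (expc A B) := by
  obtain ⟨R, hR, hR'⟩ := exists_large_radius hv n
  obtain ⟨r, hr, hr'⟩ := exists_small_radius hv n
  exact (split_of_mem_V hR hr hv hr' hR' hf).DD_conv hR hr (wt_expc A B hR) (wt_expc A B hr) v S

lemma conv_expc_mem_V {n : ℕ} {f : ℤ → ℂ} (hf : f ∈ V v n) (A B : ℂ) :
    conv f (expc A B) ∈ V v n := by
  rw [mem_V_iff hv, DD_conv_expc hv hf, (mem_V_iff hv).1 hf, conv_zero_left]

lemma conv_expc_conv_expc {n : ℕ} {f : ℤ → ℂ} (hf : f ∈ V v n) (A B A' B' : ℂ) :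
    conv (conv f (expc A B)) (expc A' B') = conv f (expc (A + A') (B + B')) := by
  obtain ⟨R, hR, hR'⟩ := exists_large_radius hv n
  obtain ⟨r, hr, hr'⟩ := exists_small_radius hv n
  rw [(split_of_mem_V hR hr hv hr' hR' hf).conv_assoc hR hr (wt_expc A B hR) (wt_expc A B hr)
    (wt_expc A' B' hR) (wt_expc A' B' hr), conv_expc_expc]

/-- Since Ψ(x) is a coefficient at y_l - x, the pairing is a convolution evaluated at y_l, and the
difference operator may be moved outside it. -/
lemma hasSum_Psi_mul {a b : ℝ → ℝ} {y : ℕ → ℤ} {ρ : ℝ} {n l : ℕ} (hρ : IsSmallRadius v n ρ)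
    (hl : l ≤ n) (t : ℝ) {f : ℤ → ℂ} (hf : f ∈ V v n) :
    HasSum (fun x => Psi v a b y ρ n t l x * f x)
      (DD v (Finset.Ioc l n) (conv f (expc (a t) (b t))) (y l)) := by
  obtain ⟨R, hR, hR'⟩ := split_of_V hv hρ
  have hw1 := wt_expc (a t) (b t) hR
  have hw2 := wt_expc (a t) (b t) hρ.1
  have h1 := ((hR' f hf).summable hR hρ.1 (hw1.DD hR v (Finset.Ioc l n))
    (hw2.DD hρ.1 v (Finset.Ioc l n)) (y l)).hasSum
  rw [← (hR' f hf).conv_DD hR hρ.1 hw1 hw2]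
  simp only [Psi_eq_of_le hv hρ hl, mul_comm _ (f _)]
  exact h1

omit hv in
lemma conv_sum_smul {R r : ℝ} (hR : 0 < R) (hr : 0 < r) {ι : Type*} (s : Finset ι) {f : ι → ℤ → ℂ}
    (hf : ∀ i ∈ s, Split R r (f i)) (c : ι → ℂ) {d : ℤ → ℂ} (h1 : Wt R d) (h2 : Wt r d) :
    conv (∑ i ∈ s, c i • f i) d = ∑ i ∈ s, c i • conv (f i) d := by
  classical
  have : Split R r (∑ i ∈ s, c i • f i) ∧
      conv (∑ i ∈ s, c i • f i) d = ∑ i ∈ s, c i • conv (f i) d := by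
    induction s using Finset.induction_on with
    | empty => exact ⟨by simpa using split_zero, by simp [conv_zero_left]⟩
    | insert i s hi ih =>
      have hi' := (hf i (Finset.mem_insert_self _ _)).smul (c i)
      have ih' := ih fun j hj => hf j (Finset.mem_insert_of_mem hj)
      rw [Finset.sum_insert hi, Finset.sum_insert hi]
      exact ⟨hi'.add hR hr ih'.1, by rw [hi'.conv_add hR hr ih'.1 h1 h2, ih'.2, conv_smul_left]⟩
  exact this.2

/-- Induction on l: once the operator over (l, n] kills g * e, the operator over (l+1, n] sends it
to a multiple of v_{l+1}^x, and vanishing at the single point y_{l+1} makes that multiple zero. At l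
= n the convolution itself vanishes, and convolving with the inverse exponential recovers g = 0. -/
lemma eq_zero_of_pairing {y : ℕ → ℤ} {n : ℕ} {A B : ℂ} {g : ℤ → ℂ} (hg : g ∈ V v n)
    (h : ∀ l, 1 ≤ l → l ≤ n → DD v (Finset.Ioc l n) (conv g (expc A B)) (y l) = 0) : g = 0 := by
  have h1 : ∀ l, l ≤ n → DD v (Finset.Ioc l n) (conv g (expc A B)) = 0 := by
    intro l
    induction l with
    | zero => intro _; rw [Ioc_zero_eq]; exact (mem_V_iff hv).1 (conv_expc_mem_V hv hg A B)
    | succ l ih =>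
      intro hl
      have h2 := ih (by omega)
      rw [DD_Ioc v (Nat.le_succ l) hl, Nat.Ioc_succ_singleton] at h2
      have h3 := eq_of_DD_singleton_eq_zero (hv (l + 1) (by omega)).ne' h2
      have h4 := h (l + 1) (by omega) hl
      change DD v (Finset.Ioc (l + 1) n) (conv g (expc A B)) = _ at h3
      have hv' : (v (l + 1) : ℂ) ≠ 0 := by exact_mod_cast (hv (l + 1) (by omega)).ne'
      rw [h3] at h4
      simp only [quasiPoly, Pi.smul_apply, eval_one, one_mul, smul_eq_mul, mul_eq_zero,
        zpow_ne_zero _ hv', or_false] at h4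
      change DD v (Finset.Ioc (l + 1) n) (conv g (expc A B)) 0 = _ at h4
      rw [h3, Nat.succ_eq_add_one, h4, zero_smul]
  have h2 := h1 n le_rfl
  simp only [Finset.Ioc_self, DD_empty, Module.End.one_apply] at h2
  have h3 := conv_expc_conv_expc hv hg A B (-A) (-B)
  rw [h2, conv_zero_left, add_neg_cancel, add_neg_cancel, conv_expc_zero] at h3
  exact h3.symm

/-- In the triangular basis the Gram matrix is upper triangular with nonzero diagonal; its inverse
gives the dual functions. -/
lemma exists_dual (y : ℕ → ℤ) (n : ℕ) (A B : ℂ) : ∃ Φ : Fin n → ℤ → ℂ, (∀ k, Φ k ∈ V v n) ∧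
    ∀ k l : Fin n, DD v (Finset.Ioc (l + 1) n) (conv (Φ k) (expc A B)) (y (l + 1)) =
      if k = l then 1 else 0 := by
  obtain ⟨e, he⟩ := exists_triangular_basis hv n
  obtain ⟨R, hR, hR'⟩ := exists_large_radius hv n
  obtain ⟨r, hr, hr'⟩ := exists_small_radius hv n
  have hsp : ∀ {f}, f ∈ V v n → Split R r f := fun hf => split_of_mem_V hR hr hv hr' hR' hf
  set G : Matrix (Fin n) (Fin n) ℂ := Matrix.of fun k l =>
    DD v (Finset.Ioc (l + 1) n) (conv (e (k + 1)) (expc A B)) (y (l + 1)) with hG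
  have heV : ∀ k : Fin n, e (k + 1) ∈ V v n := fun k => (he (k + 1) (by omega) (by omega)).1
  have hdet : IsUnit G.det := by
    rw [isUnit_iff_ne_zero, Matrix.det_of_isUpperTriangular]
    · refine Finset.prod_ne_zero_iff.2 fun l _ => ?_
      have h1 := he (l + 1) (by omega) (by omega)
      rw [hG, Matrix.of_apply, DD_conv_expc hv h1.1, h1.2, conv_quasiPoly_one (hv _ (by omega))]
      have hv' : (v (l + 1) : ℂ) ≠ 0 := by exact_mod_cast (hv (l + 1) (by omega)).ne'
      simp [quasiPoly, zpow_ne_zero _ hv', Complex.exp_ne_zero]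
    · intro i l hil
      replace hil : l < i := hil
      have h1 := he (i + 1) (by omega) (by omega)
      rw [hG, Matrix.of_apply, DD_conv_expc hv h1.1, DD_Ioc_triangular hv (by omega) (by omega)
        h1.2 (by simpa using hil), conv_zero_left]
      rfl
  refine ⟨fun k => ∑ i, G⁻¹ k i • e (i + 1), fun k => Submodule.sum_mem _ fun i _ =>
    Submodule.smul_mem _ _ (heV i), fun k l => ?_⟩
  rw [conv_sum_smul hR hr _ (fun i _ => hsp (heV i)) _ (wt_expc A B hR) (wt_expc A B hr), map_sum,
    Finset.sum_apply]
  have := congrFun (congrFun (Matrix.nonsing_inv_mul G hdet) k) l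
  rw [Matrix.mul_apply, Matrix.one_apply] at this
  simpa [hG] using this

/-- Both sides lie in V_n and have the same pairings, so `eq_zero_of_pairing` applies to their
difference. -/
lemma eq_sum_of_dual {y : ℕ → ℤ} {n : ℕ} {A B : ℂ} {Φ : Fin n → ℤ → ℂ} (hΦ : ∀ k, Φ k ∈ V v n)
    (h : ∀ k l : Fin n, DD v (Finset.Ioc (l + 1) n) (conv (Φ k) (expc A B)) (y (l + 1)) =
      if k = l then 1 else 0) {g : ℤ → ℂ} (hg : g ∈ V v n) :
    g = ∑ k : Fin n, DD v (Finset.Ioc (k + 1) n) (conv g (expc A B)) (y (k + 1)) • Φ k := by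
  obtain ⟨R, hR, hR'⟩ := exists_large_radius hv n
  obtain ⟨r, hr, hr'⟩ := exists_small_radius hv n
  have hsp : ∀ {f}, f ∈ V v n → Split R r f := fun hf => split_of_mem_V hR hr hv hr' hR' hf
  rw [← sub_eq_zero]
  set c : Fin n → ℂ := fun k => DD v (Finset.Ioc (k + 1) n) (conv g (expc A B)) (y (k + 1))
  refine eq_zero_of_pairing hv (y := y) (A := A) (B := B) (Submodule.sub_mem _ hg
    (Submodule.sum_mem _ fun k _ => Submodule.smul_mem _ (c k) (hΦ k))) fun l h1 h2 => ?_
  have hs : ∑ k, c k • Φ k ∈ V v n := Submodule.sum_mem _ fun k _ => Submodule.smul_mem _ _ (hΦ k)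
  have e1 : g - ∑ k, c k • Φ k = g + (-1 : ℂ) • ∑ k, c k • Φ k := by simp [sub_eq_add_neg]
  have hw1 := wt_expc A B hR
  have hw2 := wt_expc A B hr
  rw [e1, (hsp hg).conv_add hR hr ((hsp hs).smul _) hw1 hw2, conv_smul_left,
    conv_sum_smul hR hr _ (fun i _ => hsp (hΦ i)) _ hw1 hw2, map_add, map_smul, map_sum]
  obtain ⟨l, rfl⟩ : ∃ l' : ℕ, l = l' + 1 := ⟨l - 1, by omega⟩
  have h3 := fun k => h k ⟨l, by omega⟩
  simp only [Pi.add_apply, Pi.smul_apply, Finset.sum_apply, map_smul, smul_eq_mul] at h3 ⊢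
  simp only [h3]
  simp [c]

lemma isDual_iff {a b : ℝ → ℝ} {y : ℕ → ℤ} {ρ : ℝ} {n : ℕ} (hρ : IsSmallRadius v n ρ) {t : ℝ}
    {Φ : Fin n → ℤ → ℂ} : IsDual v a b y ρ n t Φ ↔ (∀ k, Φ k ∈ V v n) ∧
    ∀ k l : Fin n, DD v (Finset.Ioc (l + 1) n) (conv (Φ k) (expc (a t) (b t))) (y (l + 1)) =
      if k = l then 1 else 0 := by
  constructor
  · intro h
    have h1 : ∀ k, Φ k ∈ V v n := fun k => by
      rw [← h.span_eq]; exact Submodule.subset_span ⟨k, rfl⟩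
    exact ⟨h1, fun k l => (hasSum_Psi_mul hv hρ (by omega) t (h1 k)).unique (h.orthogonal k l)⟩
  · rintro ⟨h1, h2⟩
    refine ⟨fun k l => h2 k l ▸ hasSum_Psi_mul hv hρ (by omega) t (h1 k), le_antisymm ?_ ?_⟩
    · rw [Submodule.span_le]
      rintro _ ⟨k, rfl⟩
      exact h1 k
    · intro g hg
      rw [eq_sum_of_dual hv h1 h2 hg]
      exact Submodule.sum_mem _ fun k _ => Submodule.smul_mem _ _ (Submodule.subset_span ⟨k, rfl⟩)

lemma existsUnique_isDual {a b : ℝ → ℝ} {y : ℕ → ℤ} {ρ : ℝ} {n : ℕ} (hρ : IsSmallRadius v n ρ)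
    (t : ℝ) : ∃! Φ : Fin n → ℤ → ℂ, IsDual v a b y ρ n t Φ := by
  obtain ⟨Φ, h1, h2⟩ := exists_dual hv y n (a t) (b t)
  refine ⟨Φ, (isDual_iff hv hρ).2 ⟨h1, h2⟩, fun Φ' h' => ?_⟩
  obtain ⟨h3, h4⟩ := (isDual_iff hv hρ).1 h'
  funext k
  rw [eq_sum_of_dual hv h1 h2 (h3 k)]
  simp only [h4]
  simp

/-- The last dual functions span the kernel of `DD v (Ioc m n)`. -/
lemma DD_dual_eq_zero {y : ℕ → ℤ} {m n : ℕ} (hmn : m ≤ n) {A B : ℂ} {f : ℤ → ℂ} (hf : f ∈ V v n)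
    (h : ∀ l, 1 ≤ l → l ≤ m → DD v (Finset.Ioc l n) (conv f (expc A B)) (y l) = 0) :
    DD v (Finset.Ioc m n) f = 0 := by
  have h1 : DD v (Finset.Ioc m n) f ∈ V v m := by
    rw [mem_V_iff hv, ← Ioc_zero_eq, ← DD_Ioc v (Nat.zero_le m) hmn, Ioc_zero_eq]
    exact (mem_V_iff hv).1 hf
  refine eq_zero_of_pairing hv (y := y) (A := A) (B := B) h1 fun l hl hl' => ?_
  rw [← DD_conv_expc hv hf, ← DD_Ioc v hl' hmn]
  exact h l hl hl'

end

/-! ### Fredholm determinants: convergence and reduction to finite rank -/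

open scoped ComplexOrder in
/-- A weak form of Hadamard's inequality. -/
lemma norm_det_le_sqrt {r : ℕ} (M : Matrix (Fin r) (Fin r) ℂ) (h : ∀ i j, ‖M i j‖ ≤ 1) :
    ‖M.det‖ ≤ Real.sqrt ((r : ℝ) ^ r) := by
  rcases Nat.eq_zero_or_pos r with rfl | hr
  · simp
  have hr' : (0 : ℝ) < r := by exact_mod_cast hr
  have hps : (M * M.conjTranspose).PosSemidef := Matrix.posSemidef_self_mul_conjTranspose M
  have hH := hps.isHermitian
  have hdet := hH.det_eq_prod_eigenvalues
  have htr := hH.trace_eq_sum_eigenvalues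
  have hnn := hps.eigenvalues_nonneg
  have h1 : ‖M.det‖ ^ 2 = ∏ i, hH.eigenvalues i := by
    rw [Matrix.det_mul, Matrix.det_conjTranspose] at hdet
    have := congrArg norm hdet
    rw [norm_mul, norm_star, ← sq] at this
    rw [this, norm_prod]
    refine Finset.prod_congr rfl fun i _ => ?_
    simp [abs_of_nonneg (hnn i)]
  have h2 : ∑ i, hH.eigenvalues i ≤ r * r := by
    have h3 : ((∑ i, hH.eigenvalues i : ℝ) : ℂ) = ((∑ i, ∑ j, ‖M i j‖ ^ 2 : ℝ) : ℂ) := by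
      rw [Complex.ofReal_sum]
      refine htr.symm.trans ?_
      rw [Matrix.trace]
      push_cast
      refine Finset.sum_congr rfl fun i _ => ?_
      rw [Matrix.diag_apply, Matrix.mul_apply]
      refine Finset.sum_congr rfl fun j _ => ?_
      rw [Matrix.conjTranspose_apply, Complex.star_def, Complex.mul_conj']
    rw [Complex.ofReal_inj.1 h3]
    calc ∑ i, ∑ j, ‖M i j‖ ^ 2 ≤ ∑ i : Fin r, ∑ j : Fin r, (1 : ℝ) :=
          Finset.sum_le_sum fun i _ => Finset.sum_le_sum fun j _ =>
            pow_le_one₀ (norm_nonneg _) (h i j)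
      _ = r * r := by simp
  -- Arithmetic-geometric mean for the eigenvalues of M M*: their product is |det M|² and their sum,
  -- the trace ∑ |M i j|², is at most r².
  have h3 := Real.geom_mean_le_arith_mean_weighted Finset.univ (fun _ : Fin r => (r : ℝ)⁻¹)
    hH.eigenvalues (fun _ _ => by positivity) (by simp [hr'.ne']) (fun i _ => hnn i)
  rw [← Finset.mul_sum, Real.finsetProd_rpow _ _ (fun i _ => hnn i)] at h3
  have h4 : (r : ℝ)⁻¹ * ∑ i, hH.eigenvalues i ≤ r := by
    rw [inv_mul_le_iff₀ hr']; exact h2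
  have h5 : ∏ i, hH.eigenvalues i ≤ (r : ℝ) ^ r := by
    have hp : 0 ≤ ∏ i, hH.eigenvalues i := Finset.prod_nonneg fun i _ => hnn i
    calc ∏ i, hH.eigenvalues i = ((∏ i, hH.eigenvalues i) ^ ((r : ℝ)⁻¹)) ^ r :=
          (Real.rpow_inv_natCast_pow hp hr.ne').symm
      _ ≤ _ := pow_le_pow_left₀ (Real.rpow_nonneg hp _) (h3.trans h4) r
  exact Real.le_sqrt_of_sq_le (h1 ▸ h5)

lemma hasSum_prod_pow {X : Type*} {f : X → ℝ} (hf : ∀ x, 0 ≤ f x) {S : ℝ} (hs : HasSum f S)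
    (r : ℕ) : HasSum (fun p : Fin r → X => ∏ i, f (p i)) (S ^ r) := by
  induction r with
  | zero =>
    simp
  | succ r ih =>
    have hnn : (0 : (Fin r → X) → ℝ) ≤ fun p => ∏ i, f (p i) := fun p =>
      Finset.prod_nonneg fun i _ => hf _
    have h0 := Summable.mul_of_nonneg hs.summable ih.summable hf hnn
    have h1 := hs.mul ih h0
    rw [← (Fin.consEquiv fun _ => X).hasSum_iff, pow_succ']
    have : (fun p : Fin (r + 1) → X => ∏ i, f (p i)) ∘ (Fin.consEquiv fun _ => X) =
        fun x : X × (Fin r → X) => f x.1 * ∏ i, f (x.2 i) := by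
      funext x
      simp [Fin.consEquiv, Fin.prod_univ_succ]
    rw [this]
    exact h1

/-- From r^r ≤ e^r r! the terms are at most B^r / √(r!) with B = √e |A|. Writing this as (2B)^r /
√(r!) times 2^{-r} and bounding the product by the sum of squares leaves an exponential and a
geometric series. -/
lemma summable_sqrt_pow_div_factorial (A : ℝ) :
    Summable fun r : ℕ => Real.sqrt ((r : ℝ) ^ r) * A ^ r / (r.factorial : ℝ) := by
  have h1 := (Real.summable_pow_div_factorial ((2 * (Real.sqrt (Real.exp 1) * |A|)) ^ 2)).add
    (summable_geometric_of_lt_one (r := (1 / 4 : ℝ)) (by norm_num) (by norm_num))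
  refine Summable.of_norm_bounded h1 fun r => ?_
  set F : ℝ := (r.factorial : ℝ) with hF
  have hF0 : 0 < F := by positivity
  set B := Real.sqrt (Real.exp 1) * |A| with hB
  have hB0 : 0 ≤ B := by positivity
  have h2 : (r : ℝ) ^ r ≤ Real.exp 1 ^ r * F := by
    have := Real.pow_div_factorial_le_exp (x := (r : ℝ)) (by positivity) r
    rw [div_le_iff₀ hF0, ← Real.exp_one_pow] at this
    exact this
  have h3 : Real.sqrt ((r : ℝ) ^ r) ≤ Real.sqrt (Real.exp 1) ^ r * Real.sqrt F := by
    refine (Real.sqrt_le_sqrt h2).trans ?_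
    rw [Real.sqrt_mul (by positivity), Real.sqrt_eq_rpow, Real.sqrt_eq_rpow (Real.exp 1)]
    rw [← Real.rpow_natCast, ← Real.rpow_natCast, ← Real.rpow_mul (Real.exp_pos 1).le,
      ← Real.rpow_mul (Real.exp_pos 1).le, mul_comm (r : ℝ)]
  have hs : Real.sqrt F * Real.sqrt F = F := Real.mul_self_sqrt hF0.le
  have hs0 : 0 < Real.sqrt F := Real.sqrt_pos.2 hF0
  calc ‖Real.sqrt ((r : ℝ) ^ r) * A ^ r / F‖ = Real.sqrt ((r : ℝ) ^ r) * |A| ^ r / F := by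
        rw [norm_div, norm_mul, norm_pow, Real.norm_eq_abs, Real.norm_eq_abs, Real.norm_eq_abs,
          abs_of_nonneg (Real.sqrt_nonneg _), abs_of_pos hF0]
    _ ≤ Real.sqrt (Real.exp 1) ^ r * Real.sqrt F * |A| ^ r / F := by gcongr
    _ = B ^ r / Real.sqrt F := by
        rw [hB, mul_pow]
        rw [div_eq_div_iff hF0.ne' hs0.ne']
        linear_combination (Real.sqrt (Real.exp 1) ^ r * |A| ^ r) * hs
    _ ≤ ((2 * B) ^ 2) ^ r / F + (1 / 4) ^ r := by
        have e1 : B ^ r / Real.sqrt F = ((2 * B) ^ r / Real.sqrt F) * (1 / 2) ^ r := by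
          rw [div_mul_eq_mul_div, ← mul_pow]; congr 2; ring
        have e2 : ((2 * B) ^ 2) ^ r / F = ((2 * B) ^ r / Real.sqrt F) ^ 2 := by
          rw [div_pow, sq (Real.sqrt F), hs, ← pow_mul, ← pow_mul, mul_comm 2 r]
        have e3 : (1 / 4 : ℝ) ^ r = ((1 / 2) ^ r) ^ 2 := by
          rw [← pow_mul, mul_comm, pow_mul]; norm_num
        rw [e1, e2, e3]
        nlinarith [sq_nonneg ((2 * B) ^ r / Real.sqrt F - (1 / 2) ^ r),
          sq_nonneg ((2 * B) ^ r / Real.sqrt F), sq_nonneg ((1 / 2 : ℝ) ^ r)]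

/-- A term of the Fredholm series. -/
noncomputable def fredholmTerm {X : Type*} (A : X → X → ℂ) (q : Σ r : ℕ, (Fin r → X)) : ℂ :=
  (-1 : ℂ) ^ q.1 / (q.1.factorial : ℂ) *
    Matrix.det (Matrix.of fun i j : Fin q.1 => A (q.2 i) (q.2 j))

/-- An upper bound for the terms of the Fredholm series. -/
noncomputable def fredholmBound {X : Type*} (α : X → ℝ) (q : Σ r : ℕ, (Fin r → X)) : ℝ :=
  Real.sqrt ((q.1 : ℝ) ^ q.1) / (q.1.factorial : ℝ) * ∏ i, α (q.2 i) ^ 2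

/-- Weights are pulled out of the rows and the columns, leaving a matrix with entries bounded by 1
for Hadamard's inequality. -/
lemma norm_fredholmTerm_le {X : Type*} {A : X → X → ℂ} {α : X → ℝ} (h0 : ∀ p, 0 ≤ α p)
    (h : ∀ p q, ‖A p q‖ ≤ α p * α q) (q : Σ r : ℕ, (Fin r → X)) :
    ‖fredholmTerm A q‖ ≤ fredholmBound α q := by
  obtain ⟨r, p⟩ := q
  set M : Matrix (Fin r) (Fin r) ℂ := Matrix.of fun i j => A (p i) (p j) / (α (p i) * α (p j))
    with hM
  have hM1 : ∀ i j, ‖M i j‖ ≤ 1 := fun i j => by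
    rw [hM, Matrix.of_apply, norm_div, norm_mul, Complex.norm_real, Complex.norm_real,
      Real.norm_of_nonneg (h0 _), Real.norm_of_nonneg (h0 _)]
    exact div_le_one_of_le₀ (h _ _) (mul_nonneg (h0 _) (h0 _))
  have h1 : (Matrix.of fun i j : Fin r => A (p i) (p j)) =
      Matrix.of fun i j => (α (p i) : ℂ) * (Matrix.of fun i j => (α (p j) : ℂ) * M i j) i j := by
    ext i j
    simp only [hM, Matrix.of_apply]
    -- Where a weight vanishes so does the entry of `A`, hence the convention x / 0 = 0 does no
    -- harm.
    by_cases hz : (α (p i) : ℂ) * α (p j) = 0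
    · have : ‖A (p i) (p j)‖ ≤ 0 := by
        refine (h _ _).trans_eq ?_
        exact_mod_cast hz
      rw [norm_le_zero_iff.1 this]; simp
    · rw [← mul_assoc, mul_div_cancel₀ _ hz]
  rw [fredholmTerm, fredholmBound, norm_mul, norm_div, norm_pow, norm_neg, norm_one, one_pow,
    Complex.norm_natCast]
  simp only
  rw [h1, Matrix.det_mul_column, Matrix.det_mul_row, norm_mul, norm_mul, norm_prod]
  have h2 : ∏ i, ‖(α (p i) : ℂ)‖ = ∏ i, α (p i) := Finset.prod_congr rfl fun i _ => by
    rw [Complex.norm_real, Real.norm_of_nonneg (h0 _)]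
  rw [h2, Finset.prod_pow]
  have h3 : 0 ≤ ∏ i, α (p i) := Finset.prod_nonneg fun i _ => h0 _
  have := norm_det_le_sqrt M hM1
  calc 1 / (r.factorial : ℝ) * ((∏ i, α (p i)) * ((∏ i, α (p i)) * ‖M.det‖))
      ≤ 1 / (r.factorial : ℝ) * ((∏ i, α (p i)) * ((∏ i, α (p i)) * Real.sqrt ((r : ℝ) ^ r))) := by
        gcongr
    _ = _ := by ring

lemma summable_fredholmBound {X : Type*} {α : X → ℝ} (hα : Summable fun p => α p ^ 2) :
    Summable (fredholmBound α) := by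
  have hnn : ∀ q, 0 ≤ fredholmBound α q := fun q => by
    unfold fredholmBound
    exact mul_nonneg (by positivity) (Finset.prod_nonneg fun i _ => sq_nonneg _)
  obtain ⟨S, hS⟩ := hα
  have h1 := fun r => hasSum_prod_pow (fun p => sq_nonneg (α p)) hS r
  have h2 : ∀ r : ℕ, HasSum (fun p : Fin r → X => fredholmBound α ⟨r, p⟩)
      (Real.sqrt ((r : ℝ) ^ r) / (r.factorial : ℝ) * S ^ r) := fun r => (h1 r).mul_left _
  rw [summable_sigma_of_nonneg hnn]
  refine ⟨fun r => (h2 r).summable, ?_⟩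
  refine (summable_sqrt_pow_div_factorial S).congr fun r => ?_
  rw [(h2 r).tsum_eq]
  ring

/-- Tuples with a repetition give two equal rows; each r-element subset is enumerated by r!
injective tuples. -/
lemma sum_det_eq_minors {n : Type*} [Fintype n] [DecidableEq n] (M : Matrix n n ℂ) (r : ℕ) :
    ∑ p : Fin r → n, (Matrix.of fun i j => M (p i) (p j)).det =
      (r.factorial : ℂ) * ∑ s ∈ Finset.univ.powersetCard r,
        (M.submatrix (Subtype.val : s → n) (Subtype.val : s → n)).det := by
  classical
  have h1 : ∑ p : Fin r → n, (Matrix.of fun i j => M (p i) (p j)).det =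
      ∑ p ∈ Finset.univ.filter (fun p : Fin r → n => Function.Injective p),
        (Matrix.of fun i j => M (p i) (p j)).det := by
    rw [Finset.sum_filter]
    refine Finset.sum_congr rfl fun p _ => ?_
    split_ifs with hp
    · rfl
    · simp only [Function.Injective, not_forall] at hp
      obtain ⟨i, j, hij, hne⟩ := hp
      exact Matrix.det_zero_of_row_eq hne (by ext k; simp [hij])
  have hmap : ∀ p ∈ Finset.univ.filter (fun p : Fin r → n => Function.Injective p),
      Finset.univ.image p ∈ (Finset.univ : Finset n).powersetCard r := by
    intro p hp
    rw [Finset.mem_powersetCard]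
    refine ⟨Finset.subset_univ _, ?_⟩
    rw [Finset.card_image_of_injective _ (Finset.mem_filter.1 hp).2, Finset.card_univ,
      Fintype.card_fin]
  rw [h1, ← Finset.sum_fiberwise_of_maps_to hmap, Finset.mul_sum]
  refine Finset.sum_congr rfl fun s hs => ?_
  have hcard := (Finset.mem_powersetCard.1 hs).2
  rw [← nsmul_eq_mul]
  have hc : ((Finset.univ.filter (fun p : Fin r → n => Function.Injective p)).filter
      (fun p => Finset.univ.image p = s)).card = r.factorial := by
    have e0 : Fin r ≃ s := (Finset.equivFinOfCardEq hcard).symm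
    have : Fintype.card (Fin r ≃ s) = r.factorial := by
      rw [Fintype.card_equiv e0, Fintype.card_fin]
    rw [← this, ← Finset.card_univ]
    symm
    refine Finset.card_bij (fun e _ => fun i => (e i : n)) ?_ ?_ ?_
    · intro e _
      simp only [Finset.mem_filter, Finset.mem_univ, true_and]
      refine ⟨Subtype.val_injective.comp e.injective, ?_⟩
      ext x
      simp only [Finset.mem_image, Finset.mem_univ, true_and]
      exact ⟨fun ⟨i, hi⟩ => hi ▸ (e i).2, fun hx => ⟨e.symm ⟨x, hx⟩, by simp⟩⟩
    · intro e _ e' _ hee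
      ext i
      exact congrFun hee i
    · intro p hp
      simp only [Finset.mem_filter, Finset.mem_univ, true_and] at hp
      have hm : ∀ i, p i ∈ s := fun i => hp.2 ▸ Finset.mem_image_of_mem _ (Finset.mem_univ i)
      refine ⟨Equiv.ofBijective (fun i => ⟨p i, hm i⟩) ⟨fun i j hij => hp.1 (by simpa using hij),
        fun ⟨x, hx⟩ => ?_⟩, Finset.mem_univ _, rfl⟩
      rw [← hp.2] at hx
      obtain ⟨i, _, hi⟩ := Finset.mem_image.1 hx
      exact ⟨i, Subtype.ext hi⟩
  rw [← hc, ← Finset.sum_const]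
  refine Finset.sum_congr rfl fun p hp => ?_
  simp only [Finset.mem_filter, Finset.mem_univ, true_and] at hp
  have hm : ∀ i, p i ∈ s := fun i => hp.2 ▸ Finset.mem_image_of_mem _ (Finset.mem_univ i)
  let e : Fin r ≃ s := Equiv.ofBijective (fun i => ⟨p i, hm i⟩)
    ⟨fun i j hij => hp.1 (by simpa using hij), fun ⟨x, hx⟩ => by
      rw [← hp.2] at hx
      obtain ⟨i, _, hi⟩ := Finset.mem_image.1 hx
      exact ⟨i, Subtype.ext hi⟩⟩
  rw [← Matrix.det_submatrix_equiv_self e]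
  rfl

-- The coefficients of det(1 + X M) are the sums of principal minors; set X = -1.
open Polynomial in
lemma det_one_sub_eq_sum {n : Type*} [Fintype n] [DecidableEq n] (M : Matrix n n ℂ) :
    HasSum (fun r : ℕ => (-1 : ℂ) ^ r / (r.factorial : ℂ) *
      ∑ p : Fin r → n, (Matrix.of fun i j => M (p i) (p j)).det) (1 - M).det := by
  set P : ℂ[X] := Matrix.det (1 + (X : ℂ[X]) • M.map C) with hP
  have hcoeff := Matrix.coeff_det_one_add_X_smul_eq_sum_minors M
  have hev : P.eval (-1) = (1 - M).det := by
    rw [hP, ← coe_evalRingHom, RingHom.map_det]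
    congr 1
    ext i j
    simp only [RingHom.mapMatrix_apply, Matrix.map_apply, Matrix.add_apply, Matrix.smul_apply,
      Matrix.sub_apply, Matrix.one_apply, smul_eq_mul, coe_evalRingHom]
    split_ifs <;> simp [sub_eq_add_neg]
  have hterm : ∀ r : ℕ, (-1 : ℂ) ^ r / (r.factorial : ℂ) *
      ∑ p : Fin r → n, (Matrix.of fun i j => M (p i) (p j)).det = P.coeff r * (-1) ^ r := by
    intro r
    have hr : (r.factorial : ℂ) ≠ 0 := by exact_mod_cast r.factorial_ne_zero
    rw [sum_det_eq_minors, ← hcoeff r, ← hP]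
    field_simp
  simp only [hterm]
  rw [← hev, Polynomial.eval_eq_sum_range]
  refine hasSum_sum_of_ne_finset_zero fun r hr => ?_
  rw [coeff_eq_zero_of_natDegree_lt (by simpa using hr), zero_mul]

lemma hasSum_fredholmTerm_finset {X : Type*} [DecidableEq X] (A : X → X → ℂ) (S : Finset X) :
    HasSum (fun q : Σ r : ℕ, (Fin r → X) => if ∀ i, q.2 i ∈ S then fredholmTerm A q else 0)
      (1 - Matrix.of fun p q : S => A p q).det := by
  set ι : (Σ r : ℕ, (Fin r → S)) → Σ r : ℕ, (Fin r → X) := fun q => ⟨q.1, fun i => q.2 i⟩ with hι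
  have hinj : Function.Injective ι := by
    rintro ⟨r, p⟩ ⟨r', p'⟩ h
    simp only [hι, Sigma.mk.injEq] at h
    obtain ⟨rfl, h⟩ := h
    have h' := eq_of_heq h
    congr 1
    funext i
    exact Subtype.ext (congrFun h' i)
  refine (hinj.hasSum_iff ?_).1 ?_
  · rintro ⟨r, p⟩ hq
    rw [if_neg]
    intro h
    exact hq ⟨⟨r, fun i => ⟨p i, h i⟩⟩, rfl⟩
  set M : Matrix S S ℂ := Matrix.of fun p q : S => A p q with hM
  have h1 := det_one_sub_eq_sum M
  have h2 : (fun q : Σ r : ℕ, (Fin r → X) => if ∀ i, q.2 i ∈ S then fredholmTerm A q else 0) ∘ ι =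
      fun q : Σ r : ℕ, (Fin r → S) => fredholmTerm (fun p q : S => A p q) q := by
    funext q
    simp [hι, fredholmTerm]
  rw [h2]
  have hcard : ∀ r ∉ Finset.range (S.card + 1), ∀ p : Fin r → S,
      fredholmTerm (fun p q : S => A p q) ⟨r, p⟩ = 0 := by
    intro r hr p
    have : ¬ Function.Injective p := fun hp => by
      have := Fintype.card_le_of_injective p hp
      simp at this hr
      omega
    simp only [Function.Injective, not_forall] at this
    obtain ⟨i, j, hij, hne⟩ := this
    rw [fredholmTerm, Matrix.det_zero_of_row_eq hne (by ext k; simp [hij]), mul_zero]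
  have hsum : Summable fun q : Σ r : ℕ, (Fin r → S) => fredholmTerm (fun p q : S => A p q) q := by
    refine summable_of_ne_finset_zero
      (s := (Finset.range (S.card + 1)).sigma fun r => (Finset.univ : Finset (Fin r → S))) ?_
    rintro ⟨r, p⟩ hq
    refine hcard r ?_ p
    simpa using hq
  have h3 := hsum.hasSum.sigma fun r => (hasSum_fintype fun p : Fin r → S =>
    fredholmTerm (fun p q : S => A p q) ⟨r, p⟩)
  have h4 : (fun r : ℕ => ∑ p : Fin r → S, fredholmTerm (fun p q : S => A p q) ⟨r, p⟩) =
      fun r : ℕ => (-1 : ℂ) ^ r / (r.factorial : ℂ) *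
        ∑ p : Fin r → S, (Matrix.of fun i j => M (p i) (p j)).det := by
    funext r
    rw [Finset.mul_sum]
    rfl
  rw [h4] at h3
  rw [← h3.unique h1]
  exact hsum.hasSum

lemma det_one_add_of_strict {n : Type*} [Fintype n] [DecidableEq n] (L : Matrix n n ℂ) (b : n → ℕ)
    (h : ∀ p q, ¬ b p < b q → L p q = 0) : (1 + L).det = 1 := by
  have hbt : (1 + L).BlockTriangular b := by
    intro i j hij
    rw [Matrix.add_apply, Matrix.one_apply_ne (by rintro rfl; exact lt_irrefl _ hij),
      h i j (not_lt.2 hij.le), add_zero]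
  rw [hbt.det]
  refine Finset.prod_eq_one fun k _ => ?_
  have : (1 + L).toSquareBlock b k = 1 := by
    ext i j
    rw [Matrix.toSquareBlock_def, Matrix.of_apply, Matrix.add_apply, h _ _ (by rw [i.2, j.2]; simp),
      add_zero, Matrix.one_apply, Matrix.one_apply]
    simp [Subtype.ext_iff]
  rw [this, Matrix.det_one]

/-- Evaluation of a Fredholm determinant of a finite rank perturbation of a strictly upper
triangular kernel. -/
theorem hasFredholmDet_of_finite_rank {X : Type*} {N : ℕ} {B L : X → X → ℂ}
    {u w W : Fin N → X → ℂ} {b : X → ℕ} {m : ℕ} {α : X → ℝ} (hb : ∀ p, b p < m) (h0 : ∀ p, 0 ≤ α p)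
    (hα : Summable fun p => α p ^ 2)
    (hB : ∀ p q, B p q = -L p q + ∑ k, u k p * w k q)
    (hL : ∀ p q, ‖L p q‖ ≤ α p * α q) (hu : ∀ k p, ‖u k p‖ ≤ α p) (hw : ∀ k p, ‖w k p‖ ≤ α p)
    (hLz : ∀ p q, ¬ b p < b q → L p q = 0)
    (hW : ∀ k q, W k q = w k q - ∑' p, W k p * L p q) :
    HasFredholmDet B (Matrix.det (1 - Matrix.of fun k l => ∑' p, W k p * u l p)) := by
  classical
  -- |B| ≤ (1 + N) α α; the square root distributes the constant evenly over the two variables.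
  set β : X → ℝ := fun p => Real.sqrt (1 + N) * α p with hβ
  have hβ0 : ∀ p, 0 ≤ β p := fun p => mul_nonneg (Real.sqrt_nonneg _) (h0 p)
  have hβs : Summable fun p => β p ^ 2 := by
    simp only [hβ, mul_pow]; exact hα.mul_left _
  have hBβ : ∀ p q, ‖B p q‖ ≤ β p * β q := by
    intro p q
    have h1 : ‖B p q‖ ≤ α p * α q + ∑ k : Fin N, α p * α q := by
      rw [hB]
      refine (norm_add_le _ _).trans (add_le_add ((norm_neg _).trans_le (hL p q)) ?_)
      refine (norm_sum_le _ _).trans (Finset.sum_le_sum fun k _ => ?_)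
      rw [norm_mul]
      exact mul_le_mul (hu k p) (hw k q) (norm_nonneg _) (h0 p)
    refine h1.trans_eq ?_
    have := Real.mul_self_sqrt (show (0 : ℝ) ≤ 1 + N by positivity)
    simp only [hβ, Finset.sum_const, Finset.card_univ, Fintype.card_fin, nsmul_eq_mul]
    linear_combination -(α p * α q) * this
  have hsum : Summable (fredholmTerm B) :=
    Summable.of_norm_bounded (summable_fredholmBound hβs) (norm_fredholmTerm_le hβ0 hBβ)
  -- On a finite set of points the series is an ordinary determinant, and dominated convergence lets
  -- the set exhaust `X`. The limit is then computed a second time, by factorising the finite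
  -- determinants.
  have hlim : Tendsto (fun S : Finset X => (1 - Matrix.of fun p q : S => B p q).det) atTop
      (𝓝 (∑' q, fredholmTerm B q)) := by
    have h1 := fun S : Finset X => (hasSum_fredholmTerm_finset B S).tsum_eq
    simp only [← h1]
    refine tendsto_tsum_of_dominated_convergence (summable_fredholmBound hβs) ?_ ?_
    · intro q
      refine tendsto_const_nhds.congr' ?_
      filter_upwards [eventually_ge_atTop (Finset.univ.image q.2)] with S hS
      rw [if_pos fun i => hS (Finset.mem_image_of_mem _ (Finset.mem_univ i))]
    · refine Eventually.of_forall fun S q => ?_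
      split_ifs
      · exact norm_fredholmTerm_le hβ0 hBβ q
      · rw [norm_zero]
        exact (norm_nonneg _).trans (norm_fredholmTerm_le hβ0 hBβ q)
  -- the truncated solution of the triangular system
  have hex : ∀ S : Finset X, ∃ Y : Fin N → X → ℂ, (∀ k, ∀ q ∈ S, Y k q =
      w k q - ∑ p ∈ S, Y k p * L p q) ∧ ∀ k, ∀ q ∉ S, Y k q = 0 := by
    intro S
    set LS : Matrix S S ℂ := Matrix.of fun p q : S => L p q
    have hd : IsUnit (1 + LS).det := by
      rw [det_one_add_of_strict LS (fun p => b p) fun p q h => hLz p q h]; exact isUnit_one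
    set Y : Matrix (Fin N) S ℂ := (Matrix.of fun k (q : S) => w k q) * (1 + LS)⁻¹ with hY
    refine ⟨fun k q => if h : q ∈ S then Y k ⟨q, h⟩ else 0, ?_, fun k q hq => dif_neg hq⟩
    intro k q hq
    have h1 : Y * (1 + LS) = Matrix.of fun k (q : S) => w k q := by
      rw [hY, Matrix.nonsing_inv_mul_cancel_right _ _ hd]
    rw [Matrix.mul_add, Matrix.mul_one] at h1
    have h2 := congrFun (congrFun h1 k) ⟨q, hq⟩
    rw [Matrix.add_apply, Matrix.mul_apply] at h2
    simp only [Matrix.of_apply, LS] at h2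
    beta_reduce
    rw [dif_pos hq, ← h2, ← Finset.sum_coe_sort S]
    simp
  choose Y hY hY0 using hex
  have hdet : ∀ S : Finset X, (1 - Matrix.of fun p q : S => B p q).det =
      (1 - Matrix.of fun k l : Fin N => ∑' p, Y S k p * u l p).det := by
    intro S
    set LS : Matrix S S ℂ := Matrix.of fun p q : S => L p q with hLS
    set U : Matrix S (Fin N) ℂ := Matrix.of fun p k => u k p with hU
    set YS : Matrix (Fin N) S ℂ := Matrix.of fun k p => Y S k p with hYS
    -- With Y (1 + L) = w one has 1 - B = (1 - U Y)(1 + L). The second factor has determinant 1, and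
    -- det(1 - U Y) = det(1 - Y U) brings the size down to N.
    have e1 : (1 - Matrix.of fun p q : S => B p q) = (1 - U * YS) * (1 + LS) := by
      have e3 : YS * (1 + LS) = Matrix.of fun k (q : S) => w k q := by
        rw [Matrix.mul_add, Matrix.mul_one]
        ext k q
        rw [Matrix.add_apply, Matrix.mul_apply]
        simp only [hYS, hLS, Matrix.of_apply]
        rw [hY S k q q.2, ← Finset.sum_coe_sort S]
        ring
      rw [sub_mul, one_mul, Matrix.mul_assoc, e3]
      ext p q
      simp only [Matrix.sub_apply, Matrix.add_apply, Matrix.mul_apply, hU, hLS, Matrix.of_apply, hB]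
      ring
    have e2 : (Matrix.of fun k l : Fin N => ∑' p, Y S k p * u l p) = YS * U := by
      ext k l
      rw [Matrix.mul_apply, Matrix.of_apply, tsum_eq_sum (s := S), ← Finset.sum_coe_sort S]
      · rfl
      · intro p hp
        rw [hY0 S k p hp, zero_mul]
    rw [e1, e2, Matrix.det_mul, det_one_add_of_strict LS (fun p => b p) fun p q h => hLz p q h,
      mul_one, Matrix.det_one_sub_mul_comm]
  have hα0 : ∀ f : X → ℂ, ∀ C : ℝ, 0 ≤ C → (∀ p, ‖f p‖ ≤ C * α p) → ∀ q,
      ‖∑' p, f p * L p q‖ ≤ C * (∑' p, α p ^ 2) * α q := by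
    intro f C hC hf q
    have := tsum_of_norm_bounded (f := fun p => f p * L p q)
      ((hα.hasSum.mul_left C).mul_right (α q)) fun p => ?_
    · exact this
    · rw [norm_mul]
      calc ‖f p‖ * ‖L p q‖ ≤ (C * α p) * (α p * α q) :=
            mul_le_mul (hf p) (hL p q) (norm_nonneg _) (mul_nonneg hC (h0 p))
        _ = _ := by ring
  -- Induction on the block index: by strict triangularity of `L` the value of `Y S` at a point
  -- involves only points of lower blocks, where the bound uniform in `S` and the convergence to `W`
  -- are already known.
  have hkey : ∀ j : ℕ, ∃ C : ℝ, 0 ≤ C ∧ ∀ k q, b q < j → (∀ S, ‖Y S k q‖ ≤ C * α q) ∧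
      Tendsto (fun S => Y S k q) atTop (𝓝 (W k q)) := by
    intro j
    induction j with
    | zero => exact ⟨0, le_rfl, fun k q h => by omega⟩
    | succ j ih =>
      obtain ⟨C, hC, ih⟩ := ih
      set s := ∑' p, α p ^ 2 with hs
      have hs0 : 0 ≤ s := tsum_nonneg fun p => sq_nonneg _
      refine ⟨1 + C * s, by positivity, fun k q hq => ?_⟩
      set Z : Finset X → X → ℂ := fun S p => if b p < j then Y S k p else 0 with hZ
      have hZb : ∀ S p, ‖Z S p‖ ≤ C * α p := by
        intro S p
        simp only [hZ]
        split_ifs with h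
        · exact (ih k p h).1 S
        · rw [norm_zero]; exact mul_nonneg hC (h0 p)
      have hZL : ∀ S p, Y S k p * L p q = Z S p * L p q := by
        intro S p
        simp only [hZ]
        split_ifs with h
        · rfl
        · rw [hLz p q (by omega), mul_zero, mul_zero]
      have hYeq : ∀ S, q ∈ S → Y S k q = w k q - ∑' p, Z S p * L p q := by
        intro S hqS
        rw [hY S k q hqS, tsum_eq_sum (s := S)]
        · simp only [hZL]
        · intro p hp
          rw [← hZL, hY0 S k p hp, zero_mul]
      refine ⟨fun S => ?_, ?_⟩
      · by_cases hqS : q ∈ S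
        · rw [hYeq S hqS]
          refine (norm_sub_le _ _).trans ?_
          have := add_le_add (hw k q) (hα0 (Z S) C hC (hZb S) q)
          linarith
        · rw [hY0 S k q hqS, norm_zero]
          exact mul_nonneg (by positivity) (h0 q)
      · have h1 : Tendsto (fun S => w k q - ∑' p, Z S p * L p q) atTop (𝓝 (W k q)) := by
          rw [hW]
          refine tendsto_const_nhds.sub (tendsto_tsum_of_dominated_convergence
            (bound := fun p => C * α p ^ 2 * α q) ((hα.mul_left C).mul_right _) ?_ ?_)
          · intro p
            by_cases h : b p < j
            · simp only [hZ, h, if_true]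
              exact ((ih k p h).2).mul_const _
            · simp only [hLz p q (show ¬ b p < b q by omega), mul_zero]
              exact tendsto_const_nhds
          · refine Eventually.of_forall fun S p => ?_
            rw [norm_mul]
            calc ‖Z S p‖ * ‖L p q‖ ≤ (C * α p) * (α p * α q) :=
                  mul_le_mul (hZb S p) (hL p q) (norm_nonneg _) (mul_nonneg hC (h0 p))
              _ = _ := by ring
        refine h1.congr' ?_
        filter_upwards [eventually_ge_atTop {q}] with S hS
        exact (hYeq S (hS (Finset.mem_singleton_self q))).symm
  obtain ⟨C, hC, hkey⟩ := hkey m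
  have hlim2 : Tendsto (fun S : Finset X => (1 - Matrix.of fun p q : S => B p q).det) atTop
      (𝓝 (Matrix.det (1 - Matrix.of fun k l => ∑' p, W k p * u l p))) := by
    simp only [hdet]
    refine ((Continuous.matrix_det continuous_id).tendsto _).comp ?_
    refine tendsto_const_nhds.sub ?_
    refine tendsto_pi_nhds.2 fun k => tendsto_pi_nhds.2 fun l => ?_
    simp only [Matrix.of_apply]
    refine tendsto_tsum_of_dominated_convergence (bound := fun p => C * α p ^ 2)
      (hα.mul_left C) (fun p => ((hkey k p (hb p)).2).mul_const _) ?_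
    refine Eventually.of_forall fun S p => ?_
    rw [norm_mul]
    calc ‖Y S k p‖ * ‖u l p‖ ≤ (C * α p) * α p :=
          mul_le_mul ((hkey k p (hb p)).1 S) (hu l p) (norm_nonneg _) (mul_nonneg hC (h0 p))
      _ = _ := by ring
  have := hsum.hasSum
  rw [tendsto_nhds_unique hlim hlim2] at this
  exact this

lemma HasFredholmDet.conj {X : Type*} {A : X → X → ℂ} {d : ℂ} (g : X → ℂ) (hg : ∀ p, g p ≠ 0)
    (h : HasFredholmDet (fun p q => g p * A p q * (g q)⁻¹) d) : HasFredholmDet A d := by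
  refine HasSum.congr_fun h fun q => ?_
  congr 1
  have : (Matrix.of fun i j : Fin q.1 => g (q.2 i) * A (q.2 i) (q.2 j) * (g (q.2 j))⁻¹) =
      Matrix.of fun i j => (g (q.2 i)) * (Matrix.of fun i j => (g (q.2 j))⁻¹ *
        (Matrix.of fun i j : Fin q.1 => A (q.2 i) (q.2 j)) i j) i j := by
    ext i j
    simp only [Matrix.of_apply]
    ring
  rw [this, Matrix.det_mul_column, Matrix.det_mul_row, ← mul_assoc, ← Finset.prod_mul_distrib,
    Finset.prod_eq_one fun i _ => mul_inv_cancel₀ (hg _), one_mul]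

/-! ### Truncations, space-like paths and the correction recursion -/

open Classical in
/-- Restriction of a function on `ℤ` to `x < s`. -/
noncomputable def cutLt (s : ℝ) (f : ℤ → ℂ) (x : ℤ) : ℂ := if (x : ℝ) < s then f x else 0

open Classical in
/-- Restriction of a function on `ℤ` to `s ≤ x`. -/
noncomputable def cutGe (s : ℝ) (f : ℤ → ℂ) (x : ℤ) : ℂ := if (x : ℝ) < s then 0 else f x

lemma cutLt_add_cutGe (s : ℝ) (f : ℤ → ℂ) : cutLt s f + cutGe s f = f := by
  funext x
  simp only [cutLt, cutGe, Pi.add_apply]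
  split_ifs <;> simp

lemma cutLt_add (s : ℝ) (f g : ℤ → ℂ) : cutLt s (f + g) = cutLt s f + cutLt s g := by
  funext x
  simp only [cutLt, Pi.add_apply]
  split_ifs <;> simp

lemma cutGe_add (s : ℝ) (f g : ℤ → ℂ) : cutGe s (f + g) = cutGe s f + cutGe s g := by
  funext x
  simp only [cutGe, Pi.add_apply]
  split_ifs <;> simp

lemma cutLt_zero (s : ℝ) : cutLt s 0 = 0 := by
  funext x; simp [cutLt]

/-- For x < s the ratio (R/r)^x is bounded, so cutting from above permits a larger radius; dually
`Wt.cutGe` permits a smaller one. Either cut thus brings a `Split` function onto a single circle. -/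
lemma Wt.cutLt {r R : ℝ} (hr : 0 < r) (hR : r ≤ R) {f : ℤ → ℂ} (h : Wt r f) (s : ℝ) :
    Wt R (cutLt s f) := by
  have hR0 : 0 < R := hr.trans_le hR
  refine Summable.of_nonneg_of_le (fun k => by positivity) (fun k => ?_)
    (h.mul_left ((R / r) ^ ⌈s⌉))
  simp only [PushASEP.cutLt]
  split_ifs with hk
  · have h1 : k ≤ ⌈s⌉ := by
      have : (k : ℝ) ≤ ⌈s⌉ := hk.le.trans (Int.le_ceil s)
      exact_mod_cast this
    have h2 : (R / r) ^ k ≤ (R / r) ^ ⌈s⌉ := zpow_le_zpow_right₀ ((one_le_div hr).2 hR) h1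
    have h3 : R ^ k = (R / r) ^ k * r ^ k := by
      rw [← mul_zpow, div_mul_cancel₀ _ hr.ne']
    rw [h3]
    calc ‖f k‖ * ((R / r) ^ k * r ^ k) ≤ ‖f k‖ * ((R / r) ^ ⌈s⌉ * r ^ k) := by gcongr
      _ = _ := by ring
  · simp; positivity

lemma Wt.cutGe {r R : ℝ} (hr : 0 < r) (hR : r ≤ R) {f : ℤ → ℂ} (h : Wt R f) (s : ℝ) :
    Wt r (cutGe s f) := by
  have hR0 : 0 < R := hr.trans_le hR
  refine Summable.of_nonneg_of_le (fun k => by positivity) (fun k => ?_)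
    (h.mul_left ((r / R) ^ (⌈s⌉ - 1)))
  simp only [PushASEP.cutGe]
  split_ifs with hk
  · simp; positivity
  · have h1 : ⌈s⌉ - 1 ≤ k := by
      have := Int.ceil_le.2 (not_lt.1 hk)
      omega
    have h2 : (r / R) ^ k ≤ (r / R) ^ (⌈s⌉ - 1) :=
      zpow_le_zpow_right_of_le_one₀ (by positivity) ((div_le_one hR0).2 hR) h1
    have h3 : r ^ k = (r / R) ^ k * R ^ k := by
      rw [← mul_zpow, div_mul_cancel₀ _ hR0.ne']
    rw [h3]
    calc ‖f k‖ * ((r / R) ^ k * R ^ k) ≤ ‖f k‖ * ((r / R) ^ (⌈s⌉ - 1) * R ^ k) := by gcongr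
      _ = _ := by ring

lemma Split.cutLt {R r : ℝ} (hr : 0 < r) (hR : r ≤ R) {f : ℤ → ℂ} (h : Split R r f) (s : ℝ) :
    Wt R (cutLt s f) := by
  obtain ⟨f₁, f₂, h₁, h₂, rfl⟩ := h
  rw [cutLt_add]
  exact (h₁.cutLt (hr.trans_le hR) le_rfl s).add (hr.trans_le hR) (h₂.cutLt hr hR s)

lemma Split.cutGe {R r : ℝ} (hr : 0 < r) (hR : r ≤ R) {f : ℤ → ℂ} (h : Split R r f) (s : ℝ) :
    Wt r (cutGe s f) := by
  obtain ⟨f₁, f₂, h₁, h₂, rfl⟩ := h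
  rw [cutGe_add]
  exact (h₁.cutGe hr hR s).add hr (h₂.cutGe hr le_rfl s)

/-- The data entering the kernel along a space-like path: level `n i` and values `a i`, `b i` of
the functions `a`, `b` at the time number `i`, with dual functions `Φ i k`, extended by zero. -/
structure Chain (v : ℕ → ℝ) (y : ℕ → ℤ) (N : ℕ) (n : ℕ → ℕ) (a b : ℕ → ℂ)
    (Φ : ℕ → ℕ → ℤ → ℂ) : Prop where
  pos : ∀ j, 1 ≤ j → 0 < v j
  mono : Monotone n
  le : ∀ i, n i ≤ N
  mem : ∀ i k, k < n i → Φ i k ∈ V v (n i)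
  zero : ∀ i k, n i ≤ k → Φ i k = 0
  dual : ∀ i k l, k < n i → l < n i →
    DD v (Finset.Ioc (l + 1) (n i)) (conv (Φ i k) (expc (a i) (b i))) (y (l + 1)) =
      if k = l then 1 else 0

/-- The regularised kernel between two times. -/
noncomputable def creg (v : ℕ → ℝ) (n : ℕ → ℕ) (a b : ℕ → ℂ) (i j : ℕ) : ℤ → ℂ :=
  outer v (a i - a j) (b i - b j) (Finset.Ioc (n i) (n j))

/-- The kernel `φ` between two times. -/
noncomputable def cin (v : ℕ → ℝ) (n : ℕ → ℕ) (a b : ℕ → ℂ) (i j : ℕ) : ℤ → ℂ :=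
  inner v (a i - a j) (b i - b j) (Finset.Ioc (n i) (n j))

/-- The coefficients of the `Ψ` functions with nonnegative lower index. -/
noncomputable def psi (v : ℕ → ℝ) (n : ℕ → ℕ) (a b : ℕ → ℂ) (i l : ℕ) : ℤ → ℂ :=
  DD v (Finset.Ioc (l + 1) (n i)) (expc (a i) (b i))

/-- The correction to the dual functions in the triangular recursion. -/
noncomputable def corr (v : ℕ → ℝ) (n : ℕ → ℕ) (a b : ℕ → ℂ) (s : ℕ → ℝ) (Φ : ℕ → ℕ → ℤ → ℂ) :
    ℕ → ℕ → ℤ → ℂ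
  | 0, _ => 0
  | i + 1, k => conv (corr v n a b s Φ i k + cutLt (s i) (Φ i k - corr v n a b s Φ i k))
      (creg v n a b i (i + 1))

section
variable {v : ℕ → ℝ} {y : ℕ → ℤ} {N : ℕ} {n : ℕ → ℕ} {a b : ℕ → ℂ} {Φ : ℕ → ℕ → ℤ → ℂ}
  (h : Chain v y N n a b Φ) {R ρ : ℝ} {s : ℕ → ℝ}
include h

lemma Chain.pos_of_mem {i j l : ℕ} (hl : l ∈ Finset.Ioc i j) : 0 < v l :=
  h.pos l (by have := Finset.mem_Ioc.1 hl; omega)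

lemma Chain.hasLaurent_creg (hR : 0 < R) (hR' : ∀ j, 1 ≤ j → j ≤ N → 1 < R * v j) (i j : ℕ) :
    HasLaurent R (symbol v (a i - a j) (b i - b j) (Finset.Ioc (n i) (n j)))
      (creg v n a b i j) :=
  hasLaurent_outer (fun l hl => h.pos_of_mem hl) _ _ hR fun l hl => hR' l
    (by have := Finset.mem_Ioc.1 hl; omega) (by have := Finset.mem_Ioc.1 hl; have := h.le j; omega)

lemma Chain.wt_creg (hR : 0 < R) (hR' : ∀ j, 1 ≤ j → j ≤ N → 1 < R * v j) (i j : ℕ) :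
    Wt R (creg v n a b i j) := (h.hasLaurent_creg hR hR' i j).summable

lemma Chain.hasLaurent_cin (hρ : IsSmallRadius v N ρ) (i j : ℕ) :
    HasLaurent ρ (symbol v (a i - a j) (b i - b j) (Finset.Ioc (n i) (n j))) (cin v n a b i j) :=
  hasLaurent_inner (fun l hl => h.pos_of_mem hl) _ _ hρ.1 fun l hl => hρ.mul_lt h.pos
    (by have := Finset.mem_Ioc.1 hl; omega) (by have := Finset.mem_Ioc.1 hl; have := h.le j; omega)

lemma Chain.wt_cin (hρ : IsSmallRadius v N ρ) (i j : ℕ) : Wt ρ (cin v n a b i j) :=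
  (h.hasLaurent_cin hρ i j).summable

lemma Chain.DD_creg (i j : ℕ) : DD v (Finset.Ioc (n i) (n j)) (creg v n a b i j) =
    expc (a i - a j) (b i - b j) := by
  obtain ⟨R, hR, hR'⟩ := exists_large_radius h.pos N
  exact DD_outer (fun l hl => h.pos_of_mem hl) _ _ hR fun l hl => hR' l
    (by have := Finset.mem_Ioc.1 hl; omega) (by have := Finset.mem_Ioc.1 hl; have := h.le j; omega)

lemma Chain.DD_cin (hρ : IsSmallRadius v N ρ) (i j : ℕ) :
    DD v (Finset.Ioc (n i) (n j)) (cin v n a b i j) = expc (a i - a j) (b i - b j) :=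
  DD_inner (fun l hl => h.pos_of_mem hl) _ _ hρ.1 fun l hl => hρ.mul_lt h.pos
    (by have := Finset.mem_Ioc.1 hl; omega) (by have := Finset.mem_Ioc.1 hl; have := h.le j; omega)

omit h in
lemma wt_psi {r : ℝ} (hr : 0 < r) (i l : ℕ) : Wt r (psi v n a b i l) := (wt_expc _ _ hr).DD hr v _

lemma Chain.creg_self (i : ℕ) : creg v n a b i i = Pi.single 0 1 := by
  have := h.DD_creg i i
  simp only [sub_self, Finset.Ioc_self, DD_empty, Module.End.one_apply, expc_zero] at this
  exact this

/-- On a common large circle the symbols multiply: the exponents telescope and the denominators over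
adjacent ranges of labels join. -/
lemma Chain.conv_creg_creg {i j k : ℕ} (hij : i ≤ j) (hjk : j ≤ k) :
    conv (creg v n a b i j) (creg v n a b j k) = creg v n a b i k := by
  obtain ⟨R, hR, hR'⟩ := exists_large_radius h.pos N
  refine ((h.hasLaurent_creg hR hR' i j).mul hR (h.hasLaurent_creg hR hR' j k)).coeff_unique hR
    (h.hasLaurent_creg hR hR' i k) fun z _ => ?_
  rw [symbol_mul, ← Ioc_eq_union (h.mono hij) (h.mono hjk)]
  · congr 1 <;> ring
  · rw [Finset.disjoint_left]; intro x; simp; omega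

/-- The condition l < n i ensures that `psi` at level j contains all factors over (n i, n j], which
remove the denominators of `creg`. -/
lemma Chain.conv_creg_psi {i j l : ℕ} (hij : i ≤ j) (hl : l < n i) :
    conv (creg v n a b i j) (psi v n a b j l) = psi v n a b i l := by
  obtain ⟨R, hR, hR'⟩ := exists_large_radius h.pos N
  have h1 := h.wt_creg hR hR' i j
  have h2 := wt_expc (a j) (b j) hR
  rw [psi, psi, h1.conv_DD hR h2, DD_Ioc v (Nat.succ_le_of_lt hl) (h.mono hij), h1.DD_conv hR h2,
    h.DD_creg, conv_expc_expc, sub_add_cancel, sub_add_cancel]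

lemma Chain.split (hR : 0 < R) (hR' : ∀ j, 1 ≤ j → j ≤ N → 1 < R * v j)
    (hρ : IsSmallRadius v N ρ) (i k : ℕ) : Split R ρ (Φ i k) := by
  rcases lt_or_ge k (n i) with hk | hk
  · exact split_of_mem_V hR hρ.1 h.pos
      (fun j h1 h2 => hρ.mul_lt h.pos h1 (h2.trans (h.le i)))
      (fun j h1 h2 => hR' j h1 (h2.trans (h.le i))) (h.mem i k hk)
  · rw [h.zero i k hk]; exact split_zero

omit h in
lemma small_le_large (hpos : ∀ j, 1 ≤ j → 0 < v j) (hN : 1 ≤ N)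
    (hR' : ∀ j, 1 ≤ j → j ≤ N → 1 < R * v j) (hρ : IsSmallRadius v N ρ) : ρ ≤ R := by
  have h1 := hR' 1 le_rfl hN
  have h2 := hρ.mul_lt hpos le_rfl hN
  have := hpos 1 le_rfl
  nlinarith

lemma Chain.wt_cutLt (hN : 1 ≤ N) (hR : 0 < R) (hR' : ∀ j, 1 ≤ j → j ≤ N → 1 < R * v j)
    (s : ℝ) (i k : ℕ) : Wt R (cutLt s (Φ i k)) := by
  obtain ⟨ρ, hρ, hρ'⟩ := exists_small_radius h.pos N
  have hρ2 : IsSmallRadius v N ρ := ⟨hρ, fun j h1 h2 => by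
    rw [lt_div_iff₀ (h.pos j h1)]; exact hρ' j h1 h2⟩
  exact (h.split hR hR' hρ2 i k).cutLt hρ (small_le_large h.pos hN hR' hρ2) s

omit h in
lemma wt_neg {r : ℝ} {f : ℤ → ℂ} (hf : Wt r f) : Wt r (-f) := by
  simpa using hf.smul (-1)

lemma Chain.wt_corr (hN : 1 ≤ N) (hR : 0 < R) (hR' : ∀ j, 1 ≤ j → j ≤ N → 1 < R * v j) (i k : ℕ) :
    Wt R (corr v n a b s Φ i k) := by
  induction i with
  | zero => exact wt_zero R
  | succ i ih =>
    refine (ih.add hR ?_).convolve hR (h.wt_creg hR hR' _ _)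
    rw [sub_eq_add_neg, cutLt_add]
    exact (h.wt_cutLt hN hR hR' _ _ _).add hR ((wt_neg ih).cutLt hR le_rfl _)

lemma Chain.wt_cutLt_sub (hN : 1 ≤ N) (hR : 0 < R) (hR' : ∀ j, 1 ≤ j → j ≤ N → 1 < R * v j)
    (i k : ℕ) : Wt R (cutLt (s i) (Φ i k - corr v n a b s Φ i k)) := by
  rw [sub_eq_add_neg, cutLt_add]
  exact (h.wt_cutLt hN hR hR' _ _ _).add hR
    ((wt_neg (h.wt_corr hN hR hR' i k)).cutLt hR le_rfl _)

lemma Chain.wt_cutGe_sub (hN : 1 ≤ N) (hρ : IsSmallRadius v N ρ) (i k : ℕ) :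
    Wt ρ (cutGe (s i) (Φ i k - corr v n a b s Φ i k)) := by
  obtain ⟨R, hR, hR'⟩ := exists_large_radius h.pos N
  have hle := small_le_large h.pos hN hR' hρ
  rw [sub_eq_add_neg, cutGe_add]
  exact ((h.split hR hR' hρ i k).cutGe hρ.1 hle _).add hρ.1
    ((wt_neg (h.wt_corr hN hR hR' i k)).cutGe hρ.1 hle _)

/-- The functions `Φ - corr` of consecutive times agree up to new dual functions. -/
lemma Chain.DD_step (hN : 1 ≤ N) (hρ : IsSmallRadius v N ρ) {i k : ℕ} (hk : k < n i) :
    DD v (Finset.Ioc (n i) (n (i + 1))) (Φ (i + 1) k - corr v n a b s Φ (i + 1) k -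
      conv (cutGe (s i) (Φ i k - corr v n a b s Φ i k)) (cin v n a b i (i + 1))) = 0 := by
  obtain ⟨R, hR, hR'⟩ := exists_large_radius h.pos N
  have hmono : n i ≤ n (i + 1) := h.mono (Nat.le_succ i)
  set S := corr v n a b s Φ i k with hS
  have hSw : Wt R S := h.wt_corr hN hR hR' i k
  have hX := h.wt_cutLt_sub (s := s) hN hR hR' i k
  have hF := h.wt_cutGe_sub (s := s) hN hρ i k
  rw [← hS] at hX hF
  have hsum : S + cutLt (s i) (Φ i k - S) + cutGe (s i) (Φ i k - S) = Φ i k := by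
    rw [add_assoc, cutLt_add_cutGe, add_sub_cancel]
  have hΦ := h.mem i k hk
  have hΦ' := h.mem (i + 1) k (hk.trans_le hmono)
  set A := a i - a (i + 1)
  set B := b i - b (i + 1)
  -- The operator makes `creg` and `cin` equal, so the parts of Φ on both sides of the cut recombine
  -- with the correction to the full Φ at index i.
  have h1 : DD v (Finset.Ioc (n i) (n (i + 1))) (corr v n a b s Φ (i + 1) k) +
      DD v (Finset.Ioc (n i) (n (i + 1)))
        (conv (cutGe (s i) (Φ i k - S)) (cin v n a b i (i + 1))) = conv (Φ i k) (expc A B) := by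
    rw [corr, ← (hSw.add hR hX).conv_DD hR (h.wt_creg hR hR' _ _), h.DD_creg,
      ← hF.conv_DD hρ.1 (h.wt_cin hρ _ _), h.DD_cin hρ,
      ← (hSw.add hR hX).conv_add_mixed hR hρ.1 hF (wt_expc _ _ hR) (wt_expc _ _ hρ.1), hsum]
  rw [map_sub, map_sub, sub_sub, h1]
  -- What remains is that the operator maps Φ at index i + 1 to Φ at index i convolved with the
  -- exponential: both lie in V at level n i and have the same pairings with the points y_l, l ≤ n
  -- i.
  have hm1 : DD v (Finset.Ioc (n i) (n (i + 1))) (Φ (i + 1) k) ∈ V v (n i) := by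
    rw [mem_V_iff h.pos, ← Ioc_zero_eq, ← DD_Ioc v (Nat.zero_le _) hmono, Ioc_zero_eq]
    exact (mem_V_iff h.pos).1 hΦ'
  have hm2 := conv_expc_mem_V h.pos hΦ A B
  refine eq_zero_of_pairing h.pos (y := y) (A := a (i + 1)) (B := b (i + 1))
    (Submodule.sub_mem _ hm1 hm2) fun l hl1 hl2 => ?_
  obtain ⟨l, rfl⟩ : ∃ l' : ℕ, l = l' + 1 := ⟨l - 1, by omega⟩
  have hsp : ∀ {f}, f ∈ V v (n i) → Split R ρ f := fun hf => split_of_mem_V hR hρ.1 h.pos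
      (fun j h1 h2 => hρ.mul_lt h.pos h1 (h2.trans (h.le i)))
      (fun j h1 h2 => hR' j h1 (h2.trans (h.le i))) hf
  have hsub : ∀ f g : ℤ → ℂ, f - g = f + (-1 : ℂ) • g := fun f g => by simp [sub_eq_add_neg]
  rw [hsub, (hsp hm1).conv_add hR hρ.1 ((hsp hm2).smul _) (wt_expc _ _ hR) (wt_expc _ _ hρ.1),
    conv_smul_left, map_add, map_smul, conv_expc_conv_expc h.pos hΦ, sub_add_cancel,
    sub_add_cancel, ← DD_conv_expc h.pos hΦ', ← DD_Ioc v hl2 hmono, Pi.add_apply, Pi.smul_apply,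
    h.dual (i + 1) k l (by omega) (by omega), h.dual i k l hk (by omega)]
  split_ifs <;> simp

/-- The semigroup property of `creg` unfolds the recursion. Hence X_j = cutLt(Φ_j - corr_j) solves
the triangular system X_j = cutLt(Φ_j - ∑_{i<j} X_i * creg_{ij}) required by
`hasFredholmDet_of_finite_rank`. -/
lemma Chain.corr_eq_sum (hN : 1 ≤ N) (j k : ℕ) : corr v n a b s Φ j k =
    ∑ i ∈ Finset.range j, conv (cutLt (s i) (Φ i k - corr v n a b s Φ i k)) (creg v n a b i j) := by
  obtain ⟨R, hR, hR'⟩ := exists_large_radius h.pos N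
  induction j with
  | zero => rfl
  | succ j ih =>
    have hX := fun i => h.wt_cutLt_sub (s := s) hN hR hR' i k
    have hc := h.wt_creg hR hR' j (j + 1)
    rw [corr, (h.wt_corr hN hR hR' j k).conv_add hR (hX j) hc, Finset.sum_range_succ]
    congr 1
    conv_lhs => rw [ih]
    have hconv : ∀ (T : Finset ℕ) (f : ℕ → ℤ → ℂ), (∀ i ∈ T, Wt R (f i)) →
        conv (∑ i ∈ T, f i) (creg v n a b j (j + 1)) =
          ∑ i ∈ T, conv (f i) (creg v n a b j (j + 1)) := by
      intro T f hf
      have := conv_sum_smul hR hR T (fun i hi => (hf i hi).split_left (r := R)) (fun _ => 1) hc hc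
      simpa using this
    rw [hconv _ _ fun i _ => (hX i).convolve hR (h.wt_creg hR hR' i j)]
    refine Finset.sum_congr rfl fun i hi => ?_
    rw [(hX i).conv_assoc hR (h.wt_creg hR hR' i j) hc,
      h.conv_creg_creg (Finset.mem_range.1 hi).le (Nat.le_succ j)]

/-- The finite matrix obtained from the Fredholm determinant. -/
lemma Chain.matrix_eq (hN : 1 ≤ N) (hρ : IsSmallRadius v N ρ) {M : ℕ} (hM : n M = N) {k l : ℕ}
    (hk : k < N) (hl : l < N) :
    (if k = l then 1 else 0) - ∑ i ∈ Finset.range (M + 1),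
      conv (cutLt (s i) (Φ i k - corr v n a b s Φ i k))
        (conv (creg v n a b i M) (psi v n a b M l)) (y (l + 1)) =
    conv (cutGe (s M) (Φ M k - corr v n a b s Φ M k)) (psi v n a b M l) (y (l + 1)) := by
  obtain ⟨R, hR, hR'⟩ := exists_large_radius h.pos N
  have hX := fun i => h.wt_cutLt_sub (s := s) hN hR hR' i k
  have hF := h.wt_cutGe_sub (s := s) hN hρ M k
  have hS := h.wt_corr (s := s) hN hR hR' M k
  have hψ : ∀ {r : ℝ}, 0 < r → Wt r (psi v n a b M l) := fun hr => wt_psi hr M l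
  have h1 : ∑ i ∈ Finset.range (M + 1), conv (cutLt (s i) (Φ i k - corr v n a b s Φ i k))
        (conv (creg v n a b i M) (psi v n a b M l)) =
      conv (corr v n a b s Φ M k + cutLt (s M) (Φ M k - corr v n a b s Φ M k))
        (psi v n a b M l) := by
    rw [Finset.sum_range_succ, hS.conv_add hR (hX M) (hψ hR)]
    congr 1
    · have := conv_sum_smul hR hR (Finset.range M)
        (fun i _ => ((hX i).convolve hR (h.wt_creg hR hR' i M)).split_left (r := R))
        (fun _ => 1) (hψ hR) (hψ hR)
      simp only [one_smul] at this
      rw [h.corr_eq_sum hN M k, this]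
      refine Finset.sum_congr rfl fun i _ => ?_
      rw [(hX i).conv_assoc hR (h.wt_creg hR hR' i M) (hψ hR)]
    · rw [h.creg_self, conv_comm (Pi.single 0 1), conv_single]
  -- Biorthogonality at the last index writes the identity matrix as the pairing with the whole of
  -- Φ; subtracting the correction and the part below the cut leaves the part above it.
  have h2 : (if k = l then (1 : ℂ) else 0) = conv (Φ M k) (psi v n a b M l) (y (l + 1)) := by
    rw [← h.dual M k l (by omega) (by omega), psi, (h.split hR hR' hρ M k).conv_DD hR hρ.1
      (wt_expc _ _ hR) (wt_expc _ _ hρ.1)]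
  have h3 : Φ M k = corr v n a b s Φ M k + cutLt (s M) (Φ M k - corr v n a b s Φ M k) +
      cutGe (s M) (Φ M k - corr v n a b s Φ M k) := by
    rw [add_assoc, cutLt_add_cutGe, add_sub_cancel]
  rw [← Finset.sum_apply, h1, h2]
  conv_lhs => rw [h3]
  rw [(hS.add hR (hX M)).conv_add_mixed hR hρ.1 hF (hψ hR) (hψ hρ.1)]
  rw [← h3, Pi.add_apply, add_sub_cancel_left]

end

/-! ### Passage from the kernel with φ to the regularised kernel -/

/-- Translation of a function on `ℤ`. -/
def translate (x : ℤ) : Module.End ℂ (ℤ → ℂ) where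
  toFun f y := f (y - x)
  map_add' _ _ := rfl
  map_smul' _ _ := rfl

lemma translate_apply (x : ℤ) (f : ℤ → ℂ) (y : ℤ) : translate x f y = f (y - x) := rfl

lemma DD_translate (v : ℕ → ℝ) (S : Finset ℕ) (x : ℤ) (f : ℤ → ℂ) :
    DD v S (translate x f) = translate x (DD v S f) := by
  have hc : Commute shift (translate x) := by
    refine LinearMap.ext fun f => funext fun y => ?_
    simp only [Module.End.mul_apply, shift_apply, translate_apply]
    congr 1; ring
  have : Commute (DD v S) (translate x) := by
    rw [DD]
    induction fac v S using Polynomial.induction_on' with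
    | add p q hp hq => rw [map_add]; exact hp.add_left hq
    | monomial n c =>
      rw [Polynomial.aeval_monomial]
      exact (Algebra.commute_algebraMap_left c _).mul_left (hc.pow_left n)
  exact congrArg (fun g : Module.End ℂ (ℤ → ℂ) => g f) this.eq

lemma conv_translate (x : ℤ) (f c : ℤ → ℂ) : conv (translate x f) c = translate x (conv f c) := by
  funext y
  rw [translate_apply, conv, conv, ← (Equiv.addRight x).tsum_eq]
  simp only [Equiv.coe_addRight, translate_apply, add_sub_cancel_right]
  refine tsum_congr fun k => ?_
  rw [show y - (k + x) = y - x - k by ring]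

lemma hasSum_fin_prod {n : ℕ} {f : Fin n × ℤ → ℂ} {a : Fin n → ℂ}
    (h : ∀ i, HasSum (fun x => f (i, x)) (a i)) : HasSum f (∑ i, a i) := by
  have h1 : ∀ i, HasSum (fun p : Fin n × ℤ => if p.1 = i then f p else 0) (a i) := fun i => by
    have hinj : Function.Injective fun x : ℤ => (i, x) := fun x y hxy => by simpa using hxy
    refine (hinj.hasSum_iff ?_).1 ?_
    · rintro ⟨j, x⟩ hp
      rw [if_neg]
      rintro rfl
      exact hp ⟨x, rfl⟩
    · simpa [Function.comp_def] using h i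
  have h2 := hasSum_sum fun i (_ : i ∈ Finset.univ) => h1 i
  simpa using h2

lemma summable_cut_pow {r : ℝ} (hr : 1 < r) (c : ℤ) :
    Summable fun x : ℤ => if x < c then r ^ x else 0 := by
  have hr0 : 0 < r := one_pos.trans hr
  have h1 : Summable fun x : ℤ => if x < 0 then r ^ x else 0 := by
    refine Summable.of_nat_of_neg_add_one ?_ ?_
    · convert summable_zero with n
      simp
    · have : Summable fun n : ℕ => r⁻¹ ^ n * r⁻¹ :=
        (summable_geometric_of_lt_one (inv_nonneg.2 hr0.le) (inv_lt_one_of_one_lt₀ hr)).mul_right _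
      refine this.congr fun n => ?_
      rw [if_pos (by omega), zpow_neg, ← pow_succ, inv_pow]
      norm_cast
  have h2 := ((Equiv.subRight c).summable_iff.2 h1).mul_left (r ^ c)
  refine h2.congr fun x => ?_
  simp only [Function.comp, Equiv.subRight_apply, sub_neg]
  split_ifs
  · rw [← zpow_add₀ hr0.ne']; congr 1; ring
  · simp

lemma exists_uniform_bound {ι T : Type*} [Fintype ι] {f g : ι → T → ℝ} (hg : ∀ i t, 0 ≤ g i t)
    (h : ∀ i, ∃ C, ∀ t, f i t ≤ C * g i t) : ∃ C, 0 ≤ C ∧ ∀ i t, f i t ≤ C * g i t := by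
  choose C hC using h
  refine ⟨∑ i, |C i|, Finset.sum_nonneg fun i _ => abs_nonneg _, fun i t => ?_⟩
  refine (hC i t).trans (mul_le_mul_of_nonneg_right ?_ (hg i t))
  exact (le_abs_self _).trans
    (Finset.single_le_sum (f := fun i => |C i|) (fun i _ => abs_nonneg _) (Finset.mem_univ i))

lemma Wt.norm_le {r : ℝ} (hr : 0 < r) {c : ℤ → ℂ} (h : Wt r c) :
    ∃ C, 0 ≤ C ∧ ∀ k, ‖c k‖ ≤ C * r ^ (-k) := by
  refine ⟨∑' k, ‖c k‖ * r ^ k, tsum_nonneg fun k => by positivity, fun k => ?_⟩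
  have := h.le_tsum k fun j _ => by positivity
  rw [zpow_neg, ← div_eq_mul_inv, le_div_iff₀ (by positivity)]
  exact this

section
variable {v : ℕ → ℝ} {y : ℕ → ℤ} {N : ℕ} {n : ℕ → ℕ} {a b : ℕ → ℂ} {Φ : ℕ → ℕ → ℤ → ℂ}
  (h : Chain v y N n a b Φ) {R ρ : ℝ} {s : ℕ → ℝ}
include h

/-- On the small circle the denominators of `cin` cancel against factors of `psi`. What survives is
the integrand of Ψ at level n i, also when its lower index is negative, that is k + 1 > n i. -/
lemma Chain.hasLaurent_cin_psi (hρ : IsSmallRadius v N ρ) {i j k : ℕ} (hij : i ≤ j)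
    (hk : k < n j) : HasLaurent ρ (fun z => (∏ l ∈ Finset.Ioc (k + 1) (n i), (1 - (v l : ℂ) * z)) *
      symbol v (a i) (b i) (Finset.Ioc (n i) (k + 1)) z) (conv (cin v n a b i j) (psi v n a b j k)) := by
  refine ((h.hasLaurent_cin hρ i j).mul hρ.1
    ((hasLaurent_expc (a j) (b j) hρ.1).DD hρ.1 v (Finset.Ioc (k + 1) (n j)))).congr fun z hz => ?_
  have hne : ∀ l ∈ Finset.Ioc (n i) (n j), 1 - (v l : ℂ) * z ≠ 0 := fun l hl => by
    have hl' := Finset.mem_Ioc.1 hl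
    have := h.le j
    exact one_sub_ne_zero (h.pos_of_mem hl) (hρ.mul_lt h.pos (by omega) (by omega)).ne hz
  have hm := h.mono hij
  have hdis : ∀ p q r : ℕ, Disjoint (Finset.Ioc p q) (Finset.Ioc q r) := fun p q r => by
    rw [Finset.disjoint_left]; intro x; simp; omega
  have hexp : Complex.exp (a i / z + b i * z) =
      Complex.exp ((a i - a j) / z + (b i - b j) * z) * Complex.exp (a j / z + b j * z) := by
    rw [← Complex.exp_add]; congr 1; ring
  simp only [symbol, hexp]
  rcases le_total (k + 1) (n i) with hki | hki
  · rw [Finset.Ioc_eq_empty (a := n i) (b := k + 1) (by omega), Ioc_eq_union hki hm,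
      Finset.prod_union (hdis _ _ _), Finset.prod_empty]
    have : (∏ l ∈ Finset.Ioc (n i) (n j), (1 - (v l : ℂ) * z)⁻¹) *
      ∏ l ∈ Finset.Ioc (n i) (n j), (1 - (v l : ℂ) * z) = 1 := by
      rw [← Finset.prod_mul_distrib]
      exact Finset.prod_eq_one fun l hl => inv_mul_cancel₀ (hne l hl)
    linear_combination ((∏ l ∈ Finset.Ioc (k + 1) (n i), (1 - (v l : ℂ) * z)) *
      Complex.exp ((a i - a j) / z + (b i - b j) * z) * Complex.exp (a j / z + b j * z)) * this
  · rw [Finset.Ioc_eq_empty (a := k + 1) (b := n i) (by omega), Ioc_eq_union hki hk,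
      Finset.prod_union (hdis _ _ _), Finset.prod_empty]
    have : (∏ l ∈ Finset.Ioc (k + 1) (n j), (1 - (v l : ℂ) * z)⁻¹) *
      ∏ l ∈ Finset.Ioc (k + 1) (n j), (1 - (v l : ℂ) * z) = 1 := by
      rw [← Finset.prod_mul_distrib]
      refine Finset.prod_eq_one fun l hl => inv_mul_cancel₀ (hne l ?_)
      have := Finset.mem_Ioc.1 hl
      exact Finset.mem_Ioc.2 ⟨by omega, by omega⟩
    linear_combination ((∏ l ∈ Finset.Ioc (n i) (k + 1), (1 - (v l : ℂ) * z)⁻¹) *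
      Complex.exp ((a i - a j) / z + (b i - b j) * z) * Complex.exp (a j / z + b j * z)) * this

/-- The difference of the two expansions of the kernel between two times, in terms of the dual
functions. -/
lemma Chain.cin_sub_creg (hρ : IsSmallRadius v N ρ) {i j : ℕ} (hij : i ≤ j) (x x' : ℤ) :
    cin v n a b i j (x' - x) - creg v n a b i j (x' - x) =
      ∑ k ∈ Finset.range (n j), (conv (cin v n a b i j) (psi v n a b j k) (y (k + 1) - x) -
        conv (creg v n a b i j) (psi v n a b j k) (y (k + 1) - x)) * Φ j k x' := by
  obtain ⟨R, hR, hR'⟩ := exists_large_radius h.pos N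
  have hc1 := h.wt_creg hR hR' i j
  have hc2 := h.wt_cin hρ i j
  set g₀ : ℤ → ℂ := -creg v n a b i j + cin v n a b i j with hg₀
  -- The two expansions of one function have the same image, so `g₀` is annihilated; its translate
  -- lies in V at level n j and is expanded in the dual functions.
  have hDD : DD v (Finset.Ioc (n i) (n j)) g₀ = 0 := by
    rw [hg₀, map_add, map_neg, h.DD_creg, h.DD_cin hρ, neg_add_cancel]
  have hsp : Split R ρ g₀ := ⟨_, _, wt_neg hc1, hc2, rfl⟩
  have hw1 := wt_expc (a j) (b j) hR
  have hw2 := wt_expc (a j) (b j) hρ.1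
  have hmem : translate x g₀ ∈ V v (n j) := mem_V_of_DD_Ioc h.pos (h.mono hij) (by
    rw [DD_translate, hDD, map_zero])
  have key := eq_sum_of_dual h.pos (Φ := fun k : Fin (n j) => Φ j k)
    (fun k => h.mem j k k.2) (fun k l => by
      simpa only [Fin.ext_iff] using h.dual j k l k.2 l.2) hmem
  have key2 := congrFun key x'
  rw [translate_apply, hg₀, Pi.add_apply, Pi.neg_apply, neg_add_eq_sub] at key2
  rw [key2, Finset.sum_apply, Finset.sum_range]
  refine Finset.sum_congr rfl fun k _ => ?_
  rw [Pi.smul_apply, smul_eq_mul]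
  congr 1
  rw [conv_translate, DD_translate, translate_apply, ← hsp.conv_DD hR hρ.1 hw1 hw2]
  change conv g₀ (psi v n a b j k) _ = _
  have hneg : ∀ {f g : ℤ → ℂ}, conv (-f) g = -conv f g := fun {f g} => by
    have := conv_smul_left (-1) f g
    simpa using this
  rw [hg₀, (wt_neg hc1).conv_add_mixed hR hρ.1 hc2 (wt_psi hR _ _) (wt_psi hρ.1 _ _), hneg,
    Pi.add_apply, Pi.neg_apply, neg_add_eq_sub]

/-- The regularised kernel. -/
lemma Chain.kernel_eq (hρ : IsSmallRadius v N ρ) {i j M : ℕ} (hjM : j ≤ M) (hiM : i ≤ M)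
    {ψ : ℕ → ℂ} (x x' : ℤ)
    (hψ : ∀ k c, k < n j → HasLaurent ρ (fun z => (∏ l ∈ Finset.Ioc (k + 1) (n i),
      (1 - (v l : ℂ) * z)) * symbol v (a i) (b i) (Finset.Ioc (n i) (k + 1)) z) c →
      ψ k = c (y (k + 1) - x)) :
    -(if i < j then cin v n a b i j (x' - x) else 0) +
      ∑ k ∈ Finset.range (n j), ψ k * Φ j k x' =
    -(if i < j then creg v n a b i j (x' - x) else 0) + ∑ k : Fin N,
      conv (creg v n a b i M) (psi v n a b M k) (y (k + 1) - x) * Φ j k x' := by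
  have h1 : ∑ k : Fin N, conv (creg v n a b i M) (psi v n a b M k) (y (k + 1) - x) * Φ j k x' =
      ∑ k ∈ Finset.range (n j),
        conv (creg v n a b i M) (psi v n a b M k) (y (k + 1) - x) * Φ j k x' := by
    rw [← Finset.sum_range fun k =>
      conv (creg v n a b i M) (psi v n a b M k) (y (k + 1) - x) * Φ j k x']
    symm
    refine Finset.sum_subset (Finset.range_mono (h.le j)) fun k _ hk => ?_
    rw [h.zero j k (by simpa using hk), Pi.zero_apply, mul_zero]
  rw [h1]
  obtain ⟨R, hR, hR'⟩ := exists_large_radius h.pos N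
  -- For i < j the change in φ is compensated by the change in the sum over k, by `cin_sub_creg`.
  -- For i ≥ j there is no φ term, and k < n j ≤ n i makes the regularised and the original Ψ
  -- coincide.
  split_ifs with hij
  · have h2 := h.cin_sub_creg hρ hij.le x x'
    have h3 : ∑ k ∈ Finset.range (n j), ψ k * Φ j k x' =
        ∑ k ∈ Finset.range (n j),
          conv (cin v n a b i j) (psi v n a b j k) (y (k + 1) - x) * Φ j k x' :=
      Finset.sum_congr rfl fun k hk => by
        rw [hψ k _ (Finset.mem_range.1 hk) (h.hasLaurent_cin_psi hρ hij.le (Finset.mem_range.1 hk))]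
    have h4 : ∑ k ∈ Finset.range (n j),
          conv (creg v n a b i M) (psi v n a b M k) (y (k + 1) - x) * Φ j k x' =
        ∑ k ∈ Finset.range (n j),
          conv (creg v n a b i j) (psi v n a b j k) (y (k + 1) - x) * Φ j k x' :=
      Finset.sum_congr rfl fun k hk => by
        rw [← h.conv_creg_creg hij.le hjM, (h.wt_creg hR hR' i j).conv_assoc hR
          (h.wt_creg hR hR' j M) (wt_psi hR _ _), h.conv_creg_psi hjM (Finset.mem_range.1 hk)]
    simp only [sub_mul, Finset.sum_sub_distrib] at h2
    rw [h3, h4]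
    linear_combination -h2
  · congr 1
    refine Finset.sum_congr rfl fun k hk => ?_
    have hk' := Finset.mem_range.1 hk
    have hki : k < n i := hk'.trans_le (h.mono (not_lt.1 hij))
    rw [h.conv_creg_psi hiM hki, hψ k _ hk' (h.hasLaurent_cin_psi hρ (le_refl i) hki)]
    rw [← h.conv_creg_psi (le_refl i) hki, h.creg_self, cin, sub_self, sub_self, Finset.Ioc_self]
    have : inner v 0 0 ∅ = Pi.single 0 1 := by
      rw [← expc_zero]
      refine (hasLaurent_inner (by simp) 0 0 hρ.1 (by simp)).coeff_unique hρ.1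
        (hasLaurent_expc 0 0 hρ.1) fun z _ => by simp [symbol]
    rw [this, conv_comm (Pi.single 0 1) (conv _ _), conv_single]

end

/-! ### Geometric weights and the Fredholm determinant of the regularised kernel -/

lemma zpow_weight_left {a : ℝ} (ha : 0 < a) (c x : ℤ) :
    a ^ (-x) * (a * 2) ^ (-(c - x)) = (a * 2) ^ (-c) * 2 ^ x := by
  rw [show -(c - x) = -c + x by ring, zpow_add₀ (by positivity), mul_zpow a 2 x, zpow_neg a x]
  have := (zpow_pos ha x).ne'
  field_simp

lemma zpow_weight_mid {a : ℝ} (ha : 0 < a) (E : ℝ) (x x' : ℤ) :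
    a ^ (-x) * (a * 2) ^ (-(x' - x)) * (2 * E * (a * 2)) ^ x' = 2 ^ x * 2 ^ x' * E ^ x' := by
  have := (zpow_pos (show 0 < a * 2 by positivity) x').ne'
  rw [zpow_weight_left ha, mul_zpow (2 * E) (a * 2), mul_zpow 2 E, zpow_neg]
  generalize (a * 2) ^ x' = c at this ⊢
  field_simp

section
variable {v : ℕ → ℝ} {y : ℕ → ℤ} {N : ℕ} {n : ℕ → ℕ} {a b : ℕ → ℂ} {Φ : ℕ → ℕ → ℤ → ℂ}
  (h : Chain v y N n a b Φ) {R ρ : ℝ} {s : ℕ → ℝ}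
include h

/-- The Fredholm determinant of the regularised kernel. -/
lemma Chain.hasFredholmDet (hN : 1 ≤ N) {M : ℕ} (hM : n M = N) :
    HasFredholmDet (fun p q : Fin (M + 1) × ℤ =>
      (if (p.2 : ℝ) < s p.1 then (1 : ℂ) else 0) *
      (-(if (p.1 : ℕ) < q.1 then creg v n a b p.1 q.1 (q.2 - p.2) else 0) + ∑ k : Fin N,
        conv (creg v n a b p.1 M) (psi v n a b M k) (y (k + 1) - p.2) * Φ q.1 k q.2) *
      (if (q.2 : ℝ) < s q.1 then (1 : ℂ) else 0))
      (Matrix.det (Matrix.of fun k l : Fin N =>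
        conv (cutGe (s M) (Φ M k - corr v n a b s Φ M k)) (psi v n a b M l) (y (l + 1)))) := by
  classical
  obtain ⟨R, hR, hR'⟩ := exists_large_radius h.pos N
  obtain ⟨ρ, hρ, hρ'⟩ := exists_small_radius h.pos N
  have hρ2 : IsSmallRadius v N ρ := ⟨hρ, fun j h1 h2 => by
    rw [lt_div_iff₀ (h.pos j h1)]; exact hρ' j h1 h2⟩
  have hbig : ∀ {T : ℝ}, R ≤ T → ∀ j, 1 ≤ j → j ≤ N → 1 < T * v j := fun hT j h1 h2 =>
    (hR' j h1 h2).trans_le (mul_le_mul_of_nonneg_right hT (h.pos j h1).le)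
  -- Time i carries the weight r_i^{-x}, while `creg` starting at time i is estimated on the circle
  -- of radius R2_i = 2 r_i. For i < j one has r_j ≥ 2 R2_i; these two factors 2 yield the decay 2^x
  -- and 2^{x'} in the two variables.
  set r : ℕ → ℝ := fun i => R * 2 ^ (2 * i + 1) with hr
  have hr0 : ∀ i, 0 < r i := fun i => by positivity
  set R2 : ℕ → ℝ := fun i => R * 2 ^ (2 * i + 2) with hR2
  have hR20 : ∀ i, 0 < R2 i := fun i => by positivity
  have hR2R : ∀ i, R ≤ R2 i := fun i => le_mul_of_one_le_right hR.le (one_le_pow₀ (by norm_num))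
  have hR2r : ∀ i, R2 i = r i * 2 := fun i => by simp only [hr, hR2]; ring
  -- the weights
  set χ : Fin (M + 1) × ℤ → ℝ := fun p => if (p.2 : ℝ) < s p.1 then 1 else 0 with hχ
  have hχ0 : ∀ p, 0 ≤ χ p := fun p => by simp only [hχ]; split_ifs <;> norm_num
  have hχs : ∀ (i : Fin (M + 1)) (x : ℤ) (E : ℝ), 1 ≤ E →
      χ (i, x) * E ^ x ≤ E ^ ⌈s i⌉ := fun i x E hE => by
    simp only [hχ]
    split_ifs with hx
    · rw [one_mul]
      refine zpow_le_zpow_right₀ hE ?_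
      have : (x : ℝ) ≤ ⌈s i⌉ := hx.le.trans (Int.le_ceil _)
      exact_mod_cast this
    · rw [zero_mul]; positivity
  set w0 : Fin (M + 1) × ℤ → ℝ := fun p => χ p * 2 ^ p.2 with hw0
  have hw00 : ∀ p, 0 ≤ w0 p := fun p => mul_nonneg (hχ0 p) (by positivity)
  set g : Fin (M + 1) × ℤ → ℝ := fun p => (r p.1) ^ (-p.2) with hg
  have hg0 : ∀ p, 0 < g p := fun p => zpow_pos (hr0 _) _
  have hginv : ∀ p, (g p)⁻¹ = r p.1 ^ p.2 := fun p => by simp only [hg, zpow_neg, inv_inv]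
  set L : Fin (M + 1) × ℤ → Fin (M + 1) × ℤ → ℂ := fun p q => g p * χ p *
    (if (p.1 : ℕ) < q.1 then creg v n a b p.1 q.1 (q.2 - p.2) else 0) * χ q * (g q : ℂ)⁻¹ with hL
  set u : Fin N → Fin (M + 1) × ℤ → ℂ := fun k p => g p * χ p *
    conv (creg v n a b p.1 M) (psi v n a b M k) (y (k + 1) - p.2) with hu
  set w : Fin N → Fin (M + 1) × ℤ → ℂ := fun k q => Φ q.1 k q.2 * χ q * (g q : ℂ)⁻¹ with hw
  have hLb : ∃ C, 0 ≤ C ∧ ∀ (e : Fin (M + 1) × Fin (M + 1)) (t : ℤ × ℤ),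
      ‖L (e.1, t.1) (e.2, t.2)‖ ≤ C * (w0 (e.1, t.1) * w0 (e.2, t.2)) := by
    refine exists_uniform_bound (g := fun (e : Fin (M + 1) × Fin (M + 1)) (t : ℤ × ℤ) => w0 (e.1, t.1) * w0 (e.2, t.2))
      (fun _ _ => mul_nonneg (hw00 _) (hw00 _)) ?_
    rintro ⟨i, j⟩
    by_cases hij : (i : ℕ) < j
    · obtain ⟨C, hC, hCb⟩ := (h.wt_creg (hR20 i) (hbig (hR2R i)) i j).norm_le (hR20 i)
      -- The surplus ratio is at least 1, so E^{x'} is bounded on x' < s_j and goes into the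
      -- constant.
      set E : ℝ := r j / R2 i / 2 with hE
      have hE1 : 1 ≤ E := by
        have h1 : (2 : ℝ) ^ (2 * (i : ℕ) + 2) * 2 ≤ 2 ^ (2 * (j : ℕ) + 1) := by
          rw [← pow_succ]
          exact pow_le_pow_right₀ (by norm_num) (by omega)
        rw [hE, le_div_iff₀ two_pos, le_div_iff₀ (hR20 i)]
        calc 1 * 2 * R2 i = R * (2 ^ (2 * (i : ℕ) + 2) * 2) := by simp only [hR2]; ring
          _ ≤ R * 2 ^ (2 * (j : ℕ) + 1) := mul_le_mul_of_nonneg_left h1 hR.le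
      refine ⟨C * E ^ ⌈s j⌉, fun ⟨x, x'⟩ => ?_⟩
      have hnorm : ‖L (i, x) (j, x')‖ =
          r i ^ (-x) * χ (i, x) * ‖creg v n a b i j (x' - x)‖ * χ (j, x') * r j ^ x' := by
        simp only [hL, hij, if_true, norm_mul, norm_inv, Complex.norm_real, Real.norm_eq_abs,
          abs_of_nonneg (hχ0 _), abs_of_pos (hg0 _), hginv]
        rfl
      rw [hnorm]
      have e1 : r i ^ (-x) * R2 i ^ (-(x' - x)) * r j ^ x' = 2 ^ x * 2 ^ x' * E ^ x' := by
        have : r j = 2 * E * R2 i := by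
          rw [hE]; field_simp [(hR20 i).ne']
        rw [this, hR2r, zpow_weight_mid (hr0 i)]
      calc r i ^ (-x) * χ (i, x) * ‖creg v n a b i j (x' - x)‖ * χ (j, x') * r j ^ x'
          ≤ r i ^ (-x) * χ (i, x) * (C * R2 i ^ (-(x' - x))) * χ (j, x') * r j ^ x' := by
            have := hCb (x' - x)
            have h1 := hχ0 (i, x)
            have h2 := hχ0 (j, x')
            have h3 := zpow_pos (hr0 i) (-x)
            have h4 := zpow_pos (hr0 j) x'
            gcongr
        _ = C * (χ (i, x) * 2 ^ x) * (2 ^ x' * (χ (j, x') * E ^ x')) := by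
            linear_combination (χ (i, x) * χ (j, x') * C) * e1
        _ = C * (χ (i, x) * 2 ^ x) * (2 ^ x' * (χ (j, x') * (χ (j, x') * E ^ x'))) := by
            have : χ (j, x') * χ (j, x') = χ (j, x') := by
              simp only [hχ]; split_ifs <;> norm_num
            rw [← mul_assoc (χ (j, x')) (χ (j, x')), this]
        _ ≤ C * (χ (i, x) * 2 ^ x) * (2 ^ x' * (χ (j, x') * E ^ ⌈s j⌉)) := by
            have h1 := hχ0 (i, x)
            have h2 := hχ0 (j, x')
            have := hχs j x' E hE1
            gcongr
        _ = _ := by simp only [hw0]; ring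
    · refine ⟨0, fun t => ?_⟩
      simp only [hL, hij, if_false, mul_zero, zero_mul, norm_zero, le_refl]
  have hub : ∃ C, 0 ≤ C ∧ ∀ (e : Fin (M + 1) × Fin N) (x : ℤ),
      ‖u e.2 (e.1, x)‖ ≤ C * w0 (e.1, x) := by
    refine exists_uniform_bound (g := fun (e : Fin (M + 1) × Fin N) (x : ℤ) => w0 (e.1, x)) (fun _ _ => hw00 _) ?_
    rintro ⟨i, k⟩
    obtain ⟨C, hC, hCb⟩ := ((h.wt_creg (hR20 i) (hbig (hR2R i)) i M).convolve (hR20 i)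
      (wt_psi (hR20 i) M k)).norm_le (hR20 i)
    refine ⟨C * R2 i ^ (-y (k + 1)), fun x => ?_⟩
    have hnorm : ‖u k (i, x)‖ = r i ^ (-x) * χ (i, x) *
        ‖conv (creg v n a b i M) (psi v n a b M k) (y (k + 1) - x)‖ := by
      simp only [hu, norm_mul, Complex.norm_real, Real.norm_eq_abs,
          abs_of_nonneg (hχ0 _), abs_of_pos (hg0 _)]
      rfl
    rw [hnorm]
    have e1 : r i ^ (-x) * R2 i ^ (-(y (k + 1) - x)) = R2 i ^ (-y (k + 1)) * 2 ^ x := by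
      rw [hR2r, zpow_weight_left (hr0 i)]
    calc _ ≤ r i ^ (-x) * χ (i, x) * (C * R2 i ^ (-(y (k + 1) - x))) := by
          have := hCb (y (k + 1) - x)
          have h1 := hχ0 (i, x)
          have h3 := zpow_pos (hr0 i) (-x)
          gcongr
      _ = _ := by simp only [hw0]; linear_combination (C * χ (i, x)) * e1
  have hwb : ∃ C, 0 ≤ C ∧ ∀ (e : Fin (M + 1) × Fin N) (x : ℤ),
      ‖w e.2 (e.1, x)‖ ≤ C * w0 (e.1, x) := by
    refine exists_uniform_bound (g := fun (e : Fin (M + 1) × Fin N) (x : ℤ) => w0 (e.1, x)) (fun _ _ => hw00 _) ?_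
    rintro ⟨j, k⟩
    obtain ⟨C, hC, hCb⟩ := (h.wt_cutLt hN hR hR' (s j) j k).norm_le hR
    refine ⟨C * (2 ^ (2 * (j : ℕ))) ^ ⌈s j⌉, fun x => ?_⟩
    have hnorm : ‖w k (j, x)‖ = ‖cutLt (s j) (Φ j k) x‖ * χ (j, x) * r j ^ x := by
      simp only [hw, norm_mul, norm_inv, Complex.norm_real, Real.norm_eq_abs,
          abs_of_pos (hg0 _), hginv, cutLt, hχ]
      split_ifs <;> simp
    rw [hnorm]
    have e1 : R ^ (-x) * r j ^ x = 2 ^ x * (2 ^ (2 * (j : ℕ))) ^ x := by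
      simp only [hr]
      rw [mul_zpow, pow_succ, mul_zpow, zpow_neg]
      have h1 : R ^ x ≠ 0 := (zpow_pos hR _).ne'
      field_simp
    have hχχ : χ (j, x) * χ (j, x) = χ (j, x) := by
      simp only [hχ]; split_ifs <;> norm_num
    calc _ ≤ (C * R ^ (-x)) * χ (j, x) * r j ^ x := by
          have := hCb x
          have h1 := hχ0 (j, x)
          have h3 := zpow_pos (hr0 j) x
          gcongr
      _ = C * (χ (j, x) * 2 ^ x) * (χ (j, x) * (2 ^ (2 * (j : ℕ))) ^ x) := by
          linear_combination (C * χ (j, x)) * e1 - C * 2 ^ x * (2 ^ (2 * (j : ℕ))) ^ x * hχχ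
      _ ≤ C * (χ (j, x) * 2 ^ x) * (2 ^ (2 * (j : ℕ))) ^ ⌈s j⌉ := by
          have h1 := hχ0 (j, x)
          have := hχs j x (2 ^ (2 * (j : ℕ))) (one_le_pow₀ (by norm_num))
          gcongr
      _ = _ := by simp only [hw0]; ring
  obtain ⟨C1, hC1, hLb⟩ := hLb
  obtain ⟨C2, hC2, hub⟩ := hub
  obtain ⟨C3, hC3, hwb⟩ := hwb
  set K : ℝ := 1 + C1 + C2 + C3 with hK
  set X : Fin N → ℕ → ℤ → ℂ := fun k i => cutLt (s i) (Φ i k - corr v n a b s Φ i k) with hX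
  have hXw : ∀ k i, Wt R (X k i) := fun k i => h.wt_cutLt_sub hN hR hR' i k
  set W : Fin N → Fin (M + 1) × ℤ → ℂ := fun k q => X k q.1 q.2 * (g q : ℂ)⁻¹ with hW
  have hgC : ∀ p, (g p : ℂ) ≠ 0 := fun p => by exact_mod_cast (hg0 p).ne'
  have hXχ : ∀ k (i : Fin (M + 1)) x, X k i x * χ (i, x) = X k i x := fun k i x => by
    simp only [hX, hχ, cutLt]
    split_ifs <;> simp
  -- The infinite triangular system: `W` is the truncated corrected dual function times the inverse
  -- weight, and its sum against `L` is the cut correction.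
  have hsumL : ∀ k (q : Fin (M + 1) × ℤ), ∑' p, W k p * L p q =
      corr v n a b s Φ q.1 k q.2 * χ q * (g q : ℂ)⁻¹ := by
    rintro k ⟨j, x'⟩
    have := hasSum_fin_prod (f := fun p => W k p * L p (j, x'))
      (a := fun i => if (i : ℕ) < j then
        conv (X k i) (creg v n a b i j) x' * χ (j, x') * (g (j, x') : ℂ)⁻¹ else 0) fun i => by
      split_ifs with hij
      · have h1 := (((hXw k i).summable_conv hR (h.wt_creg hR hR' i j) x').hasSum.mul_right
          (χ (j, x') : ℂ)).mul_right (g (j, x') : ℂ)⁻¹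
        refine h1.congr_fun fun x => ?_
        simp only [hW, hL, hij, if_true]
        have h2 := inv_mul_cancel₀ (hgC (i, x))
        linear_combination (X k i x * χ (i, x) * creg v n a b i j (x' - x) * χ (j, x') *
          (g (j, x') : ℂ)⁻¹) * h2 + creg v n a b i j (x' - x) * χ (j, x') *
          (g (j, x') : ℂ)⁻¹ * hXχ k i x
      · refine hasSum_zero.congr_fun fun x => ?_
        simp only [hL, hij, if_false, mul_zero, zero_mul]
    rw [this.tsum_eq, h.corr_eq_sum hN j k, Finset.sum_apply, Finset.sum_mul, Finset.sum_mul,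
      ← Finset.sum_filter]
    refine Finset.sum_bij (fun i _ => (i : ℕ)) ?_ ?_ ?_ ?_
    · intro i hi; simpa using hi
    · intro i _ i' _ hii; exact Fin.ext hii
    · intro i hi
      have hi' := Finset.mem_range.1 hi
      exact ⟨⟨i, by omega⟩, Finset.mem_filter.2 ⟨Finset.mem_univ _, hi'⟩, rfl⟩
    · intro i _; rfl
  have hsumu : ∀ k l : Fin N, ∑' p, W k p * u l p = ∑ i ∈ Finset.range (M + 1),
      conv (X k i) (conv (creg v n a b i M) (psi v n a b M l)) (y (l + 1)) := by
    intro k l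
    have := hasSum_fin_prod (f := fun p => W k p * u l p)
      (a := fun i => conv (X k i) (conv (creg v n a b i M) (psi v n a b M l)) (y (l + 1)))
      fun i => by
        have h1 := ((hXw k i).summable_conv hR ((h.wt_creg hR hR' i M).convolve hR
          (wt_psi (v := v) (n := n) (a := a) (b := b) hR M l)) (y (l + 1))).hasSum
        refine h1.congr_fun fun x => ?_
        simp only [hW, hu]
        have h2 := inv_mul_cancel₀ (hgC (i, x))
        linear_combination (X k i x * χ (i, x) * conv (creg v n a b i M) (psi v n a b M l)
          (y (l + 1) - x)) * h2 + conv (creg v n a b i M) (psi v n a b M l)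
          (y (l + 1) - x) * hXχ k i x
    rw [this.tsum_eq, Finset.sum_range]
  have hfin := hasFredholmDet_of_finite_rank (X := Fin (M + 1) × ℤ) (N := N)
    (B := fun p q => -L p q + ∑ k, u k p * w k q) (L := L) (u := u) (w := w) (W := W)
    (b := fun p => p.1) (m := M + 1) (α := fun p => K * w0 p) (fun p => p.1.2)
    (fun p => mul_nonneg (by positivity) (hw00 p)) ?_ (fun p q => rfl) ?_ ?_ ?_ ?_ ?_
  -- The weights are a conjugation and so do not change the Fredholm determinant.
  · refine HasFredholmDet.conj (fun p => (g p : ℂ)) hgC ?_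
    convert hfin using 1
    · funext p q
      simp only [hL, hu, hw, mul_add, add_mul, Finset.mul_sum, Finset.sum_mul]
      have hc : ∀ p : Fin (M + 1) × ℤ, (if (p.2 : ℝ) < s p.1 then (1 : ℂ) else 0) = χ p := fun p => by
        simp only [hχ]; split_ifs <;> simp
      rw [hc, hc]
      congr 1
      · ring
      · refine Finset.sum_congr rfl fun k _ => by ring
    · congr 1
      ext k l
      rw [Matrix.sub_apply, Matrix.of_apply, Matrix.of_apply, hsumu,
        ← h.matrix_eq hN hρ2 hM k.2 l.2, Matrix.one_apply]
      simp only [Fin.ext_iff]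
      rfl
  · have h1 : Summable fun p : Fin (M + 1) × ℤ => w0 p ^ 2 := by
      have h2 : Summable fun p : Fin (M + 1) × ℤ => ((w0 p ^ 2 : ℝ) : ℂ) := by
        choose A hA using fun i : Fin (M + 1) => show ∃ A : ℂ,
          HasSum (fun x : ℤ => ((w0 (i, x) ^ 2 : ℝ) : ℂ)) A from by
            have h3 := summable_cut_pow (r := 4) (by norm_num) ⌈s i⌉
            refine ⟨_, (Complex.hasSum_ofReal.2 (h3.congr fun x => ?_).hasSum)⟩
            simp only [hw0, hχ, ← Int.lt_ceil, mul_pow]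
            have : ((2 : ℝ) ^ x) ^ 2 = 4 ^ x := by
              rw [sq, ← mul_zpow]; norm_num
            split_ifs <;> simp [this]
        exact (hasSum_fin_prod hA).summable
      exact Complex.summable_ofReal.1 h2
    refine (h1.mul_left (K ^ 2)).congr fun p => ?_
    rw [mul_pow K]
  · rintro ⟨i, x⟩ ⟨j, x'⟩
    refine (hLb (i, j) (x, x')).trans ?_
    have h1 := mul_nonneg (hw00 (i, x)) (hw00 (j, x'))
    have h2 : C1 ≤ K * K := by nlinarith
    calc _ ≤ (K * K) * (w0 (i, x) * w0 (j, x')) := mul_le_mul_of_nonneg_right h2 h1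
      _ = _ := by ring
  · rintro k ⟨i, x⟩
    exact (hub (i, k) x).trans (mul_le_mul_of_nonneg_right (by linarith) (hw00 _))
  · rintro k ⟨i, x⟩
    exact (hwb (i, k) x).trans (mul_le_mul_of_nonneg_right (by linarith) (hw00 _))
  · rintro p q hpq
    simp only [hL, if_neg hpq, mul_zero, zero_mul]
  · rintro k ⟨j, x'⟩
    rw [hsumL, ← sub_mul, ← sub_mul]
    simp only [hW, hX, cutLt, hχ, Pi.sub_apply]
    split_ifs <;> simp

end

/-! ### Jump processes with bounded rates: master equation and Dynkin's formula -/

/-- The generator of a jump process whose jumps `J i` occur at rates `c i`. -/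
def jumpGen {S ι E : Type*} [Fintype ι] [AddCommGroup E] [Module ℝ E] (J : ι → S → S)
    (c : ι → S → ℝ) (f : S → E) (ξ : S) : E := ∑ i, c i ξ • (f (J i ξ) - f ξ)

/-- A solution on `[s, T]` of the master equation of the jump process with jumps `J i` at rates
`c u i`, consisting of probability distributions. -/
structure IsMasterSolution {S ι : Type*} [Fintype ι] [DecidableEq S] (J : ι → S → S)
    (c : ℝ → ι → S → ℝ) (Λ s T : ℝ) (P : ℝ → S → ℝ) : Prop where
  rate_nonneg : ∀ u ∈ Set.Icc s T, ∀ i ξ, 0 ≤ c u i ξ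
  rate_le : ∀ u ∈ Set.Icc s T, ∀ i ξ, c u i ξ ≤ Λ
  nonneg : ∀ u ∈ Set.Icc s T, ∀ ζ, 0 ≤ P u ζ
  hasSum : ∀ u ∈ Set.Icc s T, HasSum (P u) 1
  cont : ∀ ζ, ContinuousOn (fun u => P u ζ) (Set.Icc s T)
  deriv : ∀ u ∈ Set.Ioo s T, ∀ ζ, HasDerivAt (fun u => P u ζ)
    (∑' ξ, P u ξ * jumpGen J (c u) (fun ω => if ω = ζ then (1 : ℝ) else 0) ξ) u

section
variable {S ι E : Type*} [Fintype ι] [DecidableEq S] [NormedAddCommGroup E] [NormedSpace ℝ E]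
  {J : ι → S → S}

/-- Bound for the number of transitions between two states. -/
def jumpCount (J : ι → S → S) (ξ ζ : S) : ℝ :=
  ∑ i, ((if J i ξ = ζ then 1 else 0) + if ξ = ζ then 1 else 0)

lemma jumpCount_nonneg (ξ ζ : S) : 0 ≤ jumpCount J ξ ζ :=
  Finset.sum_nonneg fun i _ => by split_ifs <;> norm_num

lemma jumpCount_le (ξ ζ : S) : jumpCount J ξ ζ ≤ 2 * Fintype.card ι := by
  calc jumpCount J ξ ζ ≤ ∑ i : ι, 2 := Finset.sum_le_sum fun i _ => by split_ifs <;> norm_num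
    _ = _ := by simp [mul_comm]

lemma hasSum_jumpCount (w : S → ℝ) (ξ : S) :
    HasSum (fun ζ => jumpCount J ξ ζ * w ζ) (∑ i, (w (J i ξ) + w ξ)) := by
  simp only [jumpCount, Finset.sum_mul]
  refine hasSum_sum fun i _ => ?_
  simp only [add_mul]
  have h : ∀ a : S, HasSum (fun ζ => (if a = ζ then (1 : ℝ) else 0) * w ζ) (w a) := fun a => by
    convert hasSum_ite_eq a (w a) using 2 with ζ
    by_cases h : ζ = a
    · subst h; simp
    · simp [h, Ne.symm h]
  exact (h _).add (h _)

lemma hasSum_jumpGen (c : ι → S → ℝ) (H : S → E) (ξ : S) :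
    HasSum (fun ζ => jumpGen J c (fun ω => if ω = ζ then (1 : ℝ) else 0) ξ • H ζ)
      (jumpGen J c H ξ) := by
  simp only [jumpGen, Finset.sum_smul]
  refine hasSum_sum fun i _ => ?_
  simp only [smul_assoc, sub_smul]
  refine HasSum.const_smul _ ?_
  have h : ∀ a : S, HasSum (fun ζ => (if a = ζ then (1 : ℝ) else 0) • H ζ) (H a) := fun a => by
    convert hasSum_ite_eq a (H a) using 2 with ζ
    by_cases h : ζ = a
    · subst h; simp
    · simp [h, Ne.symm h]
  exact (h _).sub (h _)

lemma abs_jumpGen_le {c : ι → S → ℝ} {Λ : ℝ} (h0 : ∀ i ξ, 0 ≤ c i ξ) (h1 : ∀ i ξ, c i ξ ≤ Λ)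
    (ξ ζ : S) : |jumpGen J c (fun ω => if ω = ζ then (1 : ℝ) else 0) ξ| ≤
      Λ * jumpCount J ξ ζ := by
  rw [jumpGen, jumpCount, Finset.mul_sum]
  refine (Finset.abs_sum_le_sum_abs _ _).trans (Finset.sum_le_sum fun i _ => ?_)
  rw [smul_eq_mul, abs_mul, abs_of_nonneg (h0 i ξ)]
  refine mul_le_mul (h1 i ξ) ?_ (abs_nonneg _) ((h0 i ξ).trans (h1 i ξ))
  split_ifs <;> norm_num

variable {c : ℝ → ι → S → ℝ} {Λ s T : ℝ} {P : ℝ → S → ℝ} (hP : IsMasterSolution J c Λ s T P)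
include hP

lemma IsMasterSolution.summable_mul_jumpGen {u : ℝ} (hu : u ∈ Set.Icc s T) (ζ : S) :
    Summable fun ξ => P u ξ * jumpGen J (c u) (fun ω => if ω = ζ then (1 : ℝ) else 0) ξ := by
  by_cases hι : IsEmpty ι
  · simp [jumpGen]
  have hΛ : 0 ≤ Λ := by
    obtain ⟨i⟩ := not_isEmpty_iff.1 hι
    exact (hP.rate_nonneg u hu i ζ).trans (hP.rate_le u hu i ζ)
  refine Summable.of_norm_bounded ((hP.hasSum u hu).summable.mul_right
    (Λ * (2 * Fintype.card ι))) fun ξ => ?_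
  rw [norm_mul, Real.norm_eq_abs, abs_of_nonneg (hP.nonneg u hu ξ)]
  refine mul_le_mul_of_nonneg_left ?_ (hP.nonneg u hu ξ)
  exact (abs_jumpGen_le (hP.rate_nonneg u hu) (hP.rate_le u hu) ξ ζ).trans
    (mul_le_mul_of_nonneg_left (jumpCount_le ξ ζ) hΛ)

/-- Up to an exponential factor, the probabilities are dominated by those at the final time. -/
lemma IsMasterSolution.le_final {u : ℝ} (hu : u ∈ Set.Icc s T) (ζ : S) :
    P u ζ ≤ Real.exp (Fintype.card ι * Λ * (T - u)) * P T ζ := by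
  set l : ℝ := Fintype.card ι * Λ with hl
  have hsT : s ≤ T := hu.1.trans hu.2
  -- A state is left at rate at most |ι| Λ, so compensating by this exponential makes its
  -- probability nondecreasing.
  have hmono : MonotoneOn (fun u => Real.exp (l * u) * P u ζ) (Set.Icc s T) := by
    have hd : ∀ u ∈ Set.Ioo s T, HasDerivAt (fun u => Real.exp (l * u) * P u ζ)
        (Real.exp (l * u) * l * P u ζ + Real.exp (l * u) * ∑' ξ, P u ξ *
          jumpGen J (c u) (fun ω => if ω = ζ then (1 : ℝ) else 0) ξ) u := fun u hu => by
      have h1 : HasDerivAt (fun u => Real.exp (l * u)) (Real.exp (l * u) * l) u := by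
        have := ((hasDerivAt_id u).const_mul l).exp
        simpa using this
      exact h1.mul (hP.deriv u hu ζ)
    refine monotoneOn_of_deriv_nonneg (convex_Icc _ _) ?_ ?_ ?_
    · exact ContinuousOn.mul (by fun_prop) (hP.cont ζ)
    · rw [interior_Icc]
      exact fun u hu => (hd u hu).differentiableAt.differentiableWithinAt
    · rw [interior_Icc]
      intro u hu
      rw [(hd u hu).deriv]
      have hu' := Set.Ioo_subset_Icc_self hu
      have h1 : -(l * P u ζ) ≤ ∑' ξ, P u ξ *
          jumpGen J (c u) (fun ω => if ω = ζ then (1 : ℝ) else 0) ξ := by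
        have h2 : HasSum (fun ξ => if ξ = ζ then -(l * P u ζ) else 0) (-(l * P u ζ)) :=
          hasSum_ite_eq ζ _
        refine hasSum_le (fun ξ => ?_) h2 (hP.summable_mul_jumpGen hu' ζ).hasSum
        have h3 : (if ξ = ζ then -l else 0) ≤
            jumpGen J (c u) (fun ω => if ω = ζ then (1 : ℝ) else 0) ξ := by
          rw [jumpGen]
          have : (if ξ = ζ then -l else 0) = ∑ i : ι, if ξ = ζ then -Λ else 0 := by
            split_ifs <;> simp [hl]
          rw [this]
          refine Finset.sum_le_sum fun i _ => ?_
          have e1 := hP.rate_nonneg u hu' i ξ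
          have e2 := hP.rate_le u hu' i ξ
          rw [smul_eq_mul]
          split_ifs <;> nlinarith
        have h4 := mul_le_mul_of_nonneg_left h3 (hP.nonneg u hu' ξ)
        refine le_trans (le_of_eq ?_) h4
        split_ifs with h
        · rw [h]; ring
        · ring
      have h5 := Real.exp_pos (l * u)
      nlinarith
  have := hmono hu (Set.right_mem_Icc.2 hsT) hu.2
  beta_reduce at this
  rw [mul_sub, Real.exp_sub, div_mul_eq_mul_div, le_div_iff₀ (Real.exp_pos _)]
  linarith

/-- Dominating family for sums over the states. -/
lemma IsMasterSolution.le_dom {u : ℝ} (hΛ : 0 ≤ Λ) (hu : u ∈ Set.Icc s T) (ζ : S) :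
    P u ζ ≤ Real.exp (Fintype.card ι * Λ * (T - s)) * P T ζ := by
  refine (hP.le_final hu ζ).trans (mul_le_mul_of_nonneg_right (Real.exp_le_exp.2 ?_)
    (hP.nonneg T (Set.right_mem_Icc.2 (hu.1.trans hu.2)) ζ))
  have := hu.1
  exact mul_le_mul_of_nonneg_left (by linarith) (by positivity)

variable [CompleteSpace E] {w : S → ℝ} {K C : ℝ} {H H' : ℝ → S → E}

lemma IsMasterSolution.continuousOn_tsum (hΛ : 0 ≤ Λ)
    (hPw : Summable fun ζ => P T ζ * w ζ) (hHc : ∀ ζ, ContinuousOn (fun u => H u ζ) (Set.Icc s T))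
    (hH : ∀ u ∈ Set.Icc s T, ∀ ζ, ‖H u ζ‖ ≤ C * w ζ) :
    ContinuousOn (fun u => ∑' ζ, P u ζ • H u ζ) (Set.Icc s T) := by
  refine _root_.continuousOn_tsum (fun ζ => (hP.cont ζ).smul (hHc ζ))
    (hPw.mul_left (Real.exp (Fintype.card ι * Λ * (T - s)) * C)) fun ζ u hu => ?_
  rw [norm_smul, Real.norm_eq_abs, abs_of_nonneg (hP.nonneg u hu ζ)]
  have h1 := hP.le_dom hΛ hu ζ
  have h2 := hH u hu ζ
  calc P u ζ * ‖H u ζ‖ ≤ (Real.exp (Fintype.card ι * Λ * (T - s)) * P T ζ) * (C * w ζ) :=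
        mul_le_mul h1 h2 (norm_nonneg _) ((hP.nonneg u hu ζ).trans h1)
    _ = _ := by ring

/-- By `le_dom` the probabilities at all times are dominated by those at the final time T. This one
family therefore controls, uniformly in time, the exchange of sums in Dynkin's formula. -/
lemma IsMasterSolution.summable_prod (hsT : s ≤ T) (hw : ∀ ζ, 0 ≤ w ζ)
    (hJ : ∀ i ξ, w (J i ξ) ≤ K * w ξ) (hPw : Summable fun ζ => P T ζ * w ζ) :
    Summable fun p : S × S => P T p.1 * (jumpCount J p.1 p.2 * w p.2) := by
  have h0 := hP.nonneg T (Set.right_mem_Icc.2 hsT)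
  rw [summable_prod_of_nonneg (fun p => mul_nonneg (h0 p.1)
    (mul_nonneg (jumpCount_nonneg (J := J) p.1 p.2) (hw p.2)))]
  refine ⟨fun ξ => ?_, ?_⟩
  · exact (hasSum_jumpCount (J := J) w ξ).summable.mul_left (P T ξ)
  · simp only [((hasSum_jumpCount (J := J) w _).mul_left _).tsum_eq]
    refine Summable.of_nonneg_of_le (fun ξ => mul_nonneg (h0 ξ) (Finset.sum_nonneg fun i _ =>
      add_nonneg (hw _) (hw _))) (fun ξ => ?_) (hPw.mul_left (Fintype.card ι * (K + 1)))
    calc P T ξ * ∑ i, (w (J i ξ) + w ξ) ≤ P T ξ * ∑ i : ι, (K * w ξ + w ξ) := by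
          refine mul_le_mul_of_nonneg_left (Finset.sum_le_sum fun i _ => ?_) (h0 ξ)
          have := hJ i ξ
          linarith
      _ = _ := by
        rw [Finset.sum_const, Finset.card_univ, nsmul_eq_mul]; ring

/-- Dynkin's formula. -/
theorem IsMasterSolution.hasDerivAt_tsum (hΛ : 0 ≤ Λ) (hw : ∀ ζ, 0 ≤ w ζ)
    (hJ : ∀ i ξ, w (J i ξ) ≤ K * w ξ) (hPw : Summable fun ζ => P T ζ * w ζ)
    (hH : ∀ u ∈ Set.Icc s T, ∀ ζ, ‖H u ζ‖ ≤ C * w ζ)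
    (hH' : ∀ u ∈ Set.Ioo s T, ∀ ζ, ‖H' u ζ‖ ≤ C * w ζ)
    (hHd : ∀ u ∈ Set.Ioo s T, ∀ ζ, HasDerivAt (fun u => H u ζ) (H' u ζ) u)
    {u : ℝ} (hu : u ∈ Set.Ioo s T) :
    HasDerivAt (fun u => ∑' ζ, P u ζ • H u ζ)
      (∑' ζ, P u ζ • (H' u ζ + jumpGen J (c u) (H u) ζ)) u := by
  have hsT : s ≤ T := (hu.1.trans hu.2).le
  set D := Real.exp (Fintype.card ι * Λ * (T - s)) with hD
  have hD0 : 0 < D := Real.exp_pos _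
  have hprod := hP.summable_prod hsT hw hJ hPw
  have hT0 := hP.nonneg T (Set.right_mem_Icc.2 hsT)
  set q : ℝ → S → S → ℝ := fun u ξ ζ =>
    jumpGen J (c u) (fun ω => if ω = ζ then (1 : ℝ) else 0) ξ with hq
  have hqb : ∀ u ∈ Set.Icc s T, ∀ ξ ζ, ‖(P u ξ * q u ξ ζ) • H u ζ‖ ≤
      D * Λ * C * (P T ξ * (jumpCount J ξ ζ * w ζ)) := fun u hu ξ ζ => by
    rw [norm_smul, norm_mul, Real.norm_eq_abs, Real.norm_eq_abs, abs_of_nonneg (hP.nonneg u hu ξ)]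
    calc P u ξ * |q u ξ ζ| * ‖H u ζ‖
        ≤ (D * P T ξ) * (Λ * jumpCount J ξ ζ) * (C * w ζ) := by
          have h1 := hP.le_dom hΛ hu ξ
          have h2 := abs_jumpGen_le (J := J) (hP.rate_nonneg u hu) (hP.rate_le u hu) ξ ζ
          have h3 := hP.nonneg u hu ξ
          have h4 := mul_nonneg hΛ (jumpCount_nonneg (J := J) ξ ζ)
          have h5 := hT0 ξ
          refine mul_le_mul (mul_le_mul h1 h2 (abs_nonneg _) (by positivity)) (hH u hu ζ)
            (norm_nonneg _) (by positivity)
      _ = _ := by ring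
  have hs2 : Summable fun ζ => ∑' ξ, P T ξ * (jumpCount J ξ ζ * w ζ) := by
    have := hprod.prod_symm
    exact this.prod
  have hfib : ∀ ζ, Summable fun ξ => P T ξ * (jumpCount J ξ ζ * w ζ) := fun ζ =>
    hprod.prod_symm.prod_factor ζ
  have hfu : ∀ u ∈ Set.Icc s T, ∀ ζ, (∑' ξ, P u ξ * q u ξ ζ) • H u ζ =
      ∑' ξ, (P u ξ * q u ξ ζ) • H u ζ := fun u hu ζ =>
    ((hP.summable_mul_jumpGen hu ζ).hasSum.smul_const (H u ζ)).tsum_eq.symm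
  -- The series is differentiated termwise, with the master equation for the derivative of `P`;
  -- Fubini over pairs of states then moves the generator onto `H`.
  have hmain := hasDerivAt_tsum_of_isPreconnected (t := Set.Ioo s T) (y₀ := u)
    (g := fun ζ u => P u ζ • H u ζ)
    (g' := fun ζ u => P u ζ • H' u ζ + (∑' ξ, P u ξ * q u ξ ζ) • H u ζ)
    (u := fun ζ => D * C * (P T ζ * w ζ) + D * Λ * C * ∑' ξ, P T ξ * (jumpCount J ξ ζ * w ζ))
    ((hPw.mul_left _).add (hs2.mul_left _)) isOpen_Ioo isPreconnected_Ioo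
    (fun ζ u hu => (hP.deriv u hu ζ).smul (hHd u hu ζ)) ?_ hu ?_ hu
  · convert hmain using 1
    have hu' := Set.Ioo_subset_Icc_self hu
    have hsm : ∀ {G : S → E}, (∀ ζ, ‖G ζ‖ ≤ C * w ζ) → Summable fun ζ => P u ζ • G ζ :=
      fun {G} hG => by
        refine Summable.of_norm_bounded (hPw.mul_left (D * C)) fun ζ => ?_
        rw [norm_smul, Real.norm_eq_abs, abs_of_nonneg (hP.nonneg u hu' ζ)]
        have h1 := hP.le_dom hΛ hu' ζ
        calc _ ≤ (D * P T ζ) * (C * w ζ) :=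
              mul_le_mul h1 (hG ζ) (norm_nonneg _) ((hP.nonneg u hu' ζ).trans h1)
          _ = _ := by ring
    have hunc : Summable (Function.uncurry fun ξ ζ => (P u ξ * q u ξ ζ) • H u ζ) :=
      Summable.of_norm_bounded (hprod.mul_left (D * Λ * C)) fun p => hqb u hu' p.1 p.2
    have hgen : ∀ ξ, ∑' ζ, (P u ξ * q u ξ ζ) • H u ζ = P u ξ • jumpGen J (c u) (H u) ξ :=
      fun ξ => by
        simp only [mul_smul]
        exact ((hasSum_jumpGen (J := J) (c u) (H u) ξ).const_smul (P u ξ)).tsum_eq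
    have hs3 : Summable fun ξ => P u ξ • jumpGen J (c u) (H u) ξ := by
      refine hunc.prod.congr fun ξ => ?_
      exact hgen ξ
    have hs4 : Summable fun ζ => (∑' ξ, P u ξ * q u ξ ζ) • H u ζ := by
      refine hunc.prod_symm.prod.congr fun ζ => ?_
      rw [hfu u hu' ζ]
      rfl
    simp only [smul_add]
    rw [(hsm (hH' u hu)).tsum_add hs3, (hsm (hH' u hu)).tsum_add hs4]
    congr 1
    simp only [hfu u hu']
    rw [hunc.tsum_comm]
    exact (tsum_congr hgen).symm
  · intro ζ u hu
    have hu' := Set.Ioo_subset_Icc_self hu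
    refine (norm_add_le _ _).trans (add_le_add ?_ ?_)
    · rw [norm_smul, Real.norm_eq_abs, abs_of_nonneg (hP.nonneg u hu' ζ)]
      have h1 := hP.le_dom hΛ hu' ζ
      calc _ ≤ (D * P T ζ) * (C * w ζ) :=
            mul_le_mul h1 (hH' u hu ζ) (norm_nonneg _) ((hP.nonneg u hu' ζ).trans h1)
        _ = _ := by ring
    · rw [hfu u hu' ζ, ← tsum_mul_left]
      exact tsum_of_norm_bounded ((hfib ζ).mul_left (D * Λ * C)).hasSum fun ξ => hqb u hu' ξ ζ
  · have hu' := Set.Ioo_subset_Icc_self hu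
    refine Summable.of_norm_bounded (hPw.mul_left (D * C)) fun ζ => ?_
    rw [norm_smul, Real.norm_eq_abs, abs_of_nonneg (hP.nonneg u hu' ζ)]
    have h1 := hP.le_dom hΛ hu' ζ
    calc _ ≤ (D * P T ζ) * (C * w ζ) :=
          mul_le_mul h1 (hH u hu' ζ) (norm_nonneg _) ((hP.nonneg u hu' ζ).trans h1)
      _ = _ := by ring

end

section
variable {S ι E : Type*} [Fintype ι] [DecidableEq S] [NormedAddCommGroup E] [NormedSpace ℝ E]
  {J : ι → S → S} {c : ℝ → ι → S → ℝ} {Λ s T : ℝ} {P : ℝ → S → ℝ}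

lemma eq_of_deriv_zero {F : ℝ → E} (hsT : s ≤ T) (hc : ContinuousOn F (Set.Icc s T))
    (hd : ∀ u ∈ Set.Ioo s T, HasDerivAt F 0 u) : F T = F s := by
  rcases hsT.eq_or_lt with rfl | hlt
  · rfl
  have hmid : (s + T) / 2 ∈ Set.Ioo s T := ⟨by linarith, by linarith⟩
  have h1 : Set.EqOn F (fun _ => F ((s + T) / 2)) (Set.Ioo s T) := fun u hu =>
    IsOpen.is_const_of_deriv_eq_zero (𝕜 := ℝ) isOpen_Ioo isPreconnected_Ioo
      (fun x hx => (hd x hx).differentiableAt.differentiableWithinAt)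
      (fun x hx => (hd x hx).deriv) hu hmid
  have h2 := h1.of_subset_closure hc continuousOn_const Set.Ioo_subset_Icc_self
    (closure_Ioo hlt.ne).ge
  rw [h2 (Set.right_mem_Icc.2 hsT), h2 (Set.left_mem_Icc.2 hsT)]

omit [Fintype ι] in
lemma tsum_smul_eq_of_init {f : S → ℝ} {η : S}
    (hi : ∀ ζ, f ζ = if ζ = η then 1 else 0) (H : S → E) : ∑' ζ, f ζ • H ζ = H η := by
  rw [tsum_eq_single η]
  · simp [hi]
  · intro ζ hζ; simp [hi, hζ]

variable (hP : IsMasterSolution J c Λ s T P)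
include hP

/-- Moments propagate. -/
lemma IsMasterSolution.summable_weight (hsT : s ≤ T) (hΛ : 0 ≤ Λ) {η : S}
    (hi : ∀ ζ, P s ζ = if ζ = η then 1 else 0) {w : S → ℝ} {K : ℝ} (hw : ∀ ζ, 0 ≤ w ζ)
    (hK : 1 ≤ K) (hJ : ∀ i ξ, w (J i ξ) ≤ K * w ξ) : Summable fun ζ => P T ζ * w ζ := by
  set κ : ℝ := Fintype.card ι * Λ * K with hκ
  have hT := Set.right_mem_Icc.2 hsT
  have hs := Set.left_mem_Icc.2 hsT
  -- Dynkin's formula is applied to the bounded function min(w, M); the resulting estimate does not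
  -- depend on M.
  have hbound : ∀ M : ℕ, HasSum (fun ζ => P T ζ * min (w ζ) M) (∑' ζ, P T ζ * min (w ζ) M) ∧
      ∑' ζ, P T ζ * min (w ζ) M ≤ Real.exp (κ * (T - s)) * w η := by
    intro M
    set W : S → ℝ := fun ζ => min (w ζ) M with hW
    have hW0 : ∀ ζ, 0 ≤ W ζ := fun ζ => le_min (hw ζ) (Nat.cast_nonneg M)
    have hWn : ∀ ζ, ‖W ζ‖ ≤ M * 1 := fun ζ => by
      rw [Real.norm_eq_abs, abs_of_nonneg (hW0 ζ), mul_one]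
      exact min_le_right _ _
    have hWJ : ∀ i ξ, W (J i ξ) ≤ K * W ξ := fun i ξ => by
      rcases le_total (w ξ) M with h | h
      · simp only [hW, min_eq_left h]; exact (min_le_left _ _).trans (hJ i ξ)
      · simp only [hW, min_eq_right h]
        exact (min_le_right _ _).trans (le_mul_of_one_le_left (Nat.cast_nonneg M) hK)
    have hP1 : ∀ {u}, u ∈ Set.Icc s T → Summable fun ζ => P u ζ * 1 := fun hu => by
      simpa using (hP.hasSum _ hu).summable
    have hsumW : ∀ {u}, u ∈ Set.Icc s T → ∀ {G : S → ℝ} {B : ℝ}, (∀ ζ, |G ζ| ≤ B) →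
        Summable fun ζ => P u ζ * G ζ := fun {u} hu {G} {B} hG =>
      Summable.of_norm_bounded ((hP1 hu).mul_right B) fun ζ => by
        rw [norm_mul, Real.norm_eq_abs, abs_of_nonneg (hP.nonneg u hu ζ), mul_one]
        exact mul_le_mul_of_nonneg_left (hG ζ) (hP.nonneg u hu ζ)
    have hWb : ∀ ζ, |W ζ| ≤ M := fun ζ => by simpa using hWn ζ
    refine ⟨(hsumW hT hWb).hasSum, ?_⟩
    set F : ℝ → ℝ := fun u => ∑' ζ, P u ζ • W ζ with hF
    have hFc : ContinuousOn F (Set.Icc s T) := hP.continuousOn_tsum (H := fun _ => W) hΛ (hP1 hT)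
      (fun ζ => continuousOn_const) (fun u _ => hWn)
    have hFd : ∀ u ∈ Set.Ioo s T, HasDerivAt F (∑' ζ, P u ζ • (0 + jumpGen J (c u) W ζ)) u :=
      fun u hu => hP.hasDerivAt_tsum (H := fun _ => W) (H' := fun _ _ => 0) (w := fun _ => 1)
        (K := 1) (C := M) hΛ (fun _ => zero_le_one) (fun _ _ => by norm_num)
        (hP1 hT) (fun u _ => hWn) (fun u _ ζ => by simp) (fun u _ ζ => hasDerivAt_const _ _) hu
    have hgen : ∀ u ∈ Set.Icc s T, ∀ ζ, jumpGen J (c u) W ζ ≤ κ * W ζ := fun u hu ζ => by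
      have : κ * W ζ = ∑ i : ι, Λ * (K * W ζ) := by
        rw [Finset.sum_const, Finset.card_univ, nsmul_eq_mul]; ring
      rw [this, jumpGen]
      refine Finset.sum_le_sum fun i _ => ?_
      have h1 := hP.rate_nonneg u hu i ζ
      have h2 := hP.rate_le u hu i ζ
      rw [smul_eq_mul]
      calc c u i ζ * (W (J i ζ) - W ζ) ≤ c u i ζ * (K * W ζ) :=
            mul_le_mul_of_nonneg_left (by linarith [hWJ i ζ, hW0 ζ]) h1
        _ ≤ Λ * (K * W ζ) := mul_le_mul_of_nonneg_right h2
            (mul_nonneg (by linarith) (hW0 ζ))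
    have hgenb : ∀ u ∈ Set.Icc s T, ∀ ζ, |0 + jumpGen J (c u) W ζ| ≤
        Fintype.card ι * (Λ * M) := fun u hu ζ => by
      rw [zero_add, jumpGen]
      refine (Finset.abs_sum_le_sum_abs _ _).trans ?_
      have : (Fintype.card ι : ℝ) * (Λ * M) = ∑ i : ι, Λ * M := by
        rw [Finset.sum_const, Finset.card_univ, nsmul_eq_mul]
      rw [this]
      refine Finset.sum_le_sum fun i _ => ?_
      rw [smul_eq_mul, abs_mul, abs_of_nonneg (hP.rate_nonneg u hu i ζ)]
      refine mul_le_mul (hP.rate_le u hu i ζ) ?_ (abs_nonneg _) hΛ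
      have e1 : ∀ ζ, W ζ ≤ M := fun ζ => min_le_right _ _
      rw [abs_le]
      constructor <;> linarith [e1 ζ, e1 (J i ζ), hW0 ζ, hW0 (J i ζ)]
    -- Grönwall: the generator applied to the cut weight is at most κ times the cut weight.
    have hanti : AntitoneOn (fun u => Real.exp (-κ * u) * F u) (Set.Icc s T) := by
      have hd : ∀ u ∈ Set.Ioo s T, HasDerivAt (fun u => Real.exp (-κ * u) * F u)
          (Real.exp (-κ * u) * -κ * F u +
            Real.exp (-κ * u) * ∑' ζ, P u ζ • (0 + jumpGen J (c u) W ζ)) u := fun u hu => by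
        have h1 : HasDerivAt (fun u => Real.exp (-κ * u)) (Real.exp (-κ * u) * -κ) u := by
          have := ((hasDerivAt_id u).const_mul (-κ)).exp
          simpa using this
        exact h1.mul (hFd u hu)
      refine antitoneOn_of_deriv_nonpos (convex_Icc _ _) ?_ ?_ ?_
      · exact ContinuousOn.mul (by fun_prop) hFc
      · rw [interior_Icc]
        exact fun u hu => (hd u hu).differentiableAt.differentiableWithinAt
      · rw [interior_Icc]
        intro u hu
        rw [(hd u hu).deriv]
        have hu' := Set.Ioo_subset_Icc_self hu
        have h1 : ∑' ζ, P u ζ • (0 + jumpGen J (c u) W ζ) ≤ κ * F u := by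
          rw [hF, ← tsum_mul_left]
          refine Summable.tsum_le_tsum (fun ζ => ?_) (hsumW hu' (hgenb u hu'))
            ((hsumW hu' hWb).mul_left κ)
          have := mul_le_mul_of_nonneg_left (hgen u hu' ζ) (hP.nonneg u hu' ζ)
          simp only [smul_eq_mul, zero_add]
          linarith
        have h2 := Real.exp_pos (-κ * u)
        nlinarith
    have h3 := hanti hs hT hsT
    beta_reduce at h3
    have h4 : F s = W η := tsum_smul_eq_of_init hi W
    have h5 : F T = ∑' ζ, P T ζ * W ζ := rfl
    rw [← h5]
    rw [h4] at h3
    have h6 : F T = Real.exp (κ * T) * (Real.exp (-κ * T) * F T) := by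
      rw [← mul_assoc, ← Real.exp_add]; simp
    rw [h6]
    calc _ ≤ Real.exp (κ * T) * (Real.exp (-κ * s) * W η) :=
          mul_le_mul_of_nonneg_left h3 (Real.exp_pos _).le
      _ = Real.exp (κ * (T - s)) * W η := by rw [← mul_assoc, ← Real.exp_add]; ring_nf
      _ ≤ _ := mul_le_mul_of_nonneg_left (min_le_left _ _) (Real.exp_pos _).le
  have hT0 := hP.nonneg T hT
  refine summable_of_sum_le (c := Real.exp (κ * (T - s)) * w η)
    (fun ζ => mul_nonneg (hT0 ζ) (hw ζ)) fun A => ?_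
  -- On a finite set of states the cut at a large M is invisible, so all finite partial sums are
  -- bounded.
  obtain ⟨M, hM⟩ := exists_nat_ge (∑ ζ ∈ A, w ζ)
  have h1 : ∑ ζ ∈ A, P T ζ * w ζ = ∑ ζ ∈ A, P T ζ * min (w ζ) M :=
    Finset.sum_congr rfl fun ζ hζ => by
      rw [min_eq_left ((Finset.single_le_sum (fun ζ _ => hw ζ) hζ).trans hM)]
  rw [h1]
  exact (sum_le_hasSum A (fun ζ _ => mul_nonneg (hT0 ζ) (le_min (hw ζ) (Nat.cast_nonneg M)))
    (hbound M).1).trans (hbound M).2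

end

/-! PushASEP as a jump process -/

section
variable {N : ℕ}

lemma StrictAnti.add_le {η : Fin N → ℤ} (h : StrictAnti η) {i j : Fin N} (hij : i ≤ j) :
    η j + (j - i : ℤ) ≤ η i := by
  obtain ⟨i, hi⟩ := i
  obtain ⟨j, hj⟩ := j
  simp only [Fin.mk_le_mk] at hij
  induction j, hij using Nat.le_induction with
  | base => simp
  | succ j hj' ih =>
    have h1 := ih (by omega)
    have h2 : η ⟨j + 1, hj⟩ < η ⟨j, by omega⟩ := h (by simp)
    push_cast at h1 ⊢
    omega

lemma strictAnti_jumpRight {η : Fin N → ℤ} (h : StrictAnti η) {k : Fin N}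
    (hk : ∀ j, η j ≠ η k + 1) : StrictAnti (jumpRight η k) := by
  intro i j hij
  have h1 := h hij
  simp only [jumpRight, Function.update_apply]
  split_ifs with h2 h3 h3
  · omega
  · subst h2
    have := hk i
    omega
  · subst h3; omega
  · exact h1

lemma strictAnti_pushLeft {η : Fin N → ℤ} (h : StrictAnti η) (k : Fin N) :
    StrictAnti (pushLeft η k) := by
  intro i j hij
  have h1 := h hij
  have h2 := StrictAnti.add_le h hij.le
  simp only [pushLeft]
  have hij' : (i : ℕ) < j := hij
  split_ifs with h3 h4 h4
  · omega
  · omega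
  · have h5 : ¬ (η j = η k - ((j : ℤ) - (k : ℤ))) := fun h5 => h3 ⟨h4.1.trans hij.le, h5⟩
    have := h4.2
    omega
  · exact h1

/-- The jumps of PushASEP. -/
def pushJump (i : Fin N × Bool) (η : Fin N → ℤ) : Fin N → ℤ :=
  if i.2 then jumpRight η i.1 else pushLeft η i.1

/-- The jump rates of PushASEP. -/
noncomputable def pushRate (v : ℕ → ℝ) (a b : ℝ → ℝ) (t : ℝ) (i : Fin N × Bool)
    (η : Fin N → ℤ) : ℝ :=
  if i.2 then (if ∀ j, η j ≠ η i.1 + 1 then derivWithin a (Set.Ici 0) t * v (i.1 + 1) else 0)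
  else derivWithin b (Set.Ici 0) t / v (i.1 + 1)

lemma generator_eq_jumpGen (v : ℕ → ℝ) (a b : ℝ → ℝ) (t : ℝ) (f : (Fin N → ℤ) → ℝ) :
    generator v a b t f = jumpGen pushJump (pushRate v a b t) f := by
  funext η
  rw [generator, jumpGen, Fintype.sum_prod_type]
  refine Finset.sum_congr rfl fun k _ => ?_
  simp only [Fintype.sum_bool, pushRate, pushJump, if_true, smul_eq_mul, ite_mul, zero_mul,
    Bool.false_eq_true, if_false]

/-- The exponential weight on configurations. -/
noncomputable def expWeight (R : ℝ) (η : Fin N → ℤ) : ℝ := R ^ (∑ i, (η i).natAbs)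

lemma expWeight_nonneg {R : ℝ} (hR : 1 ≤ R) (η : Fin N → ℤ) : 0 ≤ expWeight R η :=
  pow_nonneg (by linarith) _

/-- A jump, including all pushed particles, moves each coordinate by at most one. -/
lemma expWeight_pushJump {R : ℝ} (hR : 1 ≤ R) (i : Fin N × Bool) (η : Fin N → ℤ) :
    expWeight R (pushJump i η) ≤ R ^ N * expWeight R η := by
  rw [expWeight, expWeight, ← pow_add]
  refine pow_le_pow_right₀ hR ?_
  have : N + ∑ i, (η i).natAbs = ∑ i, (1 + (η i).natAbs) := by
    rw [Finset.sum_add_distrib]; simp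
  rw [this]
  refine Finset.sum_le_sum fun j _ => ?_
  simp only [pushJump]
  split_ifs
  · simp only [jumpRight, Function.update_apply]
    split_ifs with h
    · subst h; omega
    · omega
  · simp only [pushLeft]
    split_ifs <;> omega

variable {v : ℕ → ℝ} (hv : ∀ n, 1 ≤ n → 0 < v n) {a b : ℝ → ℝ}
  (ha : ContDiffOn ℝ (⊤ : ℕ∞) a (Set.Ici 0)) (hb : ContDiffOn ℝ (⊤ : ℕ∞) b (Set.Ici 0))
  (ha_mono : MonotoneOn a (Set.Ici 0)) (hb_mono : MonotoneOn b (Set.Ici 0))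
include hv ha hb ha_mono hb_mono

lemma exists_rate_bound {s : ℝ} (hs : 0 ≤ s) (T : ℝ) : ∃ Λ, 0 ≤ Λ ∧ ∀ u ∈ Set.Icc s T,
    ∀ (i : Fin N × Bool) η, 0 ≤ pushRate v a b u i η ∧ pushRate v a b u i η ≤ Λ := by
  have hcd : ∀ {f : ℝ → ℝ}, ContDiffOn ℝ (⊤ : ℕ∞) f (Set.Ici 0) →
      ∃ C, ∀ u ∈ Set.Icc s T, derivWithin f (Set.Ici 0) u ≤ C := fun {f} hf => by
    have h1 : ContinuousOn (derivWithin f (Set.Ici 0)) (Set.Icc s T) :=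
      (hf.continuousOn_derivWithin (uniqueDiffOn_Ici 0) (by simp)).mono
        fun u hu => hs.trans hu.1
    obtain ⟨C, hC⟩ := isCompact_Icc.exists_bound_of_continuousOn h1
    exact ⟨C, fun u hu => (le_abs_self _).trans (hC u hu)⟩
  obtain ⟨A, hA⟩ := hcd ha
  obtain ⟨B, hB⟩ := hcd hb
  have hA0 : ∀ u, 0 ≤ derivWithin a (Set.Ici 0) u := fun u => ha_mono.derivWithin_nonneg
  have hB0 : ∀ u, 0 ≤ derivWithin b (Set.Ici 0) u := fun u => hb_mono.derivWithin_nonneg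
  refine ⟨∑ k : Fin N, (|A| * v (k + 1) + |B| / v (k + 1)), Finset.sum_nonneg fun k _ => ?_,
    fun u hu i η => ?_⟩
  · have := hv (k + 1) (by omega)
    positivity
  have hvi := hv (i.1 + 1) (by omega)
  have h1 : |A| * v (i.1 + 1) + |B| / v (i.1 + 1) ≤
      ∑ k : Fin N, (|A| * v (k + 1) + |B| / v (k + 1)) :=
    Finset.single_le_sum (f := fun k : Fin N => |A| * v (k + 1) + |B| / v (k + 1))
      (fun k _ => by have := hv (k + 1) (by omega); positivity) (Finset.mem_univ i.1)
  have h2 : 0 ≤ |A| * v (i.1 + 1) := by positivity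
  have h3 : 0 ≤ |B| / v (i.1 + 1) := by positivity
  have h4 : derivWithin a (Set.Ici 0) u * v (i.1 + 1) ≤ |A| * v (i.1 + 1) :=
    mul_le_mul_of_nonneg_right ((hA u hu).trans (le_abs_self A)) hvi.le
  have h5 : derivWithin b (Set.Ici 0) u / v (i.1 + 1) ≤ |B| / v (i.1 + 1) :=
    div_le_div_of_nonneg_right ((hB u hu).trans (le_abs_self B)) hvi.le
  have h6 := mul_nonneg (hA0 u) hvi.le
  have h7 := div_nonneg (hB0 u) hvi.le
  simp only [pushRate]
  split_ifs <;> constructor <;> linarith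

variable {p : ℝ → ℝ → (Fin N → ℤ) → (Fin N → ℤ) → ℝ} (hp : IsTransitionFunction v a b p)
include hp

lemma IsTransitionFunction.isMasterSolution {s T : ℝ} (hs : 0 ≤ s) {η : Fin N → ℤ}
    (hη : StrictAnti η) :
    ∃ Λ, 0 ≤ Λ ∧ IsMasterSolution pushJump (pushRate v a b) Λ s T (fun u => p s u η) := by
  obtain ⟨Λ, hΛ, h⟩ := exists_rate_bound (N := N) hv ha hb ha_mono hb_mono hs T
  refine ⟨Λ, hΛ, fun u hu i ξ => (h u hu i ξ).1, fun u hu i ξ => (h u hu i ξ).2,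
    fun u hu ζ => hp.nonneg s u η ζ hs hu.1 hη, fun u hu => hp.hasSum_one s u η hs hu.1 hη,
    fun ζ u hu => ?_, fun u hu ζ => ?_⟩
  · exact (hp.forward s u η ζ hs hu.1 hη).continuousWithinAt.mono fun x hx => hx.1
  · have := (hp.forward s u η ζ hs hu.1.le hη).hasDerivAt (Ici_mem_nhds hu.1)
    rwa [generator_eq_jumpGen] at this

open Classical in
/-- Only genuine configurations are reached. -/
lemma IsTransitionFunction.eq_zero {s T : ℝ} (hs : 0 ≤ s) (hsT : s ≤ T) {η ζ : Fin N → ℤ}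
    (hη : StrictAnti η) (hζ : ¬ StrictAnti ζ) : p s T η ζ = 0 := by
  obtain ⟨Λ, hΛ, hP⟩ := hp.isMasterSolution hv ha hb ha_mono hb_mono (T := T) hs hη
  have hT := Set.right_mem_Icc.2 hsT
  set H : (Fin N → ℤ) → ℝ := fun ξ => if StrictAnti ξ then 1 else 0 with hH
  have hH0 : ∀ ξ, 0 ≤ H ξ := fun ξ => by simp only [hH]; split_ifs <;> norm_num
  have hH1 : ∀ ξ, H ξ ≤ 1 := fun ξ => by simp only [hH]; split_ifs <;> norm_num
  have hHn : ∀ ξ, ‖H ξ‖ ≤ 1 * 1 := fun ξ => by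
    rw [Real.norm_eq_abs, abs_of_nonneg (hH0 ξ), mul_one]; exact hH1 ξ
  have hP1 : Summable fun ζ => p s T η ζ * 1 := by
    simpa using (hP.hasSum _ hT).summable
  set F : ℝ → ℝ := fun u => ∑' ζ, p s u η ζ • H ζ with hF
  have hFc : ContinuousOn F (Set.Icc s T) := hP.continuousOn_tsum (H := fun _ => H) hΛ hP1
    (fun ζ => continuousOn_const) (fun u _ => hHn)
  have hFd : ∀ u ∈ Set.Ioo s T,
      HasDerivAt F (∑' ζ, p s u η ζ • (0 + jumpGen pushJump (pushRate v a b u) H ζ)) u :=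
    fun u hu => hP.hasDerivAt_tsum (H := fun _ => H) (H' := fun _ _ => 0) (w := fun _ => 1)
      (K := 1) (C := 1) hΛ (fun _ => zero_le_one) (fun _ _ => by norm_num)
      hP1 (fun u _ => hHn) (fun u _ ζ => by simp) (fun u _ ζ => hasDerivAt_const _ _) hu
  -- From a strictly decreasing configuration every jump of positive rate leads to another one. The
  -- probability of this set is therefore nondecreasing in time; starting from 1 it stays 1, and
  -- nothing is left for other configurations.
  have hgen : ∀ u ∈ Set.Icc s T, ∀ ζ, 0 ≤ jumpGen pushJump (pushRate v a b u) H ζ := by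
    intro u hu ξ
    refine Finset.sum_nonneg fun i _ => ?_
    rw [smul_eq_mul]
    have h1 := hP.rate_nonneg u hu i ξ
    by_cases hξ : StrictAnti ξ
    · by_cases hJ : StrictAnti (pushJump i ξ)
      · simp [hH, hξ, hJ]
      · simp only [pushJump] at hJ
        split_ifs at hJ with hi
        · have h2 : ¬ ∀ j, ξ j ≠ ξ i.1 + 1 := fun h2 => hJ (strictAnti_jumpRight hξ h2)
          simp [pushRate, hi, h2]
        · exact absurd (strictAnti_pushLeft hξ _) hJ
    · have : H ξ = 0 := by simp [hH, hξ]
      rw [this, sub_zero]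
      exact mul_nonneg h1 (hH0 _)
  have hmono : MonotoneOn F (Set.Icc s T) := by
    refine monotoneOn_of_deriv_nonneg (convex_Icc _ _) hFc ?_ ?_
    · rw [interior_Icc]
      exact fun u hu => (hFd u hu).differentiableAt.differentiableWithinAt
    · rw [interior_Icc]
      intro u hu
      have hu' := Set.Ioo_subset_Icc_self hu
      rw [(hFd u hu).deriv]
      refine tsum_nonneg fun ζ => ?_
      rw [zero_add]
      exact mul_nonneg (hP.nonneg u hu' ζ) (hgen u hu' ζ)
  have h1 := hmono (Set.left_mem_Icc.2 hsT) hT hsT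
  have h2 : F s = 1 := by
    rw [hF]
    beta_reduce
    rw [tsum_smul_eq_of_init (fun ζ => hp.initial s η ζ hs hη)]
    simp [hH, hη]
  rw [h2] at h1
  by_contra hne
  have hpos : 0 < p s T η ζ := lt_of_le_of_ne (hP.nonneg T hT ζ) (Ne.symm hne)
  have h3 : F T < 1 := by
    rw [← (hP.hasSum T hT).tsum_eq]
    have hle : ∀ ξ, p s T η ξ • H ξ ≤ p s T η ξ := fun ξ =>
      mul_le_of_le_one_right (hP.nonneg T hT ξ) (hH1 ξ)
    refine Summable.tsum_lt_tsum (i := ζ) hle ?_ ?_ (hP.hasSum T hT).summable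
    · simp [hH, hζ, hpos]
    · exact Summable.of_nonneg_of_le (fun ξ => mul_nonneg (hP.nonneg T hT ξ) (hH0 ξ)) hle
        (hP.hasSum T hT).summable
  linarith

/-- The expectation of a solution of the backward equation. -/
theorem IsTransitionFunction.tsum_eq {s T : ℝ} (hs : 0 ≤ s) (hsT : s ≤ T) {η : Fin N → ℤ}
    (hη : StrictAnti η) {H H' : ℝ → (Fin N → ℤ) → ℂ} {R C : ℝ} (hR : 1 ≤ R)
    (hHc : ∀ ζ, ContinuousOn (fun u => H u ζ) (Set.Icc s T))
    (hH : ∀ u ∈ Set.Icc s T, ∀ ζ, ‖H u ζ‖ ≤ C * expWeight R ζ)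
    (hH' : ∀ u ∈ Set.Ioo s T, ∀ ζ, ‖H' u ζ‖ ≤ C * expWeight R ζ)
    (hHd : ∀ u ∈ Set.Ioo s T, ∀ ζ, HasDerivAt (fun u => H u ζ) (H' u ζ) u)
    (hback : ∀ u ∈ Set.Ioo s T, ∀ ζ, StrictAnti ζ →
      H' u ζ + jumpGen pushJump (pushRate v a b u) (H u) ζ = 0) :
    ∑' ζ, p s T η ζ • H T ζ = H s η := by
  obtain ⟨Λ, hΛ, hP⟩ := hp.isMasterSolution hv ha hb ha_mono hb_mono (T := T) hs hη
  have hi := fun ζ => hp.initial s η ζ hs hη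
  have hw := hP.summable_weight hsT hΛ hi (expWeight_nonneg hR) (one_le_pow₀ hR)
    (expWeight_pushJump hR)
  rw [← tsum_smul_eq_of_init hi (H s)]
  refine eq_of_deriv_zero (F := fun u => ∑' ζ, p s u η ζ • H u ζ) hsT
    (hP.continuousOn_tsum hΛ hw hHc hH) fun u hu => ?_
  have h1 := hP.hasDerivAt_tsum hΛ (expWeight_nonneg hR) (expWeight_pushJump hR) hw hH hH' hHd hu
  convert h1 using 1
  symm
  rw [← tsum_zero]
  refine tsum_congr fun ζ => ?_
  -- The backward equation is available only on strictly decreasing configurations; the others carry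
  -- no mass.
  by_cases hζ : StrictAnti ζ
  · rw [hback u hu ζ hζ, smul_zero]
  · rw [hp.eq_zero hv ha hb ha_mono hb_mono hs hu.1.le hη hζ, zero_smul]

end

/-! ### Estimates and derivatives of convolutions and determinants -/

lemma HasLaurent.norm_coeff_le {r B : ℝ} (hr : 0 < r) {g : ℂ → ℂ} {c : ℤ → ℂ}
    (h : HasLaurent r g c) (hB : ∀ z, ‖z‖ = r → ‖g z‖ ≤ B) (k : ℤ) : ‖c k‖ ≤ B * r ^ (-k) := by
  rw [← h.coeff hr k, ← smul_eq_mul]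
  refine (circleIntegral.norm_two_pi_i_inv_smul_integral_le_of_norm_le_const
    (C := r ^ (-k - 1) * B) hr.le fun z hz => ?_).trans_eq ?_
  · have hz' : ‖z‖ = r := by simpa using hz
    rw [norm_mul, norm_zpow, hz']
    exact mul_le_mul_of_nonneg_left (hB z hz') (zpow_pos hr _).le
  · rw [zpow_sub_one₀ hr.ne']
    field_simp

lemma Wt.norm_conv_le {r B : ℝ} (hr : 0 < r) {f c : ℤ → ℂ} (hf : Wt r f)
    (hc : ∀ k, ‖c k‖ ≤ B * r ^ (-k)) (n : ℤ) :
    ‖conv f c n‖ ≤ (∑' k, ‖f k‖ * r ^ k) * (B * r ^ (-n)) := by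
  refine tsum_of_norm_bounded (hf.hasSum.mul_right (B * r ^ (-n))) fun k => ?_
  rw [norm_mul]
  calc ‖f k‖ * ‖c (n - k)‖ ≤ ‖f k‖ * (B * r ^ (-(n - k))) :=
        mul_le_mul_of_nonneg_left (hc _) (norm_nonneg _)
    _ = _ := by
      rw [neg_sub, sub_eq_add_neg, zpow_add₀ hr.ne']; ring

lemma norm_expc_le {r : ℝ} (hr : 0 < r) (A B : ℂ) (k : ℤ) :
    ‖expc A B k‖ ≤ Real.exp (‖A‖ / r + ‖B‖ * r) * r ^ (-k) := by
  refine (hasLaurent_expc A B hr).norm_coeff_le hr (fun z hz => ?_) k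
  refine (Complex.norm_exp_le_exp_norm _).trans (Real.exp_le_exp.2 ?_)
  refine (norm_add_le _ _).trans_eq ?_
  rw [norm_div, norm_mul, hz]

lemma hasLaurent_single (j : ℤ) {r : ℝ} : HasLaurent r (fun z => z ^ j) (Pi.single j 1) := by
  refine ⟨?_, fun z _ => ?_⟩
  · refine summable_of_ne_finset_zero (s := {j}) fun k hk => ?_
    have : k ≠ j := by simpa using hk
    simp [this]
  · convert hasSum_ite_eq j (z ^ j) using 2 with k
    by_cases h : k = j
    · subst h; simp
    · simp [h]

lemma conv_single_left (j : ℤ) (f : ℤ → ℂ) (n : ℤ) : conv (Pi.single j 1) f n = f (n - j) := by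
  rw [conv, tsum_eq_single j]
  · simp
  · intro k hk
    simp [hk]

/-- First order expansion of the exponential factor. -/
lemma Wt.norm_conv_expc_sub_le {r : ℝ} (hr : 0 < r) {g : ℤ → ℂ} (hg : Wt r g) (y : ℤ) :
    ∃ C, ∀ δ ε : ℂ, ‖δ‖ / r + ‖ε‖ * r ≤ 1 →
      ‖conv g (expc δ ε) y - g y - (δ * g (y + 1) + ε * g (y - 1))‖ ≤
        C * (‖δ‖ / r + ‖ε‖ * r) ^ 2 := by
  refine ⟨(∑' k, ‖g k‖ * r ^ k) * r ^ (-y), fun δ ε h => ?_⟩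
  set e : ℤ → ℂ := Pi.single 0 1 + (δ • Pi.single (-1) 1 + ε • Pi.single 1 1) with he
  have hs : ∀ j : ℤ, Wt r (Pi.single j 1) := fun j => (hasLaurent_single j).summable
  have hLe : HasLaurent r (fun z => 1 + (δ * z ^ (-1 : ℤ) + ε * z ^ (1 : ℤ))) e :=
    (hasLaurent_one r).add hr
      (((hasLaurent_single (-1)).smul δ).add hr ((hasLaurent_single 1).smul ε))
  set c : ℤ → ℂ := expc δ ε + (-1 : ℂ) • e with hc
  have hLc : HasLaurent r (fun z => Complex.exp (δ / z + ε * z) - 1 - (δ / z + ε * z)) c :=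
    ((hasLaurent_expc δ ε hr).add hr (hLe.smul (-1))).congr fun z _ => by
      simp only [zpow_neg, zpow_one, div_eq_mul_inv]; ring
  -- Cauchy's estimate for e^w - 1 - w, which is at most |w|² for |w| ≤ 1, with w = δ/z + ε z on the
  -- circle.
  have hcb : ∀ k, ‖c k‖ ≤ (‖δ‖ / r + ‖ε‖ * r) ^ 2 * r ^ (-k) := by
    refine hLc.norm_coeff_le hr fun z hz => ?_
    have h1 : ‖δ / z + ε * z‖ ≤ ‖δ‖ / r + ‖ε‖ * r := by
      refine (norm_add_le _ _).trans_eq ?_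
      rw [norm_div, norm_mul, hz]
    exact (Complex.norm_exp_sub_one_sub_id_le (h1.trans h)).trans
      (pow_le_pow_left₀ (norm_nonneg _) h1 2)
  have h1 : conv g (expc δ ε) y - g y - (δ * g (y + 1) + ε * g (y - 1)) = conv g c y := by
    have h2 : expc δ ε = c + e := by rw [hc]; simp
    have hwe := hLe.summable
    have hwc := hLc.summable
    rw [h2, conv_comm, hwc.conv_add hr hwe hg, conv_comm c, he,
      (hs 0).conv_add hr (((hs (-1)).smul δ).add hr ((hs 1).smul ε)) hg,
      ((hs (-1)).smul δ).conv_add hr ((hs 1).smul ε) hg, conv_smul_left, conv_smul_left]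
    simp only [Pi.add_apply, Pi.smul_apply, conv_single_left, smul_eq_mul, sub_zero, sub_neg_eq_add]
    ring
  rw [h1]
  refine (hg.norm_conv_le hr hcb y).trans_eq ?_
  ring

/-- Differentiating e^{A/z+Bz} multiplies it by A'/z + B'z, which on coefficients is a combination
of the two unit shifts. The semigroup law reduces the claim to small exponents, where the remainder
is quadratic. -/
lemma Wt.hasDerivWithinAt_conv_expc {r : ℝ} (hr : 0 < r) {g : ℤ → ℂ} (hg : Wt r g) (y : ℤ)
    {A B : ℝ → ℂ} {A' B' : ℂ} {S : Set ℝ} {u : ℝ} (hA : HasDerivWithinAt A A' S u)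
    (hB : HasDerivWithinAt B B' S u) :
    HasDerivWithinAt (fun u => conv g (expc (A u) (B u)) y)
      (A' * conv g (expc (A u) (B u)) (y + 1) + B' * conv g (expc (A u) (B u)) (y - 1)) S u := by
  set G := conv g (expc (A u) (B u)) with hG
  have hGw : Wt r G := hg.convolve hr (wt_expc _ _ hr)
  obtain ⟨C, hC⟩ := hGw.norm_conv_expc_sub_le hr y
  set δ : ℝ → ℂ := fun x => A x - A u with hδ
  set ε : ℝ → ℂ := fun x => B x - B u with hε
  have hshift : ∀ x, conv g (expc (A x) (B x)) y = conv G (expc (δ x) (ε x)) y := fun x => by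
    rw [hG, hg.conv_assoc hr (wt_expc _ _ hr) (wt_expc _ _ hr), conv_expc_expc]
    simp [hδ, hε]
  set ρ : ℝ → ℂ := fun x => conv G (expc (δ x) (ε x)) y - G y -
    (δ x * G (y + 1) + ε x * G (y - 1)) with hρ
  have hρ0 : ρ u = 0 := by
    simp [hρ, hδ, hε, conv_expc_zero]
  set q : ℝ → ℝ := fun x => ‖δ x‖ / r + ‖ε x‖ * r with hq
  have hδO : δ =O[𝓝[S] u] fun x => x - u := hA.hasFDerivWithinAt.isBigO_sub
  have hεO : ε =O[𝓝[S] u] fun x => x - u := hB.hasFDerivWithinAt.isBigO_sub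
  have hqO : q =O[𝓝[S] u] fun x => x - u := by
    have h1 := hδO.norm_left.const_mul_left r⁻¹
    have h2 := hεO.norm_left.const_mul_left r
    refine (h1.add h2).congr_left fun x => ?_
    simp only [hq]; ring
  have hlim : Tendsto (fun x => x - u) (𝓝[S] u) (𝓝 0) := by
    have : Tendsto (fun x : ℝ => x - u) (𝓝 u) (𝓝 (u - u)) := tendsto_id.sub tendsto_const_nhds
    rw [sub_self] at this
    exact this.mono_left nhdsWithin_le_nhds
  have hq0 : Tendsto q (𝓝[S] u) (𝓝 0) := hqO.trans_tendsto hlim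
  have hρO : ρ =O[𝓝[S] u] fun x => q x ^ 2 := by
    refine Asymptotics.IsBigO.of_bound C ?_
    filter_upwards [hq0.eventually_le_const one_pos] with x hx
    refine (hC (δ x) (ε x) hx).trans_eq ?_
    simp only [norm_pow, Real.norm_eq_abs, sq_abs, hq]
  have hρo : ρ =o[𝓝[S] u] fun x => x - u :=
    hρO.trans_isLittleO ((hqO.norm_right.pow 2).trans_isLittleO
      ((Asymptotics.isLittleO_pow_sub_sub u one_lt_two).mono nhdsWithin_le_nhds))
  have hρd : HasDerivWithinAt ρ 0 S u := by
    rw [hasDerivWithinAt_iff_isLittleO]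
    simpa [hρ0] using hρo
  have hlin : HasDerivWithinAt (fun x => G y + (δ x * G (y + 1) + ε x * G (y - 1)))
      (A' * G (y + 1) + B' * G (y - 1)) S u :=
    (((hA.sub_const _).mul_const _).add ((hB.sub_const _).mul_const _)).const_add _
  refine ((hlin.add hρd).congr_deriv (add_zero _)).congr (fun x _ => ?_) ?_
  · simp only [hshift, hρ, Pi.add_apply]; ring
  · simp only [hshift, hρ, Pi.add_apply]; ring

lemma hasDerivWithinAt_det {n : ℕ} {M : ℝ → Matrix (Fin n) (Fin n) ℂ}
    {M' : Matrix (Fin n) (Fin n) ℂ} {S : Set ℝ} {u : ℝ}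
    (h : ∀ i j, HasDerivWithinAt (fun x => M x i j) (M' i j) S u) :
    HasDerivWithinAt (fun x => (M x).det)
      (∑ l, ((M u).updateCol l fun k => M' k l).det) S u := by
  simp only [Matrix.det_apply]
  rw [Finset.sum_comm]
  refine HasDerivWithinAt.fun_sum fun σ _ => ?_
  rw [← Finset.smul_sum]
  refine HasDerivWithinAt.const_smul _ ?_
  refine (HasDerivWithinAt.fun_finsetProd fun i _ => h (σ i) i).congr_deriv ?_
  refine Finset.sum_congr rfl fun i _ => ?_
  rw [← Finset.mul_prod_erase _ _ (Finset.mem_univ i), Matrix.updateCol_self, smul_eq_mul, mul_comm]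
  congr 1
  refine Finset.prod_congr rfl fun j hj => ?_
  rw [Matrix.updateCol_ne (Finset.ne_of_mem_erase hj)]

lemma norm_det_le_of_col {n : ℕ} {M : Matrix (Fin n) (Fin n) ℂ} {c : Fin n → ℝ}
    (h : ∀ i j, ‖M i j‖ ≤ c j) : ‖M.det‖ ≤ n.factorial * ∏ j, c j := by
  rw [Matrix.det_apply]
  refine (norm_sum_le _ _).trans ?_
  calc _ ≤ ∑ σ : Equiv.Perm (Fin n), ∏ j, c j := by
        refine Finset.sum_le_sum fun σ _ => ?_
        rcases Int.units_eq_one_or (Equiv.Perm.sign σ) with hσ | hσ <;>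
        · rw [hσ]
          simp only [one_smul, Units.neg_smul, norm_neg, norm_prod]
          exact Finset.prod_le_prod (fun _ _ => norm_nonneg _) fun i _ => h _ _
    _ = _ := by
      rw [Finset.sum_const, Finset.card_univ, Fintype.card_perm, Fintype.card_fin, nsmul_eq_mul]

/-! ### Backward functions: boundary relation, time derivative and growth -/

/-- Determinants of functions with a relation between consecutive columns. -/
noncomputable def detFun (v : ℕ → ℝ) (n : ℕ) (F : ℕ → ℤ → ℂ) (A B : ℂ) (η : ℕ → ℤ) : ℂ :=
  Matrix.det (Matrix.of fun k l : Fin n =>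
    conv (DD v (Finset.Ioc (l + 1) n) (F k)) (expc A B) (η l))

/-- The product factor of the backward functions. -/
noncomputable def pref (v : ℕ → ℝ) (y : ℕ → ℤ) (n : ℕ) (A B : ℂ) (η : ℕ → ℤ) : ℂ :=
  ∏ l ∈ Finset.range n, (v (l + 1) : ℂ) ^ (y (l + 1) - η l) *
    Complex.exp (v (l + 1) * A + B / v (l + 1))

/-- Solutions of the backward equation. -/
noncomputable def backFun (v : ℕ → ℝ) (y : ℕ → ℤ) (n : ℕ) (F : ℕ → ℤ → ℂ) (A₀ B₀ A B : ℂ)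
    (η : ℕ → ℤ) : ℂ := pref v y n A B η * detFun v n F (A₀ - A) (B₀ - B) η

section
variable {v : ℕ → ℝ} {y : ℕ → ℤ} {n : ℕ} {F : ℕ → ℤ → ℂ} {A₀ B₀ A B : ℂ}

lemma detFun_update {m : ℕ} (hm : m < n) (η : ℕ → ℤ) (x : ℤ) :
    detFun v n F A B (Function.update η m x) =
      ((Matrix.of fun k l : Fin n =>
        conv (DD v (Finset.Ioc (l + 1) n) (F k)) (expc A B) (η l)).updateCol ⟨m, hm⟩
        fun k => conv (DD v (Finset.Ioc (m + 1) n) (F k)) (expc A B) x).det := by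
  rw [detFun]
  congr 1
  ext k l
  by_cases h : l = ⟨m, hm⟩
  · subst h; simp
  · have : (l : ℕ) ≠ m := fun h' => h (Fin.ext h')
    rw [Matrix.updateCol_ne h, Matrix.of_apply, Matrix.of_apply, Function.update_of_ne this]

lemma detFun_congr {η η' : ℕ → ℤ} (h : ∀ l < n, η l = η' l) :
    detFun v n F A B η = detFun v n F A B η' := by
  rw [detFun, detFun]
  congr 1
  ext k l
  rw [Matrix.of_apply, Matrix.of_apply, h l l.2]

lemma pref_congr {η η' : ℕ → ℤ} (h : ∀ l < n, η l = η' l) :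
    pref v y n A B η = pref v y n A B η' :=
  Finset.prod_congr rfl fun l hl => by rw [h l (Finset.mem_range.1 hl)]

lemma backFun_congr {η η' : ℕ → ℤ} (h : ∀ l < n, η l = η' l) :
    backFun v y n F A₀ B₀ A B η = backFun v y n F A₀ B₀ A B η' := by
  rw [backFun, backFun, detFun_congr h, pref_congr h]

lemma backFun_update_of_le {m : ℕ} (hm : n ≤ m) (η : ℕ → ℤ) (x : ℤ) :
    backFun v y n F A₀ B₀ A B (Function.update η m x) = backFun v y n F A₀ B₀ A B η :=
  backFun_congr fun l hl => Function.update_of_ne (by omega) _ _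

lemma pref_eq (η : ℕ → ℤ) : pref v y n A B η =
    (∏ l ∈ Finset.range n, (v (l + 1) : ℂ) ^ (y (l + 1) - η l)) *
      Complex.exp (∑ l ∈ Finset.range n, (v (l + 1) * A + B / v (l + 1))) := by
  rw [pref, Finset.prod_mul_distrib, Complex.exp_sum]

variable (hv : ∀ n, 1 ≤ n → 0 < v n)
include hv

lemma pref_update {m : ℕ} (hm : m < n) (η : ℕ → ℤ) (d : ℤ) :
    pref v y n A B (Function.update η m (η m + d)) =
      (v (m + 1) : ℂ) ^ (-d) * pref v y n A B η := by
  have hne : (v (m + 1) : ℂ) ≠ 0 := by exact_mod_cast (hv (m + 1) (by omega)).ne'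
  have hmem := Finset.mem_range.2 hm
  rw [pref, pref, ← Finset.mul_prod_erase _ _ hmem, ← Finset.mul_prod_erase (Finset.range n) _ hmem,
    Function.update_self, show y (m + 1) - (η m + d) = -d + (y (m + 1) - η m) by ring,
    zpow_add₀ hne, mul_assoc, mul_assoc, mul_assoc]
  congr 3
  refine Finset.prod_congr rfl fun l hl => ?_
  rw [Function.update_of_ne (Finset.ne_of_mem_erase hl)]

/-- The boundary relation. -/
lemma backFun_relation {ρ : ℝ} (hρ : 0 < ρ) (hF : ∀ k < n, Wt ρ (F k)) {l : ℕ} {η : ℕ → ℤ}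
    (h : η l = η (l + 1) + 1) :
    backFun v y n F A₀ B₀ A B (Function.update η (l + 1) (η (l + 1) + 1)) =
      backFun v y n F A₀ B₀ A B η := by
  rcases le_or_gt n (l + 1) with hl | hl
  · exact backFun_update_of_le hl _ _
  rw [backFun, backFun, pref_update hv hl, detFun_update hl]
  set M : Matrix (Fin n) (Fin n) ℂ := Matrix.of fun k l : Fin n =>
    conv (DD v (Finset.Ioc (l + 1) n) (F k)) (expc (A₀ - A) (B₀ - B)) (η l) with hM
  have hne : (v (l + 1 + 1) : ℂ) ≠ 0 := by exact_mod_cast (hv (l + 1 + 1) (by omega)).ne'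
  -- Column l carries one factor more, 1 - v_{l+2} T, than column l + 1. At adjacent positions the
  -- shifted column l + 1 is thus column l plus v_{l+2} times the unshifted column l + 1; the former
  -- drops out of the determinant and the factor v_{l+2} cancels against the prefactor.
  have hcol : (fun k : Fin n => conv (DD v (Finset.Ioc (l + 1 + 1) n) (F k))
      (expc (A₀ - A) (B₀ - B)) (η (l + 1) + 1)) =
      (fun k => M k ⟨l, by omega⟩) + (v (l + 1 + 1) : ℂ) • fun k => M k ⟨l + 1, hl⟩ := by
    funext k
    simp only [hM, Matrix.of_apply, Pi.add_apply, Pi.smul_apply, smul_eq_mul]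
    rw [DD_Ioc v (Nat.le_succ (l + 1)) (Nat.succ_le_of_lt hl),
      ← ((hF k k.2).DD hρ v _).DD_conv hρ (wt_expc _ _ hρ),
      Nat.Ioc_succ_singleton, DD_singleton, h]
    simp
  rw [hcol, Matrix.det_updateCol_add, Matrix.det_updateCol_smul,
    Matrix.det_updateCol_eq_zero (by simp), Matrix.updateCol_eq_self, zero_add]
  have : detFun v n F (A₀ - A) (B₀ - B) η = M.det := rfl
  rw [this, zpow_neg, zpow_one]
  field_simp

/-- The derivative of the determinant moves one column at a time, with coefficients -α and -β; the
powers of v in the prefactor turn these into the rates α v and β / v. The derivative of the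
exponentials in the prefactor supplies the diagonal terms, so the result is minus the generator of
independent walks. -/
lemma backFun_hasDerivWithinAt {ρ : ℝ} (hρ : 0 < ρ) (hF : ∀ k < n, Wt ρ (F k)) {a b : ℝ → ℝ}
    {α β : ℝ} {S : Set ℝ} {u : ℝ} (ha : HasDerivWithinAt a α S u) (hb : HasDerivWithinAt b β S u)
    (η : ℕ → ℤ) :
    HasDerivWithinAt (fun x => backFun v y n F A₀ B₀ (a x) (b x) η)
      (-∑ l ∈ Finset.range n,
        ((α * v (l + 1) : ℝ) • (backFun v y n F A₀ B₀ (a u) (b u) (Function.update η l (η l + 1)) -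
          backFun v y n F A₀ B₀ (a u) (b u) η) +
        (β / v (l + 1) : ℝ) • (backFun v y n F A₀ B₀ (a u) (b u) (Function.update η l (η l - 1)) -
          backFun v y n F A₀ B₀ (a u) (b u) η))) S u := by
  have haC : HasDerivWithinAt (fun x => (a x : ℂ)) α S u := ha.ofReal_comp
  have hbC : HasDerivWithinAt (fun x => (b x : ℂ)) β S u := hb.ofReal_comp
  have hpref : HasDerivWithinAt (fun x => pref v y n (a x) (b x) η)
      (pref v y n (a u) (b u) η * ∑ l ∈ Finset.range n, ((v (l + 1) : ℂ) * α + β / v (l + 1)))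
      S u := by
    simp only [pref_eq, mul_assoc]
    refine HasDerivWithinAt.const_mul _ (HasDerivWithinAt.cexp (HasDerivWithinAt.fun_sum
      fun l _ => (haC.const_mul _).add (hbC.div_const _)))
  set M : ℝ → Matrix (Fin n) (Fin n) ℂ := fun x => Matrix.of fun k l : Fin n =>
    conv (DD v (Finset.Ioc (l + 1) n) (F k)) (expc (A₀ - a x) (B₀ - b x)) (η l) with hM
  set dp : ℤ → ℕ → ℂ := fun d l => detFun v n F (A₀ - a u) (B₀ - b u)
    (Function.update η l (η l + d)) with hdp
  have hdet : HasDerivWithinAt (fun x => detFun v n F (A₀ - a x) (B₀ - b x) η)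
      (∑ l ∈ Finset.range n, (-α * dp 1 l + -β * dp (-1) l)) S u := by
    have h1 := hasDerivWithinAt_det (M := M) (S := S) (u := u) (M' := Matrix.of fun k l : Fin n =>
      -(α : ℂ) * conv (DD v (Finset.Ioc (l + 1) n) (F k)) (expc (A₀ - a u) (B₀ - b u)) (η l + 1) +
      -(β : ℂ) * conv (DD v (Finset.Ioc (l + 1) n) (F k)) (expc (A₀ - a u) (B₀ - b u)) (η l - 1))
      fun k l => ((hF k k.2).DD hρ v _).hasDerivWithinAt_conv_expc hρ (η l)
        (haC.const_sub A₀) (hbC.const_sub B₀)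
    refine h1.congr_deriv ?_
    rw [Finset.sum_range]
    refine Finset.sum_congr rfl fun l _ => ?_
    simp only [hdp]
    rw [detFun_update l.2, detFun_update l.2]
    have e : (fun k : Fin n => (Matrix.of fun k l : Fin n =>
      -(α : ℂ) * conv (DD v (Finset.Ioc (l + 1) n) (F k)) (expc (A₀ - a u) (B₀ - b u)) (η l + 1) +
      -(β : ℂ) * conv (DD v (Finset.Ioc (l + 1) n) (F k)) (expc (A₀ - a u) (B₀ - b u)) (η l - 1))
        k l) = ((-(α : ℂ)) • fun k : Fin n => conv (DD v (Finset.Ioc (l + 1) n) (F k))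
          (expc (A₀ - a u) (B₀ - b u)) (η l + 1)) +
        ((-(β : ℂ)) • fun k : Fin n => conv (DD v (Finset.Ioc (l + 1) n) (F k))
          (expc (A₀ - a u) (B₀ - b u)) (η l + -1)) := by
      funext k
      simp [sub_eq_add_neg]
    rw [e, Matrix.det_updateCol_add, Matrix.det_updateCol_smul, Matrix.det_updateCol_smul]
  refine (hpref.mul hdet).congr_deriv ?_
  have h2 : ∀ l ∈ Finset.range n, ((α * v (l + 1) : ℝ) • (backFun v y n F A₀ B₀ (a u) (b u)
      (Function.update η l (η l + 1)) - backFun v y n F A₀ B₀ (a u) (b u) η) +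
      (β / v (l + 1) : ℝ) • (backFun v y n F A₀ B₀ (a u) (b u) (Function.update η l (η l - 1)) -
          backFun v y n F A₀ B₀ (a u) (b u) η)) =
      -(pref v y n (a u) (b u) η * ((v (l + 1) : ℂ) * α + β / v (l + 1)) *
          detFun v n F (A₀ - a u) (B₀ - b u) η +
        pref v y n (a u) (b u) η * (-α * dp 1 l + -β * dp (-1) l)) := by
    intro l hl
    have hl' := Finset.mem_range.1 hl
    have hne : (v (l + 1) : ℂ) ≠ 0 := by exact_mod_cast (hv (l + 1) (by omega)).ne'
    rw [sub_eq_add_neg (η l) 1]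
    simp only [backFun, pref_update hv hl', hdp, neg_neg, zpow_neg, zpow_one, Complex.real_smul,
      Complex.ofReal_mul, Complex.ofReal_div]
    field_simp
    ring
  rw [Finset.sum_congr rfl h2, Finset.sum_neg_distrib, neg_neg, Finset.mul_sum,
    Finset.sum_mul, Finset.mul_sum, ← Finset.sum_add_distrib]

omit hv in
lemma zpow_le_pow_natAbs {x R : ℝ} (hx : 0 < x) (h1 : x ≤ R) (h2 : x⁻¹ ≤ R) (m : ℤ) :
    x ^ m ≤ R ^ m.natAbs := by
  rcases le_total 0 m with hm | hm
  · lift m to ℕ using hm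
    simpa using pow_le_pow_left₀ hx.le h1 m
  · obtain ⟨k, rfl⟩ : ∃ k : ℕ, m = -k := ⟨m.natAbs, by omega⟩
    rw [zpow_neg, ← inv_zpow, zpow_natCast, Int.natAbs_neg, Int.natAbs_natCast]
    exact pow_le_pow_left₀ (inv_pos.2 hx).le h2 k

/-- Both the powers of v in the prefactor and the Laurent coefficients in the columns grow at most
geometrically in the positions. Transition probabilities have such exponential moments
(`IsMasterSolution.summable_weight`), so Dynkin's formula applies. -/
lemma exists_backFun_bound {ρ : ℝ} (hρ : 0 < ρ) (hF : ∀ k < n, Wt ρ (F k)) (K : ℝ) :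
    ∃ R C, 1 ≤ R ∧ 0 ≤ C ∧ ∀ A B : ℂ, ‖A‖ ≤ K → ‖B‖ ≤ K → ∀ η,
      ‖backFun v y n F A₀ B₀ A B η‖ ≤ C * R ^ ∑ l ∈ Finset.range n, (η l).natAbs := by
  set V : ℝ := ∑ l ∈ Finset.range n, (v (l + 1) + (v (l + 1))⁻¹) with hV
  have hvp : ∀ l : ℕ, 0 < v (l + 1) := fun l => hv _ (by omega)
  have hVl : ∀ l ∈ Finset.range n, v (l + 1) + (v (l + 1))⁻¹ ≤ V := fun l hl =>
    Finset.single_le_sum (f := fun l => v (l + 1) + (v (l + 1))⁻¹)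
      (fun l _ => by have := hvp l; positivity) hl
  have hV0 : 0 ≤ V := Finset.sum_nonneg fun l _ => by have := hvp l; positivity
  set R₀ : ℝ := 1 + ρ + ρ⁻¹ + V with hR₀
  have hR1 : 1 ≤ R₀ := by have := inv_pos.2 hρ; linarith
  have hR0 : 0 ≤ R₀ := by linarith
  -- the entries of the determinant
  set KA : ℝ := Real.exp ((‖A₀‖ + K) / ρ + (‖B₀‖ + K) * ρ) with hKA
  set Q : ℝ := ∑ p ∈ Finset.range n ×ˢ Finset.range n,
    ∑' j, ‖DD v (Finset.Ioc (p.2 + 1) n) (F p.1) j‖ * ρ ^ j with hQ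
  have hQ0 : ∀ p ∈ Finset.range n ×ˢ Finset.range n,
      0 ≤ ∑' j, ‖DD v (Finset.Ioc (p.2 + 1) n) (F p.1) j‖ * ρ ^ j := fun p _ =>
    tsum_nonneg fun j => by positivity
  have hQn : 0 ≤ Q := Finset.sum_nonneg hQ0
  set P₀ : ℝ := ∏ l ∈ Finset.range n, v (l + 1) ^ y (l + 1) *
    Real.exp (v (l + 1) * |K| + |K| / v (l + 1)) with hP₀
  have hP₀0 : 0 ≤ P₀ := Finset.prod_nonneg fun l _ => by have := hvp l; positivity
  refine ⟨R₀ ^ 2, P₀ * (n.factorial * (Q * KA) ^ n), one_le_pow₀ hR1, by positivity,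
    fun A B hA hB η => ?_⟩
  have hpref : ‖pref v y n A B η‖ ≤ P₀ * R₀ ^ ∑ l ∈ Finset.range n, (η l).natAbs := by
    rw [pref, norm_prod, hP₀, ← Finset.prod_pow_eq_pow_sum, ← Finset.prod_mul_distrib]
    refine Finset.prod_le_prod (fun _ _ => norm_nonneg _) fun l hl => ?_
    have hvl := hvp l
    have h1 := hVl l hl
    have h3 := inv_pos.2 hvl
    have h4 := inv_pos.2 hρ
    have h2 : v (l + 1) ^ (-η l) ≤ R₀ ^ (η l).natAbs := by
      rw [← Int.natAbs_neg]
      exact zpow_le_pow_natAbs hvl (by linarith) (by linarith) _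
    have h5 : ‖Complex.exp (v (l + 1) * A + B / v (l + 1))‖ ≤
        Real.exp (v (l + 1) * |K| + |K| / v (l + 1)) := by
      refine (Complex.norm_exp_le_exp_norm _).trans (Real.exp_le_exp.2 ?_)
      refine (norm_add_le _ _).trans ?_
      rw [norm_mul, norm_div, Complex.norm_real, Real.norm_eq_abs, abs_of_pos hvl]
      have hA' := hA.trans (le_abs_self K)
      have hB' := hB.trans (le_abs_self K)
      gcongr
    rw [norm_mul, norm_zpow, Complex.norm_real, Real.norm_eq_abs, abs_of_pos hvl, sub_eq_add_neg,
      zpow_add₀ hvl.ne']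
    calc v (l + 1) ^ y (l + 1) * v (l + 1) ^ (-η l) * _
        ≤ v (l + 1) ^ y (l + 1) * R₀ ^ (η l).natAbs *
          Real.exp (v (l + 1) * |K| + |K| / v (l + 1)) := by gcongr
      _ = _ := by ring
  have hdet : ‖detFun v n F (A₀ - A) (B₀ - B) η‖ ≤
      n.factorial * (Q * KA) ^ n * R₀ ^ ∑ l ∈ Finset.range n, (η l).natAbs := by
    have h1 := norm_det_le_of_col (n := n) (M := Matrix.of fun k l : Fin n =>
      conv (DD v (Finset.Ioc (l + 1) n) (F k)) (expc (A₀ - A) (B₀ - B)) (η l))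
      (c := fun l => Q * KA * R₀ ^ (η l).natAbs) fun k l => by
        have hw := (hF k k.2).DD hρ v (Finset.Ioc ((l : ℕ) + 1) n)
        refine (hw.norm_conv_le hρ (norm_expc_le hρ (A₀ - A) (B₀ - B)) (η l)).trans ?_
        have e1 : Real.exp (‖A₀ - A‖ / ρ + ‖B₀ - B‖ * ρ) ≤ KA := by
          refine Real.exp_le_exp.2 ?_
          have e2 := (norm_sub_le A₀ A).trans (add_le_add_right hA ‖A₀‖)
          have e3 := (norm_sub_le B₀ B).trans (add_le_add_right hB ‖B₀‖)
          gcongr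
        have e4 : ρ ^ (-η l) ≤ R₀ ^ (η l).natAbs := by
          rw [← Int.natAbs_neg]
          have := inv_pos.2 hρ
          exact zpow_le_pow_natAbs hρ (by linarith) (by linarith) _
        have e5 : ∑' j, ‖DD v (Finset.Ioc ((l : ℕ) + 1) n) (F k) j‖ * ρ ^ j ≤ Q :=
          Finset.single_le_sum hQ0 (a := ((k : ℕ), (l : ℕ)))
            (Finset.mem_product.2 ⟨Finset.mem_range.2 k.2, Finset.mem_range.2 l.2⟩)
        rw [← mul_assoc]
        have e6 := Real.exp_pos (‖A₀ - A‖ / ρ + ‖B₀ - B‖ * ρ)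
        have e7 := zpow_pos hρ (-η l)
        exact mul_le_mul (mul_le_mul e5 e1 e6.le hQn) e4 e7.le (by positivity)
    refine h1.trans_eq ?_
    rw [Finset.prod_mul_distrib, Finset.prod_const, Finset.card_univ, Fintype.card_fin,
      Finset.prod_pow_eq_pow_sum, ← Finset.sum_range fun l => (η l).natAbs, mul_assoc]
  rw [backFun, norm_mul]
  refine (mul_le_mul hpref hdet (norm_nonneg _) (by positivity)).trans_eq ?_
  rw [← pow_mul, mul_comm 2, pow_mul, sq]
  ring

end

/-! ### From independent walks to PushASEP through the boundary relation -/

section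
variable {N : ℕ}

/-- Extension by zero of a configuration of `N` particles. -/
def ext (η : Fin N → ℤ) (l : ℕ) : ℤ := if h : l < N then η ⟨l, h⟩ else 0

lemma ext_apply (η : Fin N → ℤ) (k : Fin N) : ext η k = η k := by simp [ext]

lemma ext_update (η : Fin N → ℤ) (k : Fin N) (x : ℤ) :
    ext (Function.update η k x) = Function.update (ext η) k x := by
  funext l
  by_cases hl : l = k
  · subst hl; simp [ext]
  · rw [Function.update_of_ne hl, ext, ext]
    split_ifs with h
    · rw [Function.update_of_ne]
      intro h'
      exact hl (by rw [← h'])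
    · rfl

/-- Functions for which the motion of a blocked particle is invisible. -/
def BoundaryRelation (f : (Fin N → ℤ) → ℂ) : Prop :=
  ∀ (i j : Fin N) (η : Fin N → ℤ), (i : ℕ) + 1 = j → η i = η j + 1 →
    f (Function.update η j (η j + 1)) = f η

/-- The block is pushed one particle at a time. If all but the last pushed particle have moved, that
particle shares a site with its right neighbour, and the boundary relation says that moving it one
step left does not change `f`. The relation is thus used at unphysical configurations too. -/
lemma BoundaryRelation.pushLeft {f : (Fin N → ℤ) → ℂ} (hf : BoundaryRelation f) {η : Fin N → ℤ}
    (hη : StrictAnti η) (k : Fin N) :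
    f (pushLeft η k) = f (Function.update η k (η k - 1)) := by
  set σ : ℕ → Fin N → ℤ := fun m j =>
    if k ≤ j ∧ (j : ℕ) < m ∧ η j = η k - ((j : ℤ) - (k : ℤ)) then η j - 1 else η j with hσ
  have h0 : σ (k + 1) = Function.update η k (η k - 1) := by
    funext j
    by_cases hj : j = k
    · subst hj; simp [hσ]
    · rw [Function.update_of_ne hj]
      simp only [hσ]
      rw [if_neg]
      rintro ⟨h1, h2, -⟩
      exact hj (le_antisymm (Fin.le_def.2 (by omega)) h1)
  have hN : σ N = PushASEP.pushLeft η k := by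
    funext j
    simp only [hσ, PushASEP.pushLeft, j.2, true_and]
  rw [← h0, ← hN]
  have hk : (k : ℕ) + 1 ≤ N := k.2
  -- In `σ m` only the pushed particles of index below `m` have moved: `σ (k + 1)` moves particle
  -- `k` alone, `σ N` is the full push.
  refine Nat.le_induction (P := fun m _ => m ≤ N → f (σ m) = f (σ (k + 1))) (fun _ => rfl)
    (fun m hm ih hmN => ?_) N hk le_rfl
  rw [← ih (by omega)]
  have hmN' : m < N := by omega
  set j : Fin N := ⟨m, hmN'⟩ with hj
  by_cases hb : η j = η k - ((j : ℤ) - (k : ℤ))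
  · set i : Fin N := ⟨m - 1, by omega⟩ with hi
    have hki : k ≤ i := by rw [Fin.le_def]; simp only [hi]; omega
    have hij : i < j := by rw [Fin.lt_def]; simp only [hi, hj]; omega
    have h1 := StrictAnti.add_le hη hki
    have h2 := hη hij
    have hcast : ((i : ℕ) : ℤ) = (m : ℤ) - 1 := by simp only [hi]; omega
    have hcastj : ((j : ℕ) : ℤ) = m := rfl
    have hbi : η i = η k - ((i : ℤ) - (k : ℤ)) := by omega
    have hsj : σ (m + 1) j = η j - 1 := by
      simp only [hσ]
      rw [if_pos ⟨hki.trans hij.le, Nat.lt_succ_self m, hb⟩]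
    have hsi : σ (m + 1) i = η i - 1 := by
      simp only [hσ]
      rw [if_pos ⟨hki, by simp only [hi]; omega, hbi⟩]
    have h3 := hf i j (σ (m + 1)) (by simp only [hi, hj]; omega) (by rw [hsi, hsj]; omega)
    rw [← h3]
    congr 1
    funext l
    by_cases hl : l = j
    · subst hl
      rw [Function.update_self, hsj]
      simp only [hσ]
      rw [if_neg (by rintro ⟨-, h, -⟩; exact lt_irrefl _ h)]
      ring
    · rw [Function.update_of_ne hl]
      have hlm : (l : ℕ) ≠ m := fun h => hl (Fin.ext h)
      simp only [hσ]
      congr 1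
      apply propext
      constructor
      · rintro ⟨h1, h2, h3⟩; exact ⟨h1, by omega, h3⟩
      · rintro ⟨h1, h2, h3⟩; exact ⟨h1, by omega, h3⟩
  · congr 1
    funext l
    simp only [hσ]
    congr 1
    apply propext
    constructor
    · rintro ⟨h1, h2, h3⟩
      refine ⟨h1, ?_, h3⟩
      rcases Nat.lt_succ_iff_lt_or_eq.1 h2 with h | h
      · exact h
      · exact absurd (by rwa [show l = j from Fin.ext h] at h3) hb
    · rintro ⟨h1, h2, h3⟩; exact ⟨h1, by omega, h3⟩

/-- A blocked right jump contributes nothing to the generator, and nothing to the free sum either,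
because `f` takes the same value before and after it; left jumps are handled by
`BoundaryRelation.pushLeft`. -/
lemma BoundaryRelation.jumpGen_eq {f : (Fin N → ℤ) → ℂ} (hf : BoundaryRelation f)
    {η : Fin N → ℤ} (hη : StrictAnti η) (v : ℕ → ℝ) (a b : ℝ → ℝ) (t : ℝ) :
    jumpGen pushJump (pushRate v a b t) f η = ∑ k : Fin N,
      ((derivWithin a (Set.Ici 0) t * v (k + 1)) • (f (Function.update η k (η k + 1)) - f η) +
        (derivWithin b (Set.Ici 0) t / v (k + 1)) •
          (f (Function.update η k (η k - 1)) - f η)) := by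
  rw [jumpGen, Fintype.sum_prod_type]
  refine Finset.sum_congr rfl fun k _ => ?_
  simp only [Fintype.sum_bool, pushRate, pushJump, if_true, Bool.false_eq_true, if_false]
  rw [hf.pushLeft hη]
  congr 1
  split_ifs with h
  · rfl
  · push Not at h
    obtain ⟨j, hj⟩ := h
    have hjk : j < k := by
      by_contra hjk
      have := hη.antitone (not_lt.1 hjk)
      omega
    have h1 := StrictAnti.add_le hη hjk.le
    have h2 : (j : ℕ) + 1 = k := by
      have : (j : ℕ) < k := hjk
      omega
    rw [hf j k η h2 hj, sub_self, smul_zero, zero_smul]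

end

section
variable {v : ℕ → ℝ} {y : ℕ → ℤ} {n N : ℕ} {F : ℕ → ℤ → ℂ} {A₀ B₀ A B : ℂ}
  (hv : ∀ n, 1 ≤ n → 0 < v n)
include hv

lemma boundaryRelation_backFun {ρ : ℝ} (hρ : 0 < ρ) (hF : ∀ k < n, Wt ρ (F k)) :
    BoundaryRelation fun η : Fin N → ℤ => backFun v y n F A₀ B₀ A B (ext η) := by
  intro i j η hij h
  beta_reduce
  rw [ext_update, ← ext_apply η j, ← hij]
  refine backFun_relation hv hρ hF ?_
  rw [hij, ext_apply, ext_apply, h]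

lemma jumpGen_backFun {ρ : ℝ} (hρ : 0 < ρ) (hF : ∀ k < n, Wt ρ (F k)) (hn : n ≤ N)
    {η : Fin N → ℤ} (hη : StrictAnti η) (a b : ℝ → ℝ) (t : ℝ) :
    jumpGen pushJump (pushRate v a b t) (fun η : Fin N → ℤ => backFun v y n F A₀ B₀ A B (ext η)) η =
      ∑ l ∈ Finset.range n, ((derivWithin a (Set.Ici 0) t * v (l + 1)) •
        (backFun v y n F A₀ B₀ A B (Function.update (ext η) l (ext η l + 1)) -
          backFun v y n F A₀ B₀ A B (ext η)) +
        (derivWithin b (Set.Ici 0) t / v (l + 1)) •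
        (backFun v y n F A₀ B₀ A B (Function.update (ext η) l (ext η l - 1)) -
          backFun v y n F A₀ B₀ A B (ext η))) := by
  rw [(boundaryRelation_backFun hv hρ hF).jumpGen_eq hη]
  simp only [ext_update, ← ext_apply]
  rw [← Finset.sum_range fun l => ((derivWithin a (Set.Ici 0) t * v (l + 1)) •
        (backFun v y n F A₀ B₀ A B (Function.update (ext η) l (ext η l + 1)) -
          backFun v y n F A₀ B₀ A B (ext η)) +
        (derivWithin b (Set.Ici 0) t / v (l + 1)) •
        (backFun v y n F A₀ B₀ A B (Function.update (ext η) l (ext η l - 1)) -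
          backFun v y n F A₀ B₀ A B (ext η)))]
  symm
  refine Finset.sum_subset (Finset.range_mono hn) fun l _ hl => ?_
  have hl' : n ≤ l := by simpa using hl
  rw [backFun_update_of_le hl', backFun_update_of_le hl', sub_self, smul_zero, smul_zero, add_zero]

omit hv in
lemma sum_natAbs_ext_le (hn : n ≤ N) (η : Fin N → ℤ) :
    ∑ l ∈ Finset.range n, (ext η l).natAbs ≤ ∑ i, (η i).natAbs := by
  calc _ ≤ ∑ l ∈ Finset.range N, (ext η l).natAbs :=
        Finset.sum_le_sum_of_subset (Finset.range_mono hn)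
    _ = _ := by
      rw [Finset.sum_range]
      simp only [ext_apply]

omit hv in
lemma sum_natAbs_update_le {m : ℕ} (η : ℕ → ℤ) {d : ℤ} (hd : d.natAbs ≤ 1) :
    ∑ l ∈ Finset.range n, (Function.update η m (η m + d) l).natAbs ≤
      1 + ∑ l ∈ Finset.range n, (η l).natAbs := by
  by_cases hm : m ∈ Finset.range n
  · rw [← Finset.add_sum_erase _ _ hm, ← Finset.add_sum_erase (Finset.range n) _ hm,
      Function.update_self]
    have : ∑ l ∈ (Finset.range n).erase m, (Function.update η m (η m + d) l).natAbs =
        ∑ l ∈ (Finset.range n).erase m, (η l).natAbs :=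
      Finset.sum_congr rfl fun l hl => by rw [Function.update_of_ne (Finset.ne_of_mem_erase hl)]
    rw [this]
    omega
  · have : ∑ l ∈ Finset.range n, (Function.update η m (η m + d) l).natAbs =
        ∑ l ∈ Finset.range n, (η l).natAbs :=
      Finset.sum_congr rfl fun l hl => by
        rw [Function.update_of_ne]
        rintro rfl
        exact hm hl
    omega

variable {a b : ℝ → ℝ}
  (ha : ContDiffOn ℝ (⊤ : ℕ∞) a (Set.Ici 0)) (hb : ContDiffOn ℝ (⊤ : ℕ∞) b (Set.Ici 0))
  (ha_mono : MonotoneOn a (Set.Ici 0)) (hb_mono : MonotoneOn b (Set.Ici 0))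
  {p : ℝ → ℝ → (Fin N → ℤ) → (Fin N → ℤ) → ℝ} (hp : IsTransitionFunction v a b p)
include ha hb ha_mono hb_mono hp

/-- The backward functions solve the backward equation. -/
theorem IsTransitionFunction.tsum_backFun {ρ : ℝ} (hρ : 0 < ρ) (hF : ∀ k < n, Wt ρ (F k))
    (hn : n ≤ N) {s T : ℝ} (hs : 0 ≤ s) (hsT : s ≤ T) {η : Fin N → ℤ} (hη : StrictAnti η) :
    ∑' ζ, p s T η ζ • backFun v y n F A₀ B₀ (a T) (b T) (ext ζ) =
      backFun v y n F A₀ B₀ (a s) (b s) (ext η) := by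
  have hd : ∀ {f : ℝ → ℝ}, ContDiffOn ℝ (⊤ : ℕ∞) f (Set.Ici 0) → ∀ u, 0 ≤ u →
      HasDerivWithinAt f (derivWithin f (Set.Ici 0) u) (Set.Ici 0) u := fun hf u hu =>
    ((hf.differentiableOn (by simp)) u hu).hasDerivWithinAt
  set H : ℝ → (Fin N → ℤ) → ℂ := fun u ζ => backFun v y n F A₀ B₀ (a u) (b u) (ext ζ) with hH
  set H' : ℝ → (Fin N → ℤ) → ℂ := fun t η => -∑ l ∈ Finset.range n,
      ((derivWithin a (Set.Ici 0) t * v (l + 1)) •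
        (backFun v y n F A₀ B₀ (a t) (b t) (Function.update (ext η) l (ext η l + 1)) -
          backFun v y n F A₀ B₀ (a t) (b t) (ext η)) +
        (derivWithin b (Set.Ici 0) t / v (l + 1)) •
        (backFun v y n F A₀ B₀ (a t) (b t) (Function.update (ext η) l (ext η l - 1)) -
          backFun v y n F A₀ B₀ (a t) (b t) (ext η))) with hH'
  have hderiv : ∀ u, 0 ≤ u → ∀ ζ, HasDerivWithinAt (fun u => H u ζ) (H' u ζ) (Set.Ici 0) u :=
    fun u hu ζ => backFun_hasDerivWithinAt hv hρ hF (hd ha u hu) (hd hb u hu) (ext ζ)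
  obtain ⟨Λ, hΛ, hrate⟩ := exists_rate_bound (N := N) hv ha hb ha_mono hb_mono hs T
  set K : ℝ := |a s| + |a T| + (|b s| + |b T|) with hK
  have hbd : ∀ {f : ℝ → ℝ}, MonotoneOn f (Set.Ici 0) → ∀ u ∈ Set.Icc s T,
      ‖(f u : ℂ)‖ ≤ |f s| + |f T| := fun {f} hf u hu => by
    rw [Complex.norm_real, Real.norm_eq_abs, abs_le]
    have h1 := hf (Set.mem_Ici.2 hs) (Set.mem_Ici.2 (hs.trans hu.1)) hu.1
    have h2 := hf (Set.mem_Ici.2 (hs.trans hu.1)) (Set.mem_Ici.2 (hs.trans hsT)) hu.2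
    constructor <;> linarith [neg_abs_le (f s), le_abs_self (f T), abs_nonneg (f s),
      abs_nonneg (f T)]
  obtain ⟨R, C, hR, hC, hbound⟩ :=
    exists_backFun_bound (y := y) (A₀ := A₀) (B₀ := B₀) hv hρ hF K
  have hbound' : ∀ u ∈ Set.Icc s T, ∀ η, ‖backFun v y n F A₀ B₀ (a u) (b u) η‖ ≤
      C * R ^ ∑ l ∈ Finset.range n, (η l).natAbs := fun u hu η => by
    refine hbound _ _ ((hbd ha_mono u hu).trans ?_) ((hbd hb_mono u hu).trans ?_) η
    · have := add_nonneg (abs_nonneg (b s)) (abs_nonneg (b T)); linarith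
    · have := add_nonneg (abs_nonneg (a s)) (abs_nonneg (a T)); linarith
  have hR0 : 0 ≤ R := by linarith
  have hHb : ∀ u ∈ Set.Icc s T, ∀ ζ, ‖H u ζ‖ ≤ C * expWeight R ζ := fun u hu ζ =>
    (hbound' u hu (ext ζ)).trans (mul_le_mul_of_nonneg_left
      (pow_le_pow_right₀ hR (sum_natAbs_ext_le hn ζ)) hC)
  have hHu : ∀ u ∈ Set.Icc s T, ∀ ζ : Fin N → ℤ, ∀ l, ∀ d : ℤ, d.natAbs ≤ 1 →
      ‖backFun v y n F A₀ B₀ (a u) (b u) (Function.update (ext ζ) l (ext ζ l + d))‖ ≤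
        C * (R * expWeight R ζ) := fun u hu ζ l d hd => by
    refine (hbound' u hu _).trans (mul_le_mul_of_nonneg_left ?_ hC)
    rw [expWeight, ← pow_succ']
    refine pow_le_pow_right₀ hR ((sum_natAbs_update_le _ hd).trans ?_)
    have := sum_natAbs_ext_le hn ζ
    omega
  set C' : ℝ := C + n * (Λ * (C * R + C) + Λ * (C * R + C)) with hC'
  have hCC : C ≤ C' := by
    have : 0 ≤ n * (Λ * (C * R + C) + Λ * (C * R + C)) := by positivity
    linarith
  refine hp.tsum_eq hv ha hb ha_mono hb_mono hs hsT hη (H := H) (H' := H') (R := R) (C := C') hR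
    ?_ ?_ ?_ ?_ ?_
  · intro ζ u hu
    exact (hderiv u (hs.trans hu.1) ζ).continuousWithinAt.mono fun x hx => hs.trans hx.1
  · exact fun u hu ζ => (hHb u hu ζ).trans
      (mul_le_mul_of_nonneg_right hCC (expWeight_nonneg hR ζ))
  · intro u hu ζ
    have hu' := Set.Ioo_subset_Icc_self hu
    have hw := expWeight_nonneg hR ζ
    simp only [hH', norm_neg]
    have h1 : ∀ l ∈ Finset.range n, ‖(derivWithin a (Set.Ici 0) u * v (l + 1)) •
        (backFun v y n F A₀ B₀ (a u) (b u) (Function.update (ext ζ) l (ext ζ l + 1)) -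
          backFun v y n F A₀ B₀ (a u) (b u) (ext ζ)) +
        (derivWithin b (Set.Ici 0) u / v (l + 1)) •
        (backFun v y n F A₀ B₀ (a u) (b u) (Function.update (ext ζ) l (ext ζ l - 1)) -
          backFun v y n F A₀ B₀ (a u) (b u) (ext ζ))‖ ≤
        (Λ * (C * R + C) + Λ * (C * R + C)) * expWeight R ζ := by
      intro l hl
      have hlN : l < N := (Finset.mem_range.1 hl).trans_le hn
      have hr1 := hrate u hu' (⟨l, hlN⟩, true) (fun _ => 0)
      have hr2 := hrate u hu' (⟨l, hlN⟩, false) (fun _ => 0)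
      simp only [pushRate, if_true, Bool.false_eq_true, if_false] at hr1 hr2
      rw [if_pos (fun _ => by norm_num)] at hr1
      have hdiff : ∀ d : ℤ, d.natAbs ≤ 1 →
          ‖backFun v y n F A₀ B₀ (a u) (b u) (Function.update (ext ζ) l (ext ζ l + d)) -
            backFun v y n F A₀ B₀ (a u) (b u) (ext ζ)‖ ≤ (C * R + C) * expWeight R ζ :=
        fun d hd => by
          have e1 := norm_sub_le (backFun v y n F A₀ B₀ (a u) (b u)
            (Function.update (ext ζ) l (ext ζ l + d))) (backFun v y n F A₀ B₀ (a u) (b u) (ext ζ))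
          have e2 := hHu u hu' ζ l d hd
          have e3 := hHb u hu' ζ
          simp only [hH] at e3
          linarith
      refine (norm_add_le _ _).trans ?_
      rw [add_mul, mul_assoc, norm_smul, norm_smul, Real.norm_eq_abs, Real.norm_eq_abs,
        abs_of_nonneg hr1.1, abs_of_nonneg hr2.1]
      exact add_le_add (mul_le_mul hr1.2 (hdiff 1 (by norm_num)) (norm_nonneg _) hΛ)
        (mul_le_mul hr2.2 (hdiff (-1) (by norm_num)) (norm_nonneg _) hΛ)
    refine (norm_sum_le _ _).trans ((Finset.sum_le_sum h1).trans ?_)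
    rw [Finset.sum_const, Finset.card_range, nsmul_eq_mul, ← mul_assoc]
    exact mul_le_mul_of_nonneg_right (by linarith) hw
  · intro u hu ζ
    have hu0 : 0 < u := hs.trans_lt hu.1
    exact (hderiv u hu0.le ζ).hasDerivAt (Ici_mem_nhds hu0)
  · intro u hu ζ hζ
    have := jumpGen_backFun (y := y) (A₀ := A₀) (B₀ := B₀) (A := a u) (B := b u) hv hρ hF hn hζ a b u
    simp only [hH, hH']
    rw [this]
    exact neg_add_cancel _

end

/-! ### Terminal values and the link between consecutive levels -/

lemma DD_congr (v : ℕ → ℝ) {m n : ℕ} (hmn : m ≤ n) {f g : ℤ → ℂ} {x : ℤ}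
    (h : ∀ i : ℕ, i ≤ n - m → f (x - i) = g (x - i)) :
    DD v (Finset.Ioc m n) f x = DD v (Finset.Ioc m n) g x := by
  induction n, hmn using Nat.le_induction generalizing f g with
  | base => simpa using h 0 (Nat.zero_le _)
  | succ n hmn ih =>
    rw [DD_Ioc v hmn (Nat.le_succ n), DD_Ioc v hmn (Nat.le_succ n), Nat.Ioc_succ_singleton]
    refine ih fun i hi => ?_
    rw [DD_singleton, DD_singleton, h i (by omega)]
    have := h (i + 1) (by omega)
    push_cast at this
    rw [← sub_sub] at this
    rw [this]

section
variable {v : ℕ → ℝ} {y : ℕ → ℤ} {n n' : ℕ} {g F' : ℕ → ℤ → ℂ} {A₀ B₀ A' B' : ℂ}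

lemma pref_split (hn : n' ≤ n) (A B : ℂ) (η : ℕ → ℤ) : pref v y n A B η =
    pref v y n' A B η * ∏ l ∈ Finset.Ico n' n, ((v (l + 1) : ℂ) ^ (y (l + 1) - η l) *
      Complex.exp (v (l + 1) * A + B / v (l + 1))) :=
  (Finset.prod_range_mul_prod_Ico _ hn).symm

/-- The block of new rows. -/
lemma det_new_rows (hv : ∀ n, 1 ≤ n → 0 < v n) (hn : n' ≤ n)
    (hg : ∀ k, n' ≤ k → k < n → DD v (Finset.Ioc n' n) (g k) = 0)
    (hdual : ∀ k l, n' ≤ k → k < n → n' ≤ l → l < n →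
      DD v (Finset.Ioc (l + 1) n) (conv (g k) (expc A₀ B₀)) (y (l + 1)) = if k = l then 1 else 0)
    (η : ℕ → ℤ) :
    Matrix.det (Matrix.of fun k l : {k : Fin n // ¬(k : ℕ) < n'} =>
      DD v (Finset.Ioc ((l : ℕ) + 1) n) (g (k : ℕ)) (η l)) *
      ∏ l ∈ Finset.Ico n' n, ((v (l + 1) : ℂ) ^ (y (l + 1) - η l) *
        Complex.exp (v (l + 1) * A₀ + B₀ / v (l + 1))) = 1 := by
  obtain ⟨κ, hκ⟩ := exists_det_pairing hv (hmn := hn)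
    (ι := {k : Fin n // ¬(k : ℕ) < n'}) (lab := fun k => (k : ℕ) + 1)
    (h := fun k => g (k : ℕ))
    (hmono := fun i j hij => Nat.succ_lt_succ hij)
    (hlab := fun j => ⟨by
      rintro ⟨i, rfl⟩
      have := i.1.2
      have := i.2
      omega, fun ⟨h1, h2⟩ => ⟨⟨⟨j - 1, by omega⟩, by dsimp only; omega⟩, by
        dsimp only; omega⟩⟩)
    (hh := fun k => hg _ (not_lt.1 k.2) k.1.2)
  have hdet : ∀ A B : ℂ, ∀ ξ : {k : Fin n // ¬(k : ℕ) < n'} → ℤ,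
      Matrix.det (Matrix.of fun k l : {k : Fin n // ¬(k : ℕ) < n'} =>
        DD v (Finset.Ioc ((l : ℕ) + 1) n) (conv (g (k : ℕ)) (expc A B)) (ξ l)) =
        κ * ∏ l : {k : Fin n // ¬(k : ℕ) < n'}, ((v ((l : ℕ) + 1) : ℂ) ^ ξ l *
          Complex.exp (A * v ((l : ℕ) + 1) + B / v ((l : ℕ) + 1))) := fun A B ξ => by
    rw [← hκ A B ξ]
    congr!
  -- At (A₀, B₀, y) biorthogonality makes the matrix the identity, which determines κ; at (0, 0, η)
  -- it is the matrix of the statement.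
  have h1 := hdet A₀ B₀ (fun l => y ((l : ℕ) + 1))
  have h2 := hdet 0 0 (fun l => η l)
  have h3 : (Matrix.of fun k l : {k : Fin n // ¬(k : ℕ) < n'} =>
      DD v (Finset.Ioc ((l : ℕ) + 1) n) (conv (g (k : ℕ)) (expc A₀ B₀)) (y ((l : ℕ) + 1))) = 1 := by
    ext k l
    rw [Matrix.of_apply, hdual _ _ (not_lt.1 k.2) k.1.2 (not_lt.1 l.2) l.1.2, Matrix.one_apply]
    congr 1
    rw [← Fin.ext_iff, Subtype.ext_iff]
  have hprod : ∀ f : ℕ → ℂ, ∏ l : {k : Fin n // ¬(k : ℕ) < n'}, f l = ∏ l ∈ Finset.Ico n' n, f l := by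
    intro f
    refine Finset.prod_bij (fun l _ => (l : ℕ)) (fun l _ => Finset.mem_Ico.2
      ⟨not_lt.1 l.2, l.1.2⟩) (fun l _ l' _ h => Subtype.ext (Fin.ext h))
      (fun j hj => ⟨⟨⟨j, (Finset.mem_Ico.1 hj).2⟩, not_lt.2 (Finset.mem_Ico.1 hj).1⟩,
        Finset.mem_univ _, rfl⟩) fun _ _ => rfl
  rw [h3, Matrix.det_one, hprod fun l => (v (l + 1) : ℂ) ^ y (l + 1) *
    Complex.exp (A₀ * v (l + 1) + B₀ / v (l + 1))] at h1
  simp only [conv_expc_zero] at h2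
  rw [h2, hprod fun l => (v (l + 1) : ℂ) ^ η l *
    Complex.exp (0 * v (l + 1) + 0 / v (l + 1)), h1, mul_assoc, ← Finset.prod_mul_distrib]
  congr 1
  refine Finset.prod_congr rfl fun l _ => ?_
  have hne : (v (l + 1) : ℂ) ≠ 0 := by exact_mod_cast (hv (l + 1) (by omega)).ne'
  rw [zero_mul, zero_div, add_zero, Complex.exp_zero, mul_one, ← mul_assoc, ← zpow_add₀ hne,
    add_sub_cancel, mul_comm A₀]

/-- At the final time the truncated backward function reduces to the backward function of the
preceding level. -/
theorem backFun_terminal (hv : ∀ n, 1 ≤ n → 0 < v n) (hn : n' ≤ n) (hn1 : 1 ≤ n) {ρ : ℝ}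
    (hρ : 0 < ρ) {s : ℝ} {η : ℕ → ℤ} (hη : ∀ l < n, η (n - 1) + ((n - 1 : ℕ) - l : ℤ) ≤ η l)
    (hF' : ∀ k < n', Wt ρ (F' k))
    (hstep : ∀ k < n', DD v (Finset.Ioc n' n) (g k) = conv (F' k) (expc A' B'))
    (hg : ∀ k, n' ≤ k → k < n → DD v (Finset.Ioc n' n) (g k) = 0)
    (hdual : ∀ k l, n' ≤ k → k < n → n' ≤ l → l < n →
      DD v (Finset.Ioc (l + 1) n) (conv (g k) (expc A₀ B₀)) (y (l + 1)) = if k = l then 1 else 0) :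
    backFun v y n (fun k => cutGe s (g k)) A₀ B₀ A₀ B₀ η =
      if (η (n - 1) : ℝ) < s then 0 else pref v y n' A₀ B₀ η * detFun v n' F' A' B' η := by
  simp only [backFun, detFun, sub_self, conv_expc_zero]
  split_ifs with hs
  -- The last column carries no difference operator, so it consists of the cut functions evaluated
  -- to the left of the cut.
  · rw [Matrix.det_eq_zero_of_column_eq_zero ⟨n - 1, by omega⟩, mul_zero]
    intro k
    rw [Matrix.of_apply, Nat.sub_add_cancel hn1, Finset.Ioc_self, DD_empty]
    simp [cutGe, hs]
  -- The column with index l looks at most n - l - 1 sites to the left of η l, hence never beyond η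
  -- (n - 1) ≥ s: the cut is invisible.
  have hM : (Matrix.of fun k l : Fin n => DD v (Finset.Ioc (l + 1) n) (cutGe s (g k)) (η l)) =
      Matrix.of fun k l : Fin n => DD v (Finset.Ioc (l + 1) n) (g k) (η l) := by
    ext k l
    rw [Matrix.of_apply, Matrix.of_apply]
    refine DD_congr v (by omega) fun i hi => ?_
    have h1 := hη l l.2
    have h2 : η (n - 1) ≤ η l - i := by
      have := l.2
      omega
    have h3 : ¬((η l - i : ℤ) : ℝ) < s := by
      have : (η (n - 1) : ℝ) ≤ ((η l - i : ℤ) : ℝ) := by exact_mod_cast h2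
      linarith
    rw [cutGe, if_neg h3]
  -- The rows k ≥ n' vanish in the columns l < n'. The old block is the determinant of the preceding
  -- level, and the new block cancels the new factors of the prefactor.
  rw [hM, Matrix.twoBlockTriangular_det _ (fun k : Fin n => (k : ℕ) < n'), pref_split hn]
  · have h2 := det_new_rows hv hn hg hdual η
    have h1 : Matrix.det (Matrix.toSquareBlockProp (Matrix.of fun k l : Fin n =>
        DD v (Finset.Ioc (l + 1) n) (g k) (η l)) fun k : Fin n => (k : ℕ) < n') =
        Matrix.det (Matrix.of fun k l : Fin n' =>
          conv (DD v (Finset.Ioc (l + 1) n') (F' k)) (expc A' B') (η l)) := by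
      let e : Fin n' ≃ {k : Fin n // (k : ℕ) < n'} :=
        ⟨fun k => ⟨⟨k, k.2.trans_le hn⟩, k.2⟩, fun k => ⟨k, k.2⟩, fun _ => rfl, fun _ => rfl⟩
      rw [← Matrix.det_submatrix_equiv_self e]
      congr 1
      ext k l
      have := congrFun ((hF' k k.2).DD_conv hρ (wt_expc A' B' hρ) v (Finset.Ioc (l + 1) n')) (η l)
      rw [Matrix.of_apply, ← this, ← hstep k k.2, ← DD_Ioc v (Nat.succ_le_of_lt l.2) hn]
      rfl
    rw [h1]
    rw [show Matrix.toSquareBlockProp (Matrix.of fun k l : Fin n =>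
        DD v (Finset.Ioc (l + 1) n) (g k) (η l)) (fun k : Fin n => ¬(k : ℕ) < n') =
      Matrix.of fun k l : {k : Fin n // ¬(k : ℕ) < n'} =>
      DD v (Finset.Ioc ((l : ℕ) + 1) n) (g (k : ℕ)) (η l) from rfl]
    linear_combination (pref v y n' A₀ B₀ η * Matrix.det (Matrix.of fun k l : Fin n' =>
          conv (DD v (Finset.Ioc (l + 1) n') (F' k)) (expc A' B') (η l))) * h2
  · intro k hk l hl
    rw [Matrix.of_apply, DD_Ioc v (Nat.succ_le_of_lt hl) hn, hg k (not_lt.1 hk) k.2, map_zero]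
    rfl

end

section
variable {v : ℕ → ℝ} {y : ℕ → ℤ} {N : ℕ} {n : ℕ → ℕ} {a b : ℕ → ℂ} {Φ : ℕ → ℕ → ℤ → ℂ}
  (h : Chain v y N n a b Φ) {ρ : ℝ} {s : ℕ → ℝ}
include h

lemma Chain.corr_eq_zero {i k : ℕ} (hk : n i ≤ k) : corr v n a b s Φ i k = 0 := by
  induction i with
  | zero => rfl
  | succ i ih =>
    have hik : n i ≤ k := (h.mono (Nat.le_succ i)).trans hk
    rw [corr, ih hik, h.zero i k hik, sub_zero, cutLt_zero, add_zero, conv_zero_left]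

lemma Chain.corr_succ_eq_zero {i k : ℕ} (hk : n i ≤ k) : corr v n a b s Φ (i + 1) k = 0 := by
  rw [corr, h.corr_eq_zero hk, h.zero i k hk, sub_zero, cutLt_zero, add_zero, conv_zero_left]

omit h in
/-- The backward function of the level number `j`. -/
noncomputable def levelFun (v : ℕ → ℝ) (y : ℕ → ℤ) (n : ℕ → ℕ) (a b : ℕ → ℂ) (s : ℕ → ℝ)
    (Φ : ℕ → ℕ → ℤ → ℂ) (j : ℕ) (A B : ℂ) (η : ℕ → ℤ) : ℂ :=
  backFun v y (n j) (fun k => cutGe (s j) (Φ j k - corr v n a b s Φ j k)) (a j) (b j) A B η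

lemma Chain.levelFun_zero (hn1 : 1 ≤ n 0) (hρ : IsSmallRadius v N ρ) {η : ℕ → ℤ}
    (hη : ∀ l < n 0, η (n 0 - 1) + ((n 0 - 1 : ℕ) - l : ℤ) ≤ η l) :
    levelFun v y n a b s Φ 0 (a 0) (b 0) η = if (η (n 0 - 1) : ℝ) < s 0 then 0 else 1 := by
  rw [levelFun, backFun_terminal (n' := 0) (F' := 0) (A' := 0) (B' := 0) h.pos (Nat.zero_le _) hn1
    hρ.1 hη (by simp) (by simp)]
  · simp [pref, detFun]
  · intro k _ hk
    simp only [corr, sub_zero]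
    rw [Ioc_zero_eq]
    exact (mem_V_iff h.pos).1 (h.mem 0 k hk)
  · intro k l _ hk _ hl
    simp only [corr, sub_zero]
    exact h.dual 0 k l hk hl

/-- Indices increase as time decreases, so this is the gluing demanded by the Markov property at the
time of index i + 1: the indicator of that observation times the backward function for the
chronologically later ones. `DD_step` matches the old rows, and the correction vanishes on the new
rows. -/
lemma Chain.levelFun_succ (hN : 1 ≤ N) (hρ : IsSmallRadius v N ρ) {i : ℕ} (hn1 : 1 ≤ n (i + 1))
    {η : ℕ → ℤ} (hη : ∀ l < n (i + 1), η (n (i + 1) - 1) + ((n (i + 1) - 1 : ℕ) - l : ℤ) ≤ η l) :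
    levelFun v y n a b s Φ (i + 1) (a (i + 1)) (b (i + 1)) η =
      if (η (n (i + 1) - 1) : ℝ) < s (i + 1) then 0
      else levelFun v y n a b s Φ i (a (i + 1)) (b (i + 1)) η := by
  have hmono : n i ≤ n (i + 1) := h.mono (Nat.le_succ i)
  rw [levelFun, backFun_terminal (n' := n i)
    (F' := fun k => cutGe (s i) (Φ i k - corr v n a b s Φ i k))
    (A' := a i - a (i + 1)) (B' := b i - b (i + 1)) h.pos hmono hn1 hρ.1 hη
    (fun k _ => h.wt_cutGe_sub hN hρ i k)]
  · rfl
  · intro k hk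
    have h1 := h.DD_step (s := s) hN hρ hk
    rw [map_sub, sub_eq_zero] at h1
    rw [h1, ← (h.wt_cutGe_sub hN hρ i k).conv_DD hρ.1 (h.wt_cin hρ _ _), h.DD_cin hρ]
  · intro k hk hk'
    rw [h.corr_succ_eq_zero hk, sub_zero]
    refine DD_dual_eq_zero (y := y) (A := a (i + 1)) (B := b (i + 1)) h.pos hmono
      (h.mem (i + 1) k hk') fun l hl hl' => ?_
    obtain ⟨l, rfl⟩ : ∃ l' : ℕ, l = l' + 1 := ⟨l - 1, by omega⟩
    rw [h.dual (i + 1) k l hk' (by omega), if_neg (by omega)]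
  · intro k l hk hk' _ hl
    rw [h.corr_succ_eq_zero hk, sub_zero]
    exact h.dual (i + 1) k l hk' hl

/-- The value of the backward function of the last level at the initial configuration. -/
lemma Chain.levelFun_init (hN : 1 ≤ N) (hρ : IsSmallRadius v N ρ) {M : ℕ} (hM : n M = N)
    {η : ℕ → ℤ} (hη : ∀ l < N, η l = y (l + 1)) :
    levelFun v y n a b s Φ M 0 0 η = Matrix.det (Matrix.of fun k l : Fin N =>
      conv (cutGe (s M) (Φ M k - corr v n a b s Φ M k)) (psi v n a b M l) (y (l + 1))) := by
  subst hM
  have hpref : pref v y (n M) 0 0 η = 1 := Finset.prod_eq_one fun l hl => by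
    rw [hη l (Finset.mem_range.1 hl)]
    simp
  rw [levelFun, backFun, hpref, one_mul, detFun, sub_zero, sub_zero]
  congr 1
  ext k l
  have hF := h.wt_cutGe_sub (s := s) hN hρ M k
  have hw := wt_expc (a M) (b M) hρ.1
  rw [Matrix.of_apply, Matrix.of_apply, psi, hF.conv_DD hρ.1 hw, hF.DD_conv hρ.1 hw, hη l l.2]

end

/-! ### Probabilities along space-like paths -/

/-- `pathProb p t n s j u ζ` is the probability that, started from `ζ` at time `u`, the particles
with labels `n i` are not to the left of `s i` at the times `t i`, for all `i < j`, where the times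
`t i` decrease with `i`. -/
noncomputable def pathProb {N : ℕ} (p : ℝ → ℝ → (Fin N → ℤ) → (Fin N → ℤ) → ℝ) (t : ℕ → ℝ)
    (n : ℕ → ℕ) (s : ℕ → ℝ) : ℕ → ℝ → (Fin N → ℤ) → ℝ
  | 0, _, _ => 1
  | j + 1, u, ζ => ∑' ζ', p u (t j) ζ ζ' *
      {ξ : Fin N → ℤ | s j ≤ ext ξ (n j - 1)}.indicator (pathProb p t n s j (t j)) ζ'

lemma ext_add_le {N m : ℕ} {ζ : Fin N → ℤ} (hζ : StrictAnti ζ) (hm : m ≤ N) (l : ℕ) (hl : l < m) :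
    ext ζ (m - 1) + ((m - 1 : ℕ) - l : ℤ) ≤ ext ζ l := by
  have h1 : m - 1 < N := by omega
  have h2 : l < N := by omega
  have := StrictAnti.add_le hζ (i := ⟨l, h2⟩) (j := ⟨m - 1, h1⟩) (by rw [Fin.mk_le_mk]; omega)
  rw [ext, ext, dif_pos h1, dif_pos h2]
  exact this

/-- The probability of the event along a space-like path, through the backward functions. -/
theorem Chain.pathProb_eq {v : ℕ → ℝ} {a b : ℝ → ℝ}
    (ha : ContDiffOn ℝ (⊤ : ℕ∞) a (Set.Ici 0)) (hb : ContDiffOn ℝ (⊤ : ℕ∞) b (Set.Ici 0))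
    (ha_mono : MonotoneOn a (Set.Ici 0)) (hb_mono : MonotoneOn b (Set.Ici 0))
    {N : ℕ} (hN : 1 ≤ N) {p : ℝ → ℝ → (Fin N → ℤ) → (Fin N → ℤ) → ℝ}
    (hp : IsTransitionFunction v a b p) {y : ℕ → ℤ} {n : ℕ → ℕ} {t : ℕ → ℝ} {s : ℕ → ℝ}
    {Φ : ℕ → ℕ → ℤ → ℂ} (h : Chain v y N n (fun i => a (t i)) (fun i => b (t i)) Φ)
    (hn1 : ∀ i, 1 ≤ n i) (ht : Antitone t) (ht0 : ∀ i, 0 ≤ t i) {ρ : ℝ} (hρ : IsSmallRadius v N ρ)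
    (j : ℕ) {u : ℝ} (hu : 0 ≤ u) (huj : u ≤ t j) {ζ : Fin N → ℤ} (hζ : StrictAnti ζ) :
    (pathProb p t n s (j + 1) u ζ : ℂ) =
      levelFun v y n (fun i => a (t i)) (fun i => b (t i)) s Φ j (a u) (b u) (ext ζ) := by
  induction j generalizing u ζ with
  | zero =>
    rw [levelFun, ← hp.tsum_backFun h.pos ha hb ha_mono hb_mono hρ.1
      (fun k _ => h.wt_cutGe_sub hN hρ 0 k) (h.le 0) hu huj hζ, pathProb, Complex.ofReal_tsum]
    refine tsum_congr fun ζ' => ?_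
    by_cases hζ' : StrictAnti ζ'
    · have := h.levelFun_zero (s := s) (hn1 0) hρ (ext_add_le hζ' (h.le 0))
      rw [levelFun] at this
      rw [this]
      split_ifs with hs
      · rw [Set.indicator_of_notMem (a := ζ') (by simpa using hs)]
        simp
      · rw [Set.indicator_of_mem (a := ζ') (by simpa using hs), pathProb]
        simp
    · rw [hp.eq_zero h.pos ha hb ha_mono hb_mono hu huj hζ hζ']
      simp
  | succ j ih =>
    rw [levelFun, ← hp.tsum_backFun h.pos ha hb ha_mono hb_mono hρ.1
      (fun k _ => h.wt_cutGe_sub hN hρ (j + 1) k) (h.le (j + 1)) hu huj hζ, pathProb,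
      Complex.ofReal_tsum]
    refine tsum_congr fun ζ' => ?_
    by_cases hζ' : StrictAnti ζ'
    · have := h.levelFun_succ (s := s) hN hρ (hn1 (j + 1)) (ext_add_le hζ' (h.le (j + 1)))
      rw [levelFun, ← ih (ht0 (j + 1)) (ht (Nat.le_succ j)) hζ'] at this
      rw [this]
      split_ifs with hs
      · rw [Set.indicator_of_notMem (a := ζ') (by simpa using hs)]
        simp
      · rw [Set.indicator_of_mem (a := ζ') (by simpa using hs), Complex.real_smul, Complex.ofReal_mul]
    · rw [hp.eq_zero h.pos ha hb ha_mono hb_mono hu huj hζ hζ']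
      simp

end PushASEP

/-! ### Path events from finite-dimensional distributions -/

namespace PushASEP
open Filter Topology MeasureTheory

section
variable {Ω S : Type*} [MeasurableSpace Ω] {μ : Measure Ω} [IsProbabilityMeasure μ]
  [MeasurableSpace S] [Countable S] [MeasurableSingletonClass S] {X : ℕ → Ω → S}
  (hX : ∀ i, Measurable (X i)) {L : ℕ} {y : S} {q : ℕ → S → S → ℝ}
  (hlaw : ∀ ζ : ℕ → S, ζ 0 = y → μ.real {ω | ∀ i ≤ L, X i ω = ζ i} =
    ∏ i ∈ Finset.range L, q i (ζ i) (ζ (i + 1)))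
  {E : ℕ → Set S} {V : ℕ → S → ℝ} (hVL : V L = 1)
  (hV : ∀ i < L, ∀ ζ, V i ζ = ∑' ξ, q i ζ ξ * (E (i + 1)).indicator (V (i + 1)) ξ)
include hX hlaw hVL hV

/-- Induction on r downwards from L: the event is split according to the value at step r + 1, each
piece fixing one more step of the path. -/
lemma markov_paths_aux {r : ℕ} (hr : r ≤ L) (ζ : ℕ → S) (hζ : ζ 0 = y) :
    μ.real {ω | (∀ i ≤ r, X i ω = ζ i) ∧ ∀ i, r < i → i ≤ L → X i ω ∈ E i} =
      (∏ i ∈ Finset.range r, q i (ζ i) (ζ (i + 1))) * V r (ζ r) := by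
  induction hr using Nat.decreasingInduction generalizing ζ with
  | self =>
    rw [hVL, Pi.one_apply, mul_one, ← hlaw ζ hζ]
    congr 1
    ext ω
    simp only [Set.mem_ofPred_eq]
    exact ⟨fun h => h.1, fun h => ⟨h, fun i h1 h2 => absurd h2 (not_le.2 h1)⟩⟩
  | of_succ r hr ih =>
    set D : S → Set Ω := fun ξ => {ω | ((∀ i ≤ r, X i ω = ζ i) ∧ X (r + 1) ω = ξ ∧ ξ ∈ E (r + 1)) ∧
      ∀ i, r + 1 < i → i ≤ L → X i ω ∈ E i} with hD
    have hunion : {ω | (∀ i ≤ r, X i ω = ζ i) ∧ ∀ i, r < i → i ≤ L → X i ω ∈ E i} = ⋃ ξ, D ξ := by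
      ext ω
      simp only [hD, Set.mem_ofPred_eq, Set.mem_iUnion]
      constructor
      · rintro ⟨h1, h2⟩
        exact ⟨_, ⟨h1, rfl, h2 _ (Nat.lt_succ_self r) hr⟩, fun i h3 h4 => h2 i (by omega) h4⟩
      · rintro ⟨ξ, ⟨h1, rfl, h2⟩, h3⟩
        refine ⟨h1, fun i h4 h5 => ?_⟩
        rcases Nat.lt_or_ge (r + 1) i with h6 | h6
        · exact h3 i h6 h5
        · obtain rfl : i = r + 1 := by omega
          exact h2
    have hmeas : ∀ ξ, MeasurableSet (D ξ) := fun ξ => by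
      have hDξ : D ξ = (⋂ i, ⋂ (_ : i ≤ r), X i ⁻¹' {ζ i}) ∩
          X (r + 1) ⁻¹' {x | x = ξ ∧ ξ ∈ E (r + 1)} ∩
          ⋂ i, ⋂ (_ : r + 1 < i), ⋂ (_ : i ≤ L), X i ⁻¹' E i := by
        ext ω
        simp [hD]
      rw [hDξ]
      refine MeasurableSet.inter (MeasurableSet.inter ?_ (hX _ (Set.to_countable _).measurableSet)) ?_
      · exact MeasurableSet.iInter fun i => MeasurableSet.iInter fun _ =>
          hX i (measurableSet_singleton _)
      · exact MeasurableSet.iInter fun i => MeasurableSet.iInter fun _ =>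
          MeasurableSet.iInter fun _ => hX i (Set.to_countable _).measurableSet
    have hdisj : Pairwise (Function.onFun Disjoint D) := fun ξ ξ' hne => by
      refine Set.disjoint_left.2 fun ω h1 h2 => hne ?_
      rw [← h1.1.2.1, h2.1.2.1]
    rw [hunion, measureReal_def, measure_iUnion hdisj hmeas,
      ENNReal.tsum_toReal_eq fun ξ => measure_ne_top μ _, hV r hr, ← tsum_mul_left]
    refine tsum_congr fun ξ => ?_
    by_cases hξ : ξ ∈ E (r + 1)
    · have h1 := ih (Function.update ζ (r + 1) ξ) (by rwa [Function.update_of_ne (by omega)])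
      rw [Set.indicator_of_mem hξ, ← mul_assoc]
      rw [Finset.prod_range_succ, Function.update_self, Function.update_of_ne (by omega)] at h1
      have h2 : ∏ i ∈ Finset.range r, q i (Function.update ζ (r + 1) ξ i)
          (Function.update ζ (r + 1) ξ (i + 1)) = ∏ i ∈ Finset.range r, q i (ζ i) (ζ (i + 1)) :=
        Finset.prod_congr rfl fun i hi => by
          have := Finset.mem_range.1 hi
          rw [Function.update_of_ne (by omega), Function.update_of_ne (by omega)]
      rw [h2] at h1
      rw [← h1, measureReal_def]
      congr 2
      ext ω
      simp only [hD, Set.mem_ofPred_eq, hξ, and_true]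
      refine and_congr_left fun _ => ⟨fun ⟨h3, h4⟩ i hi => ?_, fun h3 => ⟨fun i hi => ?_, ?_⟩⟩
      · rcases Nat.lt_or_ge i (r + 1) with h5 | h5
        · rw [Function.update_of_ne (by omega), h3 i (by omega)]
        · obtain rfl : i = r + 1 := by omega
          rw [Function.update_self, h4]
      · have := h3 i (by omega)
        rwa [Function.update_of_ne (by omega)] at this
      · have := h3 (r + 1) le_rfl
        rwa [Function.update_self] at this
    · have : D ξ = ∅ := Set.eq_empty_of_forall_notMem fun ω h => hξ h.1.2.2
      rw [this, Set.indicator_of_notMem hξ]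
      simp

/-- Probabilities of path events of a discrete Markov chain, computed backwards. -/
theorem markov_paths (h0 : μ.real {ω | X 0 ω = y} = 1) :
    μ.real {ω | ∀ i, 0 < i → i ≤ L → X i ω ∈ E i} = V 0 y := by
  have h1 := markov_paths_aux hX hlaw hVL hV (Nat.zero_le L) (fun _ => y) rfl
  rw [Finset.range_zero, Finset.prod_empty, one_mul] at h1
  rw [← h1]
  have h2 : ∀ᵐ ω ∂μ, X 0 ω = y := by
    have hm : MeasurableSet {ω | X 0 ω = y} := hX 0 (measurableSet_singleton y)
    have h3 : μ {ω | X 0 ω = y} = 1 := by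
      rw [measureReal_def] at h0
      exact (ENNReal.toReal_eq_one_iff _).1 h0
    exact (prob_compl_eq_zero_iff hm).2 h3
  refine measureReal_congr ?_
  filter_upwards [h2] with ω hω
  refine propext ⟨fun h => ⟨fun i hi => ?_, h⟩, fun h => h.2⟩
  obtain rfl : i = 0 := by omega
  exact hω

end
end PushASEP

namespace PushASEP
open Filter Topology MeasureTheory

/-- The distribution of a PushASEP at a decreasing sequence of times in terms of the transition
function. -/
theorem IsPushASEP.exists_pathProb {Ω : Type*} [MeasurableSpace Ω] {μ : Measure Ω}
    [IsProbabilityMeasure μ] {v : ℕ → ℝ} {a b : ℝ → ℝ} {y : ℕ → ℤ} {x : ℕ → ℝ → Ω → ℤ}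
    (h : IsPushASEP μ v a b y x) (N : ℕ) :
    ∃ p : ℝ → ℝ → (Fin N → ℤ) → (Fin N → ℤ) → ℝ, IsTransitionFunction v a b p ∧
      ∀ (M : ℕ) (t : ℕ → ℝ) (n : ℕ → ℕ) (s : ℕ → ℝ), Antitone t → (∀ i, 0 ≤ t i) →
        (∀ i, 1 ≤ n i) → (∀ i, n i ≤ N) →
        μ.real {ω | ∀ i ≤ M, s i ≤ (x (n i) (t i) ω : ℝ)} =
          pathProb p t n s (M + 1) 0 fun k => y (k + 1) := by
  obtain ⟨p, hp, hlaw⟩ := h.law N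
  refine ⟨p, hp, fun M t n s ht ht0 hn1 hnN => ?_⟩
  -- The observation times decrease with the index, so they are reversed to run forward, with the
  -- initial time 0 put in front.
  set τ : ℕ → ℝ := fun i => if i = 0 then 0 else t (M + 1 - i) with hτ
  have hτ_succ : ∀ i, τ (i + 1) = t (M - i) := fun i => by simp [hτ]
  have hτ0 : ∀ i, 0 ≤ τ i := fun i => by
    simp only [hτ]; split_ifs
    exacts [le_rfl, ht0 _]
  have hτ_mono : Monotone τ := fun i j hij => by
    rcases Nat.eq_zero_or_pos i with rfl | hi
    · simpa [hτ] using hτ0 j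
    · simp only [hτ]
      rw [if_neg (by omega), if_neg (by omega)]
      exact ht (by omega)
  set X : ℕ → Ω → Fin N → ℤ := fun i ω k => x (k + 1) (τ i) ω with hX
  have key := markov_paths (μ := μ) (X := X) (L := M + 1) (y := fun k => y (k + 1))
    (q := fun i => p (τ i) (τ (i + 1)))
    (E := fun i => {ξ : Fin N → ℤ | s (M + 1 - i) ≤ ext ξ (n (M + 1 - i) - 1)})
    (V := fun i => pathProb p t n s (M + 1 - i) (τ i))
    (fun i => measurable_pi_lambda _ fun k => h.measurable _ _ (Nat.le_add_left 1 k) (hτ0 i))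
    ?_ ?_ ?_ ?_
  · simp only [Nat.sub_zero] at key
    rw [show τ 0 = 0 from rfl] at key
    rw [← key]
    congr 1
    ext ω
    simp only [Set.mem_ofPred_eq]
    have hval : ∀ i ≤ M, ext (X (M - i + 1) ω) (n i - 1) = x (n i) (t i) ω := fun i hi => by
      have h1 := hn1 i
      have h2 := hnN i
      rw [ext, dif_pos (by omega)]
      simp only [hX]
      rw [hτ_succ, Nat.sub_sub_self hi, Nat.sub_add_cancel h1]
    constructor
    · intro hω i hi hi'
      have h1 := hval (M + 1 - i) (by omega)
      rw [show M - (M + 1 - i) + 1 = i by omega] at h1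
      rw [h1]
      exact hω _ (by omega)
    · intro hω i hi
      have h1 := hω (M - i + 1) (by omega) (by omega)
      rw [show M + 1 - (M - i + 1) = i by omega, hval i hi] at h1
      exact h1
  · intro ζ hζ
    have h1 := hlaw (M + 1) (fun i => τ i) (fun i => ζ i) (fun i j hij => hτ_mono hij) rfl
      (fun k => by
        rw [Fin.val_zero, hζ])
    rw [Finset.prod_range]
    refine Eq.trans ?_ h1
    congr 1
    ext ω
    simp only [Set.mem_ofPred_eq]
    constructor
    · intro hω i k
      exact congrFun (hω i (Nat.lt_succ_iff.1 i.2)) k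
    · intro hω i hi
      funext k
      exact hω ⟨i, Nat.lt_succ_iff.2 hi⟩ k
  · funext ζ
    simp [pathProb]
  · intro i hi ζ
    rw [show M + 1 - i = M - i + 1 by omega, pathProb, hτ_succ, Nat.add_sub_add_right]
  · have h1 := hlaw 0 (fun _ => 0) (fun _ k => y (k + 1)) (fun _ _ _ => le_rfl) rfl fun _ => rfl
    rw [Finset.univ_eq_empty, Finset.prod_empty] at h1
    rw [← h1]
    congr 1
    ext ω
    simp only [Set.mem_ofPred_eq]
    constructor
    · intro hω i k
      exact congrFun hω k
    · intro hω
      funext k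
      exact hω 0 k

lemma HasFredholmDet.of_isEmpty {X : Type*} [IsEmpty X] (A : X → X → ℂ) : HasFredholmDet A 1 := by
  have := hasSum_single (f := fun q : Σ r : ℕ, (Fin r → X) =>
    (-1 : ℂ) ^ q.1 / (q.1.factorial : ℂ) *
      Matrix.det (Matrix.of fun i j : Fin q.1 => A (q.2 i) (q.2 j))) ⟨0, Fin.elim0⟩ (by
    rintro ⟨r, q⟩ hq
    rcases r with _ | r
    · exact absurd (by congr!) hq
    · exact isEmptyElim (q 0))
  simpa [HasFredholmDet] using this

lemma Prec.irrefl {n : ℕ} {t : ℝ} : ¬Prec n t n t := fun h => h.2.2 rfl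

lemma Prec.asymm {n n' : ℕ} {t t' : ℝ} (h : Prec n t n' t') : ¬Prec n' t' n t := fun h' =>
  h.2.2 (by rw [le_antisymm h.1 h'.1, le_antisymm h'.2.1 h.2.1])

end PushASEP

/-! ### Assembly -/

theorem proposition3p1
    (v : ℕ → ℝ) (hv : ∀ n, 1 ≤ n → 0 < v n)
    (a b : ℝ → ℝ)
    (ha : ContDiffOn ℝ (⊤ : ℕ∞) a (Set.Ici 0)) (hb : ContDiffOn ℝ (⊤ : ℕ∞) b (Set.Ici 0))
    (ha_mono : MonotoneOn a (Set.Ici 0)) (hb_mono : MonotoneOn b (Set.Ici 0))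
    (ha_zero : a 0 = 0) (hb_zero : b 0 = 0)
    (y : ℕ → ℤ) (hy : ∀ n, 1 ≤ n → y (n + 1) < y n) :
    -- the functions `Φ^{n,t}_{n-k}`, `1 ≤ k ≤ n`, are uniquely determined
    (∀ (n : ℕ) (t ρ : ℝ), 1 ≤ n → 0 ≤ t → PushASEP.IsSmallRadius v n ρ →
      ∃! Φ : Fin n → ℤ → ℂ, PushASEP.IsDual v a b y ρ n t Φ) ∧
    -- the joint distribution along a space-like sequence is a Fredholm determinant
    (∀ {Ω : Type*} [MeasurableSpace Ω] (μ : MeasureTheory.Measure Ω)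
      [MeasureTheory.IsProbabilityMeasure μ] (x : ℕ → ℝ → Ω → ℤ),
      PushASEP.IsPushASEP μ v a b y x →
      ∀ (m : ℕ) (n : Fin m → ℕ) (t : Fin m → ℝ) (s : Fin m → ℝ),
        (∀ k, 1 ≤ n k) → (∀ k, 0 ≤ t k) →
        (∀ i j, i < j → PushASEP.Prec (n i) (t i) (n j) (t j)) →
        ∀ ρ : ℝ, (∀ k, PushASEP.IsSmallRadius v (n k) ρ) →
        ∀ Φ : (n : ℕ) → ℝ → Fin n → ℤ → ℂ,
          (∀ k, PushASEP.IsDual v a b y ρ (n k) (t k) (Φ (n k) (t k))) →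
          PushASEP.HasFredholmDet
            (fun p q : Fin m × ℤ =>
              PushASEP.chi s p *
                PushASEP.kernel v a b y ρ Φ (n p.1) (t p.1) p.2 (n q.1) (t q.1) q.2 *
                PushASEP.chi s q)
            (μ.real {ω | ∀ k, s k ≤ (x (n k) (t k) ω : ℝ)} : ℂ)) := by
  refine ⟨fun n t ρ _ _ hρ => PushASEP.existsUnique_isDual hv hρ t, ?_⟩
  intro Ω _ μ _ x hx m n t s hn ht hprec ρ hρ Φ hΦ
  rcases m with _ | M
  · have : μ.real {ω | ∀ k : Fin 0, s k ≤ (x (n k) (t k) ω : ℝ)} = 1 := by simp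
    rw [this, Complex.ofReal_one]
    exact PushASEP.HasFredholmDet.of_isEmpty _
  -- The finite path is continued to all indices by repeating its last entry, to fit `Chain`, whose
  -- sequences are indexed by ℕ.
  set σ : ℕ → Fin (M + 1) := fun i => ⟨min i M, by omega⟩ with hσ
  have hσ_val : ∀ i : Fin (M + 1), σ i = i := fun i => Fin.ext (by simp only [hσ]; omega)
  have hσ_mono : Monotone σ := fun i j hij => by simp only [hσ, Fin.mk_le_mk]; omega
  have hmono : ∀ i j : Fin (M + 1), i ≤ j → n i ≤ n j ∧ t j ≤ t i := fun i j hij => by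
    rcases hij.eq_or_lt with rfl | h
    · exact ⟨le_rfl, le_rfl⟩
    · exact ⟨(hprec i j h).1, (hprec i j h).2.1⟩
  have hle : ∀ i, n (σ i) ≤ n (σ M) := fun i =>
    (hmono _ _ (by simp only [hσ, Fin.mk_le_mk]; omega)).1
  have hN : 1 ≤ n (σ M) := hn _
  have hρN := hρ (σ M)
  set Φ' : ℕ → ℕ → ℤ → ℂ := fun i k =>
    if hk : k < n (σ i) then Φ (n (σ i)) (t (σ i)) ⟨k, hk⟩ else 0 with hΦ'
  have hdual := fun i => (PushASEP.isDual_iff hv (hρ (σ i))).1 (hΦ (σ i))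
  have hchain : PushASEP.Chain v y (n (σ M)) (fun i => n (σ i)) (fun i => (a (t (σ i)) : ℂ))
      (fun i => (b (t (σ i)) : ℂ)) Φ' :=
    { pos := hv
      mono := fun i j hij => (hmono _ _ (hσ_mono hij)).1
      le := hle
      mem := fun i k hk => by
        simp only [hΦ', dif_pos hk]
        exact (hdual i).1 _
      zero := fun i k hk => by simp only [hΦ', dif_neg (not_lt.2 hk)]
      dual := fun i k l hk hl => by
        simp only [hΦ', dif_pos hk]
        simpa only [Fin.mk.injEq] using (hdual i).2 ⟨k, hk⟩ ⟨l, hl⟩ }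
  obtain ⟨p, hp, hprob⟩ := hx.exists_pathProb (n (σ M))
  have hanti : StrictAnti fun k : Fin (n (σ M)) => y (k + 1) := fun i j hij => by
    have hsa : StrictAnti fun k : ℕ => y (k + 1) :=
      strictAnti_nat_of_succ_lt fun k => hy (k + 1) (Nat.le_add_left 1 k)
    exact hsa hij
  have hprob_eq : (μ.real {ω | ∀ k, s k ≤ (x (n k) (t k) ω : ℝ)} : ℂ) =
      Matrix.det (Matrix.of fun k l : Fin (n (σ M)) =>
        PushASEP.conv (PushASEP.cutGe (s (σ M)) (Φ' M k - PushASEP.corr v (fun i => n (σ i))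
          (fun i => (a (t (σ i)) : ℂ)) (fun i => (b (t (σ i)) : ℂ)) (fun i => s (σ i)) Φ' M k))
          (PushASEP.psi v (fun i => n (σ i)) (fun i => (a (t (σ i)) : ℂ))
            (fun i => (b (t (σ i)) : ℂ)) M l) (y (l + 1))) := by
    rw [← hchain.levelFun_init (s := fun i => s (σ i)) hN hρN rfl (η := PushASEP.ext
      fun k : Fin (n (σ M)) => y (k + 1)) fun l hl => by rw [PushASEP.ext, dif_pos hl]]
    have h1 := PushASEP.Chain.pathProb_eq (t := fun i => t (σ i)) (s := fun i => s (σ i)) ha hb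
      ha_mono hb_mono hN hp hchain (fun i => hn _) (fun i j hij => (hmono _ _ (hσ_mono hij)).2)
      (fun i => ht _) hρN M le_rfl (ht _) hanti
    rw [ha_zero, hb_zero, Complex.ofReal_zero] at h1
    rw [← h1, ← hprob M (fun i => t (σ i)) (fun i => n (σ i)) (fun i => s (σ i))
      (fun i j hij => (hmono _ _ (hσ_mono hij)).2) (fun i => ht _) (fun i => hn _) hle]
    congr 2
    ext ω
    simp only [Set.mem_ofPred_eq]
    refine ⟨fun h i _ => h (σ i), fun h k => ?_⟩
    have := h k (Nat.lt_succ_iff.1 k.2)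
    rwa [hσ_val] at this
  rw [hprob_eq]
  convert hchain.hasFredholmDet (s := fun i => s (σ i)) hN (M := M) rfl using 1
  funext ⟨i, x₁⟩ ⟨j, x₂⟩
  have h1 := hchain.kernel_eq hρN (Nat.lt_succ_iff.1 j.2) (Nat.lt_succ_iff.1 i.2)
    (ψ := fun k => PushASEP.Psi v a b y ρ (n i) (t i) (k + 1) x₁) x₁ x₂ fun k c hk hc =>
      PushASEP.Psi_eq hv hρN (Nat.succ_le_of_lt (hk.trans_le (hle j)))
        (by simpa only [hσ_val] using hc) x₁
  simp only [PushASEP.chi, hσ_val, ← h1]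
  congr 2
  rw [PushASEP.kernel]
  refine congrArg₂ (· + ·) (congrArg Neg.neg ?_) ?_
  -- Along the path the order `≺` is the order of the indices, so the indicator in φ is that of i <
  -- j.
  · split_ifs with hij
    · rw [PushASEP.phi_eq hv (hρ j) (hprec i j hij), PushASEP.cin, hσ_val, hσ_val]
    · rw [PushASEP.phi, if_neg]
      rcases (not_lt.1 hij).eq_or_lt with h | h
      · have : i = j := (Fin.ext h).symm
        subst this
        exact PushASEP.Prec.irrefl
      · exact (hprec j i h).asymm
  · rw [Finset.sum_range]
    refine Finset.sum_congr rfl fun k _ => ?_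
    have hk : ∀ j', j' = j → (if hk : (k : ℕ) < n j' then Φ (n j') (t j') ⟨k, hk⟩ else 0) =
        Φ (n j) (t j) k := by
      rintro _ rfl
      simp
    simp only [hΦ', hk _ (hσ_val j)]
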